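/- Let $M$ be a connected, second countable, Hausdorff smooth manifold without boundary, of finite dimension $n\ge 1$. Let $\mathcal X(M)$ be the space of smooth vector fields on $M$, and let $\mathcal D^1(M)$ be the real Lie algebra, under the commutator bracket, of linear differential operators of order at most one on $C^\infty(M)$, that is, of the $\mathbb R$-linear maps $D:C^\infty(M)\to C^\infty(M)$ such that for every $f\in C^\infty(M)$ the commutator of $D$ with the multiplication by $f$ is the multiplication by a smooth function. Then $\mathcal D^1(M)=C^\infty(M)\oplus\mathcal X(M)$: every $D\in\mathcal D^1(M)$ is, for a unique $f\in C^\infty(M)$ and a unique $X\in\mathcal X(M)$, the operator $f+X: g\mapsto fg+X(g)$. Fix a nowhere vanishing smooth tensor $1$-density $\rho_0$ on $M$, and let $\operatorname{div}$ be the divergence with respect to it: in local coordinates in which $\rho_0$ has the coefficient $r$, $\operatorname{div}X=r^{-1}\sum_i\partial_i(rX^i)$. A linear map $\Phi:\mathcal D^1(M)\to\mathcal D^1(M)$ is an automorphism of the Lie algebra $\mathcal D^1(M)$ if and only if it can be written in the form $$\Phi(f+X)=\bigl(\kappa f+\lambda\operatorname{div}X+\omega(X)\bigr)\circ\varphi^{-1}+\varphi_*(X)\qquad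 (f\in C^\infty(M),\ X\in\mathcal X(M)),$$ where $\varphi$ is a diffeomorphism of $M$, $\kappa\ne 0$ and $\lambda$ are real constants, $\omega$ is a closed (smooth) $1$-form on $M$, and $\varphi_*$ is defined by $(\varphi_*(X))(g)=(X(g\circ\varphi))\circ\varphi^{-1}$. Conversely, for all such $\varphi,\kappa,\lambda,\omega$ this formula defines an automorphism of $\mathcal D^1(M)$. All the objects $\varphi,\lambda,\kappa,\omega$ are uniquely determined by $\Phi$. -/

import Mathlib

open scoped Manifold ContDiff Bundle

attribute [local instance 100] LieRing.ofAssociativeRing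

/-- The filtration `D⁰(A) ⊆ D¹(A) ⊆ ⋯` of the linear differential operators on a commutative
unital algebra `A`: `D⁰(A)` consists of the multiplications `m_f : g ↦ f * g`, and
`D ∈ Dⁱ⁺¹(A)` iff `[D, m_f] ∈ Dⁱ(A)` for all `f`. -/
def diffOp (K A : Type*) [Field K] [CommRing A] [Algebra K A] :
    ℕ → Submodule K (Module.End K A)
  | 0 => LinearMap.range (LinearMap.mul K A)
  | i + 1 =>
    { carrier := {D | ∀ f : A, ⁅D, LinearMap.mul K A f⁆ ∈ diffOp K A i}
      add_mem' := fun {D E} hD hE f => by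
        rw [add_lie]
        exact Submodule.add_mem _ (hD f) (hE f)
      zero_mem' := fun f => by
        rw [zero_lie]
        exact Submodule.zero_mem _
      smul_mem' := fun c D hD f => by
        rw [smul_lie]
        exact Submodule.smul_mem _ c (hD f) }

/-- The Lie algebra `D¹(A)` of differential operators of order at most one, with the commutator
bracket. -/
def diffOpOne (K A : Type*) [Field K] [CommRing A] [Algebra K A] :
    LieSubalgebra K (Module.End K A) :=
  { diffOp K A 1 with
    lie_mem' := by
      intro D E hD hE f
      obtain ⟨g, hg⟩ := hE f
      obtain ⟨h, hh⟩ := hD f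
      rw [lie_lie, ← hg, ← hh]
      exact Submodule.sub_mem _ (hD g) (hE h) }

/-- Lie algebra automorphisms: bijective linear maps that preserve the bracket. -/
def IsLieAutomorphism {K L : Type*} [CommRing K] [LieRing L] [LieAlgebra K L]
    (Φ : L →ₗ[K] L) : Prop :=
  Function.Bijective Φ ∧ ∀ a b : L, Φ ⁅a, b⁆ = ⁅Φ a, Φ b⁆

section Manifold

variable {n : ℕ}

/-- The algebra `C^∞(M)` of smooth real functions. -/
abbrev SmoothFn (n : ℕ) (M : Type*) [TopologicalSpace M]
    [ChartedSpace (EuclideanSpace ℝ (Fin n)) M] : Type _ :=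
  C^∞⟮𝓡 n, M; 𝓘(ℝ, ℝ), ℝ⟯

variable (M : Type*) [TopologicalSpace M] [ChartedSpace (EuclideanSpace ℝ (Fin n)) M]
  [IsManifold (𝓡 n) ∞ M]

/-- The space of smooth vector fields: smooth sections of the tangent bundle. -/
abbrev SmoothVectorField (n : ℕ) (M : Type*) [TopologicalSpace M]
    [ChartedSpace (EuclideanSpace ℝ (Fin n)) M] [IsManifold (𝓡 n) ∞ M] : Type _ :=
  Cₛ^∞⟮𝓡 n; EuclideanSpace ℝ (Fin n), (TangentSpace (𝓡 n) : M → Type _)⟯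

/-- The space of smooth 1-forms: smooth sections of the cotangent bundle. -/
abbrev SmoothOneForm (n : ℕ) (M : Type*) [TopologicalSpace M]
    [ChartedSpace (EuclideanSpace ℝ (Fin n)) M] [IsManifold (𝓡 n) ∞ M] : Type _ :=
  Cₛ^∞⟮𝓡 n; EuclideanSpace ℝ (Fin n) →L[ℝ] ℝ,
    (fun x : M => TangentSpace (𝓡 n) x →L[ℝ] Bundle.Trivial M ℝ x)⟯

variable {M}

/-- A smooth vector field `X` as a linear operator on smooth functions: `(X g)(x) = dg_x (X_x)`. -/
noncomputable def SmoothVectorField.toEnd (X : SmoothVectorField n M) :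
    Module.End ℝ (SmoothFn n M) where
  toFun g :=
    ⟨fun x => mfderiv (𝓡 n) 𝓘(ℝ, ℝ) g x (X x), by
      have h1 := g.contMDiff.contMDiff_tangentMap (m := ∞) (by simp)
      exact (contMDiff_snd_tangentBundle_modelSpace ℝ 𝓘(ℝ, ℝ)).comp
        (h1.comp X.contMDiff)⟩
  map_add' g h := by
    ext x
    have hg : MDifferentiableAt (𝓡 n) 𝓘(ℝ, ℝ) g x := g.contMDiff.mdifferentiable (by simp) x
    have hh : MDifferentiableAt (𝓡 n) 𝓘(ℝ, ℝ) h x := h.contMDiff.mdifferentiable (by simp) x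
    exact DFunLike.congr_fun (mfderiv_add hg hh) (X x)
  map_smul' c g := by
    ext x
    have hg : MDifferentiableAt (𝓡 n) 𝓘(ℝ, ℝ) g x := g.contMDiff.mdifferentiable (by simp) x
    exact DFunLike.congr_fun (const_smul_mfderiv hg c) (X x)

theorem SmoothVectorField.toEnd_mul (X : SmoothVectorField n M) (g h : SmoothFn n M) :
    X.toEnd (g * h) = g * X.toEnd h + h * X.toEnd g := by
  ext x
  have hg : MDifferentiableAt (𝓡 n) 𝓘(ℝ, ℝ) g x := g.contMDiff.mdifferentiable (by simp) x
  have hh : MDifferentiableAt (𝓡 n) 𝓘(ℝ, ℝ) h x := h.contMDiff.mdifferentiable (by simp) x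
  exact DFunLike.congr_fun (hg.hasMFDerivAt.mul hh.hasMFDerivAt).mfderiv (X x)

/-- The first-order differential operator `f + X : g ↦ f * g + X g`, for a smooth function `f` and
a smooth vector field `X`. -/
noncomputable def firstOrderOp (f : SmoothFn n M) (X : SmoothVectorField n M) :
    diffOpOne ℝ (SmoothFn n M) :=
  ⟨LinearMap.mul ℝ (SmoothFn n M) f + X.toEnd, by
    intro g
    refine ⟨X.toEnd g, ?_⟩
    refine LinearMap.ext fun h => ?_
    have hX : X.toEnd (g * h) = g * X.toEnd h + h * X.toEnd g := X.toEnd_mul g h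
    simp only [LieRing.of_associative_ring_bracket, LinearMap.mul_apply', LinearMap.sub_apply,
      Module.End.mul_apply, LinearMap.add_apply, hX]
    ring⟩

/-- The operator `g ↦ (X (g ∘ φ)) ∘ φ⁻¹`, that is, the push-forward `φ_* X`. -/
noncomputable def pushforwardOp (φ : M ≃ₘ^∞⟮𝓡 n, 𝓡 n⟯ M) (X : SmoothVectorField n M)
    (g : SmoothFn n M) : SmoothFn n M :=
  (X.toEnd (g.comp φ.toContMDiffMap)).comp φ.symm.toContMDiffMap

/-- A smooth tensor density of weight one. At each point it is a function of `n` tangent vectors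
that is multiplied by `|det A|` when a linear map `A` is applied to these vectors. Smoothness is
that of the coefficient `r = ρ(∂₁, …, ∂ₙ)` in the charts. -/
structure SmoothDensity (n : ℕ) (M : Type*) [TopologicalSpace M]
    [ChartedSpace (EuclideanSpace ℝ (Fin n)) M] where
  toFun : (x : M) → (Fin n → TangentSpace (𝓡 n) x) → ℝ
  map_linear : ∀ (x : M) (A : TangentSpace (𝓡 n) x →ₗ[ℝ] TangentSpace (𝓡 n) x)
    (v : Fin n → TangentSpace (𝓡 n) x),
    toFun x (fun i => A (v i)) = |LinearMap.det A| * toFun x v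
  smooth : ∀ x₀ : M, ContDiffOn ℝ ∞
    (fun u : EuclideanSpace ℝ (Fin n) =>
      toFun ((extChartAt (𝓡 n) x₀).symm u) fun i =>
        mfderiv 𝓘(ℝ, EuclideanSpace ℝ (Fin n)) (𝓡 n) (extChartAt (𝓡 n) x₀).symm u
          (EuclideanSpace.single i 1))
    (extChartAt (𝓡 n) x₀).target

/-- The density vanishes at no point. -/
def SmoothDensity.IsNowhereVanishing (ρ : SmoothDensity n M) : Prop :=
  ∀ x : M, ∃ v : Fin n → TangentSpace (𝓡 n) x, ρ.toFun x v ≠ 0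

/-- The coefficient `r = ρ(∂₁, …, ∂ₙ)` of a density in the chart around `x₀`. -/
noncomputable def SmoothDensity.coeff (ρ : SmoothDensity n M) (x₀ : M)
    (u : EuclideanSpace ℝ (Fin n)) : ℝ :=
  ρ.toFun ((extChartAt (𝓡 n) x₀).symm u) fun i =>
    mfderiv 𝓘(ℝ, EuclideanSpace ℝ (Fin n)) (𝓡 n) (extChartAt (𝓡 n) x₀).symm u
      (EuclideanSpace.single i 1)

/-- The vector field `(X¹, …, Xⁿ)` on `ℝⁿ` that represents `X` in the chart around `x₀`. -/
noncomputable def SmoothVectorField.inChart (X : SmoothVectorField n M) (x₀ : M)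
    (u : EuclideanSpace ℝ (Fin n)) : EuclideanSpace ℝ (Fin n) :=
  VectorField.mpullback 𝓘(ℝ, EuclideanSpace ℝ (Fin n)) (𝓡 n) (extChartAt (𝓡 n) x₀).symm X u

/-- The divergence of `X` with respect to a nowhere vanishing density `ρ`, in coordinates
`r⁻¹ ∑ᵢ ∂ᵢ (r Xⁱ)`; its value at `x` is computed in the preferred chart around `x`. -/
noncomputable def divergence (ρ : SmoothDensity n M) (X : SmoothVectorField n M) (x : M) : ℝ :=
  (ρ.coeff x (extChartAt (𝓡 n) x x))⁻¹ *
    ∑ i : Fin n, fderiv ℝ (fun u => ρ.coeff x u * X.inChart x u i) (extChartAt (𝓡 n) x x)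
      (EuclideanSpace.single i 1)

/-- The covector field on `ℝⁿ` that represents the 1-form `η` in the chart around `x₀`. -/
noncomputable def SmoothOneForm.inChart (η : SmoothOneForm n M) (x₀ : M)
    (u : EuclideanSpace ℝ (Fin n)) : EuclideanSpace ℝ (Fin n) →L[ℝ] ℝ :=
  (η ((extChartAt (𝓡 n) x₀).symm u) : TangentSpace (𝓡 n) ((extChartAt (𝓡 n) x₀).symm u) →L[ℝ] ℝ).comp
    (mfderiv 𝓘(ℝ, EuclideanSpace ℝ (Fin n)) (𝓡 n) (extChartAt (𝓡 n) x₀).symm u)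

/-- `dη = 0`: in the charts, `∂ᵢ ηⱼ = ∂ⱼ ηᵢ`. -/
def SmoothOneForm.IsClosed (η : SmoothOneForm n M) : Prop :=
  ∀ x₀ : M, ∀ u ∈ (extChartAt (𝓡 n) x₀).target, ∀ v w : EuclideanSpace ℝ (Fin n),
    fderiv ℝ (η.inChart x₀) u v w = fderiv ℝ (η.inChart x₀) u w v

/-- `Φ(f + X) = (κ f + λ div X + η(X)) ∘ φ⁻¹ + φ_*(X)` for all `f` and `X`, as an equality of
operators on smooth functions `g`, evaluated at the points `x`. -/
def HasStandardForm (ρ : SmoothDensity n M)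
    (Φ : diffOpOne ℝ (SmoothFn n M) →ₗ[ℝ] diffOpOne ℝ (SmoothFn n M))
    (φ : M ≃ₘ^∞⟮𝓡 n, 𝓡 n⟯ M) (κ l : ℝ) (η : SmoothOneForm n M) : Prop :=
  ∀ (f : SmoothFn n M) (X : SmoothVectorField n M) (g : SmoothFn n M) (x : M),
    (Φ (firstOrderOp f X)).1 g x =
      (κ * f (φ.symm x) + l * divergence ρ X (φ.symm x) + η (φ.symm x) (X (φ.symm x))) * g x
        + pushforwardOp φ X g x

end Manifold

/-! The Lie algebra `D¹(A) = A ⊕ Der A` remembers the algebra `A = C^∞(M)`. Multiplications satisfy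
`[m_f, [m_f, D]] = 0` for all `D`; an operator `b + X` with this property has `X (X h) = 0` for all
`h`, and then `X (X (g²)) = 2 (X g)²` forces `X = 0`, as `A` is reduced. So an automorphism
restricts to a linear bijection `ψ` of `A`, and it induces a map `θ` of `Der A` onto itself with `θ
X (ψ f) = ψ (X f)`. Hence `ψ 1` is killed by all derivations and is a constant `κ ≠ 0`. The
conjugate of `m_{ψ f}` by `ψ` composes with every derivation to a derivation, so it is a
multiplication (`eq_mul_of_comp_derivation`); this makes `σ = κ⁻¹ ψ` an algebra automorphism
(`IsLieAutomorphism.exists_algEquiv`). The rest of the automorphism is a cocycle `c : Der A → A`.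

For such a cocycle (`cocycle_eq_divergence_add`) consider the defect `δ_X a = c (a X) - a c X`.
Since `c` vanishes wherever a field vanishes to second order, `δ_X` is a derivation. It is
`A`-linear in `X` and compatible with brackets, which forces `δ_X = l X` with a constant `l`. The
divergence has the defect `X a`, so `c - l div` is `A`-linear, that is, a 1-form; it is closed
because the divergence is a cocycle too.

The algebra uses three facts about `M`: functions killed by all fields are constant (connectedness),
points separate functions, and the derivatives `X h` generate the unit ideal
(`derivativeIdeal_eq_top`). The last needs care if `M` is not compact, as `1` must be a finite sum:
two functions without common critical points exist by a dimension count, and a partition of unity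
does the rest.

The dictionary with geometry: derivations are vector fields (Hadamard's lemma), algebra
automorphisms come from diffeomorphisms because characters are point evaluations, and `A`-linear
maps `Der A → A` are 1-forms. -/

/-! ### First-order operators, their automorphisms and cocycles over a commutative algebra. -/

section Algebra

variable {K A : Type*} [Field K] [CommRing A] [Algebra K A]

/-- The ideal generated by all derivatives `X h`. -/
def derivativeIdeal (K A : Type*) [Field K] [CommRing A] [Algebra K A] : Ideal A :=
  Ideal.span {a | ∃ (X : Derivation K A A) (h : A), X h = a}

/-- The radical of this ideal contains every `X h`, since the square of `X h` is a generator.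
Squares are the elements on which the antisymmetric identities used below can be resolved. -/
theorem span_sq_derivative_eq_top (hI : derivativeIdeal K A = ⊤) :
    Ideal.span {a : A | ∃ (X : Derivation K A A) (h : A), X h * X h = a} = ⊤ := by
  rw [← Ideal.radical_eq_top, ← top_le_iff, ← hI, derivativeIdeal, Ideal.span_le]
  rintro _ ⟨X, h, rfl⟩
  refine ⟨2, Ideal.subset_span ⟨X, h, ?_⟩⟩
  rw [sq]

/-- An additive map whose compositions with all derivations are derivations is a
multiplication. -/
theorem eq_mul_of_comp_derivation [CharZero K] (hI : derivativeIdeal K A = ⊤) (L : A →ₗ[K] A)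
    (hL : ∀ X : Derivation K A A, ∃ Y : Derivation K A A, ∀ f, Y f = L (X f)) (f : A) :
    L f = f * L 1 := by
  have h2 : ∀ a : A, a + a = 0 → a = 0 := fun a ha => by
    have : (2 : K) • a = 0 := by rw [two_smul, ha]
    exact (smul_eq_zero_iff_right (two_ne_zero)).1 this
  -- The Leibniz rule of `L ∘ X` on `f * h`: the defect `L (f * X h) - f * L (X h)` is antisymmetric
  -- in `f` and `h`.
  have key : ∀ (X : Derivation K A A) (f h : A),
      (L (f * X h) - f * L (X h)) + (L (h * X f) - h * L (X f)) = 0 := by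
    intro X f h
    obtain ⟨Y, hY⟩ := hL X
    have h1 := Y.leibniz f h
    rw [hY, hY, hY, X.leibniz, map_add] at h1
    simp only [smul_eq_mul] at h1
    linear_combination h1
  have hsq : ∀ u : A, L (f * u) - f * L u = 0 := by
    intro u
    have hu : u ∈ Ideal.span {a : A | ∃ (X : Derivation K A A) (h : A), X h * X h = a} := by
      rw [span_sq_derivative_eq_top hI]; trivial
    induction hu using Submodule.closure_induction with
    | zero => simp
    | add x y _ _ hx hy =>
      rw [mul_add, map_add, map_add]
      linear_combination hx + hy
    | smul_mem r x hx =>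
      obtain ⟨X, h, rfl⟩ := hx
      -- `e1` contains the wanted defect and a second one, at `h` and `r * X h * X f`. The choice `f
      -- = h` in `e2` shows that twice the second defect is zero.
      have e1 := key ((r * X h) • X) f h
      have e2 := key ((r * X f) • X) h h
      have e3 := h2 _ e2
      simp only [Derivation.coe_smul, Pi.smul_apply, smul_eq_mul] at e1 e3 ⊢
      have e4 : r * X f * X h = r * X h * X f := by ring
      rw [e4] at e3
      rw [e3, add_zero] at e1
      rw [← mul_assoc r]
      exact e1
  have := hsq 1
  rw [mul_one] at this
  exact sub_eq_zero.1 this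

/-- The operator `f + X`, for a derivation `X`. -/
def derivationOp (f : A) (X : Derivation K A A) : diffOpOne K A :=
  ⟨LinearMap.mul K A f + X.toLinearMap, by
    intro g
    refine ⟨X g, LinearMap.ext fun h => ?_⟩
    simp only [LieRing.of_associative_ring_bracket, LinearMap.mul_apply', LinearMap.sub_apply,
      Module.End.mul_apply, LinearMap.add_apply, Derivation.coeFn_coe,
      Derivation.leibniz, smul_eq_mul]
    ring⟩

@[simp] theorem derivationOp_apply (f : A) (X : Derivation K A A) (g : A) :
    (derivationOp f X).1 g = f * g + X g := rfl

theorem derivationOp_injective {f f' : A} {X X' : Derivation K A A}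
    (h : derivationOp f X = derivationOp f' X') : f = f' ∧ X = X' := by
  have h1 : ∀ g, f * g + X g = f' * g + X' g := fun g => by
    rw [← derivationOp_apply, ← derivationOp_apply, h]
  have hf : f = f' := by simpa using h1 1
  subst hf
  exact ⟨rfl, Derivation.ext fun g => by simpa using h1 g⟩

/-- The commutator of `D` with `m_f` is the multiplication by its value at `1`, which is `D f - f *
D 1`. Its value at `g` then gives the Leibniz rule for `D - D 1`. -/
theorem exists_derivationOp_eq (D : diffOpOne K A) :
    ∃ (f : A) (X : Derivation K A A), derivationOp f X = D := by
  obtain ⟨D, hD⟩ := D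
  have hD' : ∀ f g : A, D (f * g) = f * D g + g * D f - f * g * D 1 := by
    intro f g
    obtain ⟨h, hh⟩ := hD f
    have e : ∀ g, h * g = D (f * g) - f * D g := fun g => LinearMap.congr_fun hh g
    have e1 := e 1
    have e2 := e g
    simp only [mul_one] at e1
    linear_combination -e2 + g * e1
  refine ⟨D 1, Derivation.mk' (D - LinearMap.mul K A (D 1)) fun a b => ?_, ?_⟩
  · simp only [LinearMap.sub_apply, LinearMap.mul_apply', smul_eq_mul, hD' a b]
    ring
  · refine Subtype.ext (LinearMap.ext fun g => ?_)
    rw [derivationOp_apply]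
    simp

theorem lie_derivationOp (f f' : A) (X X' : Derivation K A A) :
    ⁅derivationOp f X, derivationOp f' X'⁆ = derivationOp (X f' - X' f) (⁅X, X'⁆ : Derivation K A A) := by
  refine Subtype.ext (LinearMap.ext fun g => ?_)
  change (derivationOp f X).1 ((derivationOp f' X').1 g)
    - (derivationOp f' X').1 ((derivationOp f X).1 g) = _
  simp only [derivationOp_apply, map_add, Derivation.leibniz, smul_eq_mul,
    Derivation.commutator_apply]
  ring

theorem derivationOp_add (f f' : A) (X X' : Derivation K A A) :
    derivationOp (f + f') (X + X') = derivationOp f X + derivationOp f' X' := by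
  refine Subtype.ext (LinearMap.ext fun g => ?_)
  change (f + f') * g + (X g + X' g) = (f * g + X g) + (f' * g + X' g)
  ring

theorem derivationOp_smul (c : K) (f : A) (X : Derivation K A A) :
    derivationOp (c • f) (c • X) = c • derivationOp f X := by
  refine Subtype.ext (LinearMap.ext fun g => ?_)
  change (c • f) * g + c • X g = c • (f * g + X g)
  rw [smul_add, smul_mul_assoc]

/-- Applying `X` twice to `g²` leaves only `2 (X g)²`, so `X g` is nilpotent. -/
theorem derivation_eq_zero_of_sq [CharZero K] [IsReduced A] (X : Derivation K A A)
    (hX : ∀ h, X (X h) = 0) : X = 0 := by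
  refine Derivation.ext fun g => ?_
  have h1 := hX (g * g)
  simp only [Derivation.leibniz, map_add, smul_eq_mul, hX] at h1
  have h2 : (2 : K) • (X g * X g) = 0 := by
    rw [two_smul]
    linear_combination h1
  have h3 : X g * X g = 0 := (smul_eq_zero_iff_right two_ne_zero).1 h2
  exact pow_eq_zero_iff two_ne_zero |>.1 ((sq _).trans h3)

/-- Multiplications are singled out by `[m_f, [m_f, D]] = 0` for all `D`, a property that `Φ`
preserves. For `b + X` in place of `m_f` and `D = m_h`, the double bracket is `X (X h)`. -/
theorem IsLieAutomorphism.map_mul_left [CharZero K] [IsReduced A]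
    {Φ : diffOpOne K A →ₗ[K] diffOpOne K A} (hΦ : IsLieAutomorphism Φ) (f : A) :
    ∃ b, Φ (derivationOp f 0) = derivationOp b (0 : Derivation K A A) := by
  obtain ⟨b, X, hX⟩ := exists_derivationOp_eq (Φ (derivationOp f (0 : Derivation K A A)))
  refine ⟨b, ?_⟩
  suffices X = 0 by rw [← hX, this]
  refine derivation_eq_zero_of_sq X fun h => ?_
  obtain ⟨D, hD⟩ := hΦ.1.2 (derivationOp h (0 : Derivation K A A))
  obtain ⟨a, Y, rfl⟩ := exists_derivationOp_eq D
  have h1 : ⁅derivationOp f (0 : Derivation K A A),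
      ⁅derivationOp f (0 : Derivation K A A), derivationOp a Y⁆⁆ = 0 := by
    rw [lie_derivationOp, lie_derivationOp]
    refine Subtype.ext (LinearMap.ext fun g => ?_)
    simp
  have h2 := congrArg Φ h1
  rw [hΦ.2, hΦ.2, hD, ← hX, lie_derivationOp, lie_derivationOp, map_zero] at h2
  have h3 := congrArg (fun D => D.1 1) h2
  simpa using h3

theorem IsLieAutomorphism.exists_inverse {Φ : diffOpOne K A →ₗ[K] diffOpOne K A}
    (hΦ : IsLieAutomorphism Φ) :
    ∃ Ψ : diffOpOne K A →ₗ[K] diffOpOne K A, IsLieAutomorphism Ψ ∧ ∀ D, Φ (Ψ D) = D := by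
  let e := LinearEquiv.ofBijective Φ hΦ.1
  refine ⟨e.symm.toLinearMap, ⟨e.symm.bijective, fun a b => ?_⟩, fun D => e.apply_symm_apply D⟩
  refine hΦ.1.1 ?_
  rw [hΦ.2]
  change e (e.symm _) = ⁅e (e.symm a), e (e.symm b)⁆
  simp only [LinearEquiv.apply_symm_apply]

/-- A Lie automorphism of `D¹(A)` is, up to a cocycle and a constant factor on `A`, the
conjugation by an automorphism of the algebra `A`. -/
theorem IsLieAutomorphism.exists_algEquiv [CharZero K] [IsReduced A] [Nontrivial A]
    (hI : derivativeIdeal K A = ⊤)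
    (hconst : ∀ f : A, (∀ X : Derivation K A A, X f = 0) → ∃ c : K, f = algebraMap K A c)
    {Φ : diffOpOne K A →ₗ[K] diffOpOne K A} (hΦ : IsLieAutomorphism Φ) :
    ∃ (σ : A ≃ₐ[K] A) (κ : K) (c : Derivation K A A →ₗ[K] A), κ ≠ 0 ∧
      (∀ X Y, c ⁅X, Y⁆ = X (c Y) - Y (c X)) ∧
      ∀ f X g, (Φ (derivationOp f X)).1 (σ g) = σ ((κ • f + c X) * g + X g) := by
  choose ψ₀ hψ₀ using hΦ.map_mul_left
  have hsmul0 : ∀ (c : K) (f : A), derivationOp (c • f) (0 : Derivation K A A)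
      = c • derivationOp f 0 := fun c f => by
    rw [← derivationOp_smul, smul_zero]
  have hadd0 : ∀ f f' : A, derivationOp (f + f') (0 : Derivation K A A)
      = derivationOp f 0 + derivationOp f' 0 := fun f f' => by
    rw [← derivationOp_add, add_zero]
  have hψinj : Function.Injective ψ₀ := fun a b hab => by
    have := (hψ₀ a).trans ((congrArg (derivationOp · 0) hab).trans (hψ₀ b).symm)
    exact (derivationOp_injective (hΦ.1.1 this)).1
  obtain ⟨Ψ, hΨ, hΦΨ⟩ := hΦ.exists_inverse
  -- The inverse is an automorphism as well, so it also maps multiplications to multiplications.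
  have hψsurj : Function.Surjective ψ₀ := fun b => by
    obtain ⟨a, ha⟩ := hΨ.map_mul_left b
    refine ⟨a, ?_⟩
    have := hΦΨ (derivationOp b 0)
    rw [ha, hψ₀] at this
    exact (derivationOp_injective this).1
  let ψ₁ : A →ₗ[K] A :=
    { toFun := ψ₀
      map_add' := fun a b => by
        refine (derivationOp_injective (K := K) (X := 0) (X' := 0) ?_).1
        rw [← hψ₀, hadd0, hadd0, map_add, hψ₀, hψ₀]
      map_smul' := fun c a => by
        refine (derivationOp_injective (K := K) (X := 0) (X' := 0) ?_).1
        rw [RingHom.id_apply, ← hψ₀, hsmul0, hsmul0, map_smul, hψ₀] }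
  let ψ : A ≃ₗ[K] A := LinearEquiv.ofBijective ψ₁ ⟨hψinj, hψsurj⟩
  have hψ : ∀ f, Φ (derivationOp f 0) = derivationOp (ψ f) 0 := hψ₀
  choose c₀ θ hθ using fun X : Derivation K A A => exists_derivationOp_eq (Φ (derivationOp 0 X))
  have hΦ_apply : ∀ f X, Φ (derivationOp f X) = derivationOp (ψ f + c₀ X) (θ X) := fun f X => by
    have : derivationOp f X = derivationOp f 0 + derivationOp 0 X := by
      rw [← derivationOp_add, add_zero, zero_add]
    rw [this, map_add, hψ, ← hθ, ← derivationOp_add, zero_add]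
  -- The image under `Φ` of the relation `[X, m_f] = m_{X f}`.
  have hθψ : ∀ X f, θ X (ψ f) = ψ (X f) := fun X f => by
    have h1 := hΦ.2 (derivationOp 0 X) (derivationOp f 0)
    rw [← hθ, hψ, lie_derivationOp, lie_derivationOp] at h1
    simp only [Derivation.coe_zero, Pi.zero_apply, sub_zero, lie_zero] at h1
    rw [hψ] at h1
    exact (derivationOp_injective h1).1.symm
  have hθsurj : ∀ Y, ∃ X, θ X = Y := fun Y => by
    obtain ⟨D, hD⟩ := hΦ.1.2 (derivationOp 0 Y)
    obtain ⟨f, X, rfl⟩ := exists_derivationOp_eq D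
    rw [hΦ_apply] at hD
    exact ⟨X, (derivationOp_injective hD).2⟩
  obtain ⟨κ, hκ⟩ := hconst (ψ 1) fun Y => by
    obtain ⟨X, rfl⟩ := hθsurj Y
    rw [hθψ, Derivation.map_one_eq_zero, map_zero]
  have hκ0 : κ ≠ 0 := by
    rintro rfl
    rw [map_zero] at hκ
    exact one_ne_zero (ψ.injective (hκ.trans (map_zero ψ).symm))
  -- The composition of `ψ⁻¹ ∘ m_{ψ f} ∘ ψ` with `X` is the derivation `X'` for which `θ X' = ψ f •
  -- θ X`. So this conjugate is a multiplication, namely by its value `κ f` at `1`.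
  have hmul : ∀ f g, ψ f * ψ g = κ • ψ (f * g) := by
    intro f g
    have h1 := eq_mul_of_comp_derivation hI
      (ψ.symm.toLinearMap ∘ₗ LinearMap.mul K A (ψ f) ∘ₗ ψ.toLinearMap) (fun X => by
        obtain ⟨X', hX'⟩ := hθsurj (ψ f • θ X)
        refine ⟨X', fun h => ?_⟩
        change _ = ψ.symm (ψ f * ψ (X h))
        rw [ψ.eq_symm_apply, ← hθψ, ← hθψ, hX', Derivation.smul_apply, smul_eq_mul]) g
    change ψ.symm (ψ f * ψ g) = g * ψ.symm (ψ f * ψ 1) at h1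
    rw [hκ, mul_comm (ψ f) (algebraMap K A κ), ← Algebra.smul_def, map_smul,
      ψ.symm_apply_apply, ψ.symm_apply_eq] at h1
    rw [h1, mul_smul_comm, map_smul, mul_comm]
  let σl : A ≃ₗ[K] A := ψ.trans (LinearEquiv.smulOfNeZero K A κ⁻¹ (inv_ne_zero hκ0))
  have hσl : ∀ f, σl f = κ⁻¹ • ψ f := fun f => rfl
  let σ : A ≃ₐ[K] A := AlgEquiv.ofLinearEquiv σl
    (by rw [hσl, hκ, Algebra.smul_def, ← map_mul, inv_mul_cancel₀ hκ0, map_one])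
    (fun f g => by
      rw [hσl, hσl, hσl, smul_mul_smul_comm, hmul, smul_smul, mul_assoc, inv_mul_cancel₀ hκ0,
        mul_one])
  have hσ : ∀ f, σ f = κ⁻¹ • ψ f := fun f => rfl
  have hψσ : ∀ f, ψ f = κ • σ f := fun f => by
    rw [hσ, smul_smul, mul_inv_cancel₀ hκ0, one_smul]
  have hθσ : ∀ X f, θ X (σ f) = σ (X f) := fun X f => by
    rw [hσ, hσ, Derivation.map_smul, hθψ]
  have hc_add : ∀ X Y, c₀ (X + Y) = c₀ X + c₀ Y := fun X Y => by
    refine (derivationOp_injective (K := K) (X := θ (X + Y)) (X' := θ X + θ Y) ?_).1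
    rw [derivationOp_add, hθ, hθ, hθ, ← map_add, ← derivationOp_add, add_zero]
  have hc_smul : ∀ (r : K) X, c₀ (r • X) = r • c₀ X := fun r X => by
    refine (derivationOp_injective (K := K) (X := θ (r • X)) (X' := r • θ X) ?_).1
    rw [derivationOp_smul, hθ, hθ, ← map_smul, ← derivationOp_smul, smul_zero]
  -- Since `θ X ∘ σ = σ ∘ X`, pulling `c₀` back by `σ` turns the action through `θ` into the natural
  -- action of derivations on `A`.
  refine ⟨σ, κ,
    { toFun := fun X => σ.symm (c₀ X)
      map_add' := fun X Y => by rw [hc_add, map_add]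
      map_smul' := fun r X => by rw [hc_smul, map_smul, RingHom.id_apply] }, hκ0, ?_, ?_⟩
  · intro X Y
    change σ.symm _ = X (σ.symm _) - Y (σ.symm _)
    rw [AlgEquiv.symm_apply_eq, map_sub, ← hθσ, ← hθσ, AlgEquiv.apply_symm_apply,
      AlgEquiv.apply_symm_apply]
    have h1 := hΦ.2 (derivationOp 0 X) (derivationOp 0 Y)
    rw [lie_derivationOp, map_zero, map_zero, sub_zero, hΦ_apply, hΦ_apply, hΦ_apply,
      lie_derivationOp] at h1
    simpa only [map_zero, zero_add] using (derivationOp_injective h1).1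
  · intro f X g
    change _ = σ ((κ • f + σ.symm (c₀ X)) * g + X g)
    rw [hΦ_apply, derivationOp_apply, hθσ, map_add, map_mul, map_add, map_smul,
      AlgEquiv.apply_symm_apply, hψσ]

/-- The cocycles of the derivations with values in `A`, in terms of a given divergence operator. -/
theorem cocycle_eq_divergence_add [CharZero K]
    (hI : derivativeIdeal K A = ⊤)
    (hconst : ∀ f : A, (∀ X : Derivation K A A, X f = 0) → ∃ c : K, f = algebraMap K A c)
    (hpts : ∀ f : A, (∀ χ : A →ₐ[K] K, χ f = 0) → f = 0)
    (d : Derivation K A A →ₗ[K] A) (hd : ∀ a X, d (a • X) = a * d X + X a)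
    (c : Derivation K A A →ₗ[K] A) (hc : ∀ X Y, c ⁅X, Y⁆ = X (c Y) - Y (c X)) :
    ∃ (l : K) (w : Derivation K A A →ₗ[A] A), ∀ X, c X = l • d X + w X := by
  have lie_smul' : ∀ (X Y : Derivation K A A) (a : A), ⁅X, a • Y⁆ = X a • Y + a • ⁅X, Y⁆ := by
    intro X Y a
    refine Derivation.ext fun g => ?_
    simp only [Derivation.commutator_apply, Derivation.smul_apply, Derivation.add_apply,
      smul_eq_mul, Derivation.leibniz]
    ring
  have smul_lie' : ∀ (X Y : Derivation K A A) (a : A), ⁅a • X, Y⁆ = a • ⁅X, Y⁆ - Y a • X := by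
    intro X Y a
    refine Derivation.ext fun g => ?_
    simp only [Derivation.commutator_apply, Derivation.smul_apply, Derivation.sub_apply,
      smul_eq_mul, Derivation.leibniz]
    ring
  -- `c` vanishes where a vector field vanishes to the second order
  have hvan : ∀ (χ : A →ₐ[K] K) (a b : A), χ a = 0 → χ b = 0 →
      ∀ W : Derivation K A A, χ (c ((a * b) • W)) = 0 := by
    intro χ a b ha hb W
    -- The cocycle identity gives the two terms the coefficients `a` and `b`, which `χ` kills.
    have hbr : ∀ (a b : A) (Y Z : Derivation K A A), χ a = 0 → χ b = 0 →
        χ (c ⁅a • Y, b • Z⁆) = 0 := by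
      intro a b Y Z ha hb
      simp only [hc, Derivation.smul_apply, smul_eq_mul, map_sub, map_mul, ha, hb, zero_mul,
        sub_zero]
    have h1 : ∀ (g h : A) (Y : Derivation K A A), χ (c ((a * b * g * Y h) • Y)) = 0 := by
      intro g h Y
      -- Moving `h` from one factor to the other changes the bracket of two multiples of `Y` by a
      -- multiple without derivatives of `a`, `b` and `g`.
      have e : (2 : K) • ((a * b * g * Y h) • Y)
          = ⁅(a * g) • Y, (b * h) • Y⁆ - ⁅(a * g * h) • Y, b • Y⁆ := by
        refine Derivation.ext fun k => ?_
        simp only [Derivation.commutator_apply, Derivation.smul_apply, Derivation.sub_apply,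
          smul_eq_mul, Derivation.leibniz, two_smul, Derivation.add_apply]
        ring
      have e2 := congrArg (fun Z => χ (c Z)) e
      simp only [map_smul, map_sub] at e2
      rw [hbr _ _ _ _ (by rw [map_mul, ha, zero_mul]) (by rw [map_mul, hb, zero_mul]),
        hbr _ _ _ _ (by rw [map_mul, map_mul, ha, zero_mul, zero_mul]) hb, sub_zero] at e2
      exact (smul_eq_zero_iff_right two_ne_zero).1 e2
    -- Polarization of `h1` in `Y`.
    have h2 : ∀ (g h : A) (Y Z : Derivation K A A),
        χ (c ((a * b * g * Y h) • Z)) + χ (c ((a * b * g * Z h) • Y)) = 0 := by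
      intro g h Y Z
      have e := h1 g h (Y + Z)
      have e' : (a * b * g * (Y + Z) h) • (Y + Z) = (a * b * g * Y h) • Y + (a * b * g * Z h) • Z
          + ((a * b * g * Y h) • Z + (a * b * g * Z h) • Y) := by
        rw [Derivation.add_apply]
        module
      rw [e', map_add, map_add, map_add, map_add, map_add, map_add, h1, h1, zero_add,
        zero_add] at e
      exact e
    have h3 : ∀ u : A, χ (c ((a * b * u) • W)) = 0 := by
      intro u
      have hu : u ∈ Ideal.span {a : A | ∃ (X : Derivation K A A) (h : A), X h * X h = a} := by
        rw [span_sq_derivative_eq_top hI]; trivial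
      induction hu using Submodule.closure_induction with
      | zero => simp
      | add x y _ _ hx hy => rw [mul_add, add_smul, map_add, map_add, hx, hy, add_zero]
      | smul_mem r x hx =>
        obtain ⟨Y, h, rfl⟩ := hx
        -- By `h2`, the coefficient `r * Y h * Y h` on `W` is traded, up to sign, for `r * Y h * W
        -- h` on `Y`, where `h1` applies.
        have e1 := h2 (r * Y h) h Y W
        have e2 := h1 (r * W h) h Y
        rw [show a * b * (r * W h) * Y h = a * b * (r * Y h) * W h by ring] at e2
        rw [e2, add_zero] at e1
        rw [smul_eq_mul, show a * b * (r * (Y h * Y h)) = a * b * (r * Y h) * Y h by ring]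
        exact e1
    simpa using h3 1
  -- `hvan` for `a - χ a` and `b - χ b`, expanded; since the characters separate elements, the
  -- result holds in `A` itself.
  have hquad : ∀ (a b : A) (X : Derivation K A A),
      c ((a * b) • X) = a * c (b • X) + b * c (a • X) - a * b * c X := by
    intro a b X
    rw [← sub_eq_zero]
    refine hpts _ fun χ => ?_
    have h1 := hvan χ (a - algebraMap K A (χ a)) (b - algebraMap K A (χ b))
      (by simp) (by simp) X
    have e : ((a - algebraMap K A (χ a)) * (b - algebraMap K A (χ b))) • X
        = (a * b) • X - (χ a) • (b • X) - (χ b) • (a • X) + (χ a * χ b) • X := by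
      refine Derivation.ext fun k => ?_
      simp only [Derivation.smul_apply, Derivation.sub_apply, Derivation.add_apply, smul_eq_mul,
        Algebra.smul_def, map_mul]
      ring
    rw [e] at h1
    simp only [map_add, map_sub, map_smul, smul_eq_mul, map_mul] at h1 ⊢
    linear_combination h1
  -- The defect of `A`-linearity of `c`; `hquad` is its Leibniz rule in `a`.
  let δ : Derivation K A A → Derivation K A A := fun X =>
    Derivation.mk'
      { toFun := fun a => c (a • X) - a * c X
        map_add' := fun a b => by rw [add_smul, map_add]; ring
        map_smul' := fun r a => by
          rw [smul_assoc, map_smul, RingHom.id_apply, smul_sub, smul_mul_assoc] }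
      (fun a b => by
        change c ((a * b) • X) - a * b * c X
          = a * (c (b • X) - b * c X) + b * (c (a • X) - a * c X)
        rw [hquad]; ring)
  have hδ : ∀ X a, δ X a = c (a • X) - a * c X := fun X a => rfl
  have hδ_smul : ∀ (b : A) X, δ (b • X) = b • δ X := by
    intro b X
    refine Derivation.ext fun a => ?_
    rw [Derivation.smul_apply, smul_eq_mul, hδ, hδ, smul_smul, hquad]
    ring
  have hδ_add : ∀ X Y, δ (X + Y) = δ X + δ Y := by
    intro X Y
    refine Derivation.ext fun a => ?_
    rw [Derivation.add_apply, hδ, hδ, hδ, smul_add, map_add, map_add]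
    ring
  have hδ_lie : ∀ X Y : Derivation K A A, δ ⁅X, Y⁆ = ⁅X, δ Y⁆ := by
    intro X Y
    refine Derivation.ext fun a => ?_
    have e := hc X (a • Y)
    rw [lie_smul', map_add] at e
    have e1 : c (a • Y) = a * c Y + δ Y a := by rw [hδ]; ring
    have e2 : c (X a • Y) = X a * c Y + δ Y (X a) := by rw [hδ]; ring
    have e3 : c (a • ⁅X, Y⁆) = a * c ⁅X, Y⁆ + δ ⁅X, Y⁆ a := by rw [hδ]; ring
    rw [e1, e2, e3, hc, map_add, Derivation.leibniz, Derivation.smul_apply] at e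
    simp only [smul_eq_mul] at e
    rw [Derivation.commutator_apply]
    linear_combination e
  -- Both sides of `δ ⁅b • X, Y⁆ = ⁅b • X, δ Y⁆` contain `b • ⁅X, δ Y⁆`; the remaining terms give
  -- the claim.
  have hδ_comm : ∀ X Y b, Y b • δ X = δ Y b • X := by
    intro X Y b
    have e := hδ_lie (b • X) Y
    have hsub : ∀ X Y, δ (X - Y) = δ X - δ Y := fun X Y => by
      rw [eq_sub_iff_add_eq, ← hδ_add, sub_add_cancel]
    rw [smul_lie', smul_lie', hsub, hδ_smul, hδ_smul, hδ_lie] at e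
    exact sub_right_injective e
  -- The elements `g` for which `g • δ` is the multiplication by some element form an ideal. By
  -- `hδ_comm` it contains all derivatives `Y b`, hence also `1`.
  obtain ⟨τ, hτ⟩ : ∃ τ : A, ∀ X, δ X = τ • X := by
    have : ∀ g : A, ∃ τ : A, ∀ X, g • δ X = τ • X := by
      intro g
      have hg : g ∈ derivativeIdeal K A := by rw [hI]; trivial
      unfold derivativeIdeal at hg
      induction hg using Submodule.closure_induction with
      | zero => exact ⟨0, fun X => by simp⟩
      | add x y _ _ hx hy =>
        obtain ⟨s, hs⟩ := hx
        obtain ⟨t, ht⟩ := hy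
        exact ⟨s + t, fun X => by rw [add_smul, add_smul, hs, ht]⟩
      | smul_mem r x hx =>
        obtain ⟨Y, b, rfl⟩ := hx
        exact ⟨r * δ Y b, fun X => by rw [smul_assoc, hδ_comm, smul_smul]⟩
    obtain ⟨τ, hτ⟩ := this 1
    exact ⟨τ, fun X => by rw [← hτ, one_smul]⟩
  -- Compatibility with brackets reads `[X, τ Y] = τ [X, Y]`, so `X τ` annihilates every `Y h`,
  -- hence the unit ideal.
  obtain ⟨l, hl⟩ := hconst τ fun X => by
    have h0 : ∀ (Y : Derivation K A A) (h : A), X τ * Y h = 0 := by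
      intro Y h
      have e := hδ_lie X Y
      rw [hτ, hτ, lie_smul', right_eq_add] at e
      simpa using congrArg (fun D => D h) e
    have : ∀ g : A, X τ * g = 0 := by
      intro g
      have hg : g ∈ derivativeIdeal K A := by rw [hI]; trivial
      unfold derivativeIdeal at hg
      induction hg using Submodule.closure_induction with
      | zero => simp
      | add x y _ _ hx hy => rw [mul_add, hx, hy, add_zero]
      | smul_mem r x hx =>
        obtain ⟨Y, b, rfl⟩ := hx
        rw [smul_eq_mul, mul_left_comm, h0, mul_zero]
    simpa using this 1
  have hcl : ∀ a X, c (a • X) = a * c X + l • X a := by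
    intro a X
    have e := hδ X a
    rw [hτ, hl, Derivation.smul_apply, smul_eq_mul, ← Algebra.smul_def] at e
    linear_combination -e
  refine ⟨l,
    { toFun := fun X => c X - l • d X
      map_add' := fun X Y => by rw [map_add, map_add, smul_add]; ring
      map_smul' := fun a X => by
        rw [hcl, hd, RingHom.id_apply, smul_eq_mul, smul_add, mul_sub, mul_smul_comm]
        ring }, fun X => ?_⟩
  change c X = l • d X + (c X - l • d X)
  ring

/-- The map given by an algebra automorphism, a constant and a cocycle. -/
theorem exists_isLieAutomorphism (σ : A ≃ₐ[K] A) (κ : K) (hκ : κ ≠ 0)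
    (c : Derivation K A A →ₗ[K] A) (hc : ∀ X Y, c ⁅X, Y⁆ = X (c Y) - Y (c X)) :
    ∃ Φ : diffOpOne K A →ₗ[K] diffOpOne K A, IsLieAutomorphism Φ ∧
      ∀ f X g, (Φ (derivationOp f X)).1 (σ g) = σ ((κ • f + c X) * g + X g) := by
  choose F Δ hFΔ using fun D : diffOpOne K A => exists_derivationOp_eq D
  have hF : ∀ f X, F (derivationOp f X) = f := fun f X => (derivationOp_injective (hFΔ _)).1
  have hΔ : ∀ f X, Δ (derivationOp f X) = X := fun f X => (derivationOp_injective (hFΔ _)).2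
  let conj : Derivation K A A → Derivation K A A := fun X =>
    Derivation.mk' (σ.toLinearMap ∘ₗ X.toLinearMap ∘ₗ σ.symm.toLinearMap) fun a b => by
      change σ (X (σ.symm (a * b))) = a * σ (X (σ.symm b)) + b * σ (X (σ.symm a))
      rw [map_mul, Derivation.leibniz]
      simp
  have hconj : ∀ X g, conj X g = σ (X (σ.symm g)) := fun X g => rfl
  let T : A → Derivation K A A → diffOpOne K A := fun f X =>
    derivationOp (σ (κ • f + c X)) (conj X)
  have hT : ∀ f X, T f X = derivationOp (σ (κ • f + c X)) (conj X) := fun f X => rfl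
  have hTadd : ∀ f f' X X', T (f + f') (X + X') = T f X + T f' X' := by
    intro f f' X X'
    rw [hT, hT, hT, ← derivationOp_add]
    congr 1
    · rw [← map_add]
      congr 1
      rw [smul_add, map_add]
      ring
    · refine Derivation.ext fun g => ?_
      simp only [hconj, Derivation.add_apply, map_add]
  have hTsmul : ∀ (r : K) f X, T (r • f) (r • X) = r • T f X := by
    intro r f X
    rw [hT, hT, ← derivationOp_smul]
    congr 1
    · rw [← map_smul]
      congr 1
      rw [smul_add, map_smul, smul_comm]
    · refine Derivation.ext fun g => ?_
      simp only [hconj, Derivation.smul_apply, map_smul]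
  let Φ : diffOpOne K A →ₗ[K] diffOpOne K A :=
    { toFun := fun D => T (F D) (Δ D)
      map_add' := fun D E => by
        have : D + E = derivationOp (F D + F E) (Δ D + Δ E) := by
          rw [derivationOp_add, hFΔ, hFΔ]
        rw [this, hF, hΔ, hTadd]
      map_smul' := fun r D => by
        have : r • D = derivationOp (r • F D) (r • Δ D) := by
          rw [derivationOp_smul, hFΔ]
        rw [this, hF, hΔ, hTsmul, RingHom.id_apply] }
  have hΦ : ∀ f X, Φ (derivationOp f X) = derivationOp (σ (κ • f + c X)) (conj X) := fun f X => by
    change T (F _) (Δ _) = _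
    rw [hF, hΔ]
  have hconj_inj : ∀ X Y, conj X = conj Y → X = Y := fun X Y h => by
    refine Derivation.ext fun g => ?_
    have := congrArg (fun D => D (σ g)) h
    simpa [hconj] using this
  refine ⟨Φ, ⟨⟨?_, ?_⟩, ?_⟩, ?_⟩
  · intro D E h
    obtain ⟨f, X, rfl⟩ := exists_derivationOp_eq D
    obtain ⟨g, Y, rfl⟩ := exists_derivationOp_eq E
    rw [hΦ, hΦ] at h
    obtain ⟨h1, h2⟩ := derivationOp_injective h
    obtain rfl := hconj_inj _ _ h2
    have h3 := add_right_cancel (σ.injective h1)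
    rw [smul_right_injective A hκ h3]
  · intro D
    obtain ⟨f, Y, rfl⟩ := exists_derivationOp_eq D
    let X : Derivation K A A :=
      Derivation.mk' (σ.symm.toLinearMap ∘ₗ Y.toLinearMap ∘ₗ σ.toLinearMap) fun a b => by
        change σ.symm (Y (σ (a * b))) = a * σ.symm (Y (σ b)) + b * σ.symm (Y (σ a))
        rw [map_mul, Derivation.leibniz]
        simp
    have hX : ∀ g, X g = σ.symm (Y (σ g)) := fun g => rfl
    refine ⟨derivationOp (κ⁻¹ • (σ.symm f - c X)) X, ?_⟩
    rw [hΦ]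
    congr 1
    · rw [smul_smul, mul_inv_cancel₀ hκ, one_smul, sub_add_cancel, AlgEquiv.apply_symm_apply]
    · refine Derivation.ext fun g => ?_
      simp [hconj, hX]
  · intro D E
    obtain ⟨f, X, rfl⟩ := exists_derivationOp_eq D
    obtain ⟨g, Y, rfl⟩ := exists_derivationOp_eq E
    rw [lie_derivationOp, hΦ, hΦ, hΦ, lie_derivationOp]
    congr 1
    · simp only [hconj, AlgEquiv.symm_apply_apply, hc, ← map_sub]
      congr 1
      simp only [map_add, Derivation.map_smul, smul_sub]
      ring
    · refine Derivation.ext fun h => ?_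
      simp [hconj, Derivation.commutator_apply]
  · intro f X g
    rw [hΦ, derivationOp_apply, hconj, AlgEquiv.symm_apply_apply, ← map_mul, ← map_add]

end Algebra

/-! ### Functions and vector fields in charts; extension from a neighbourhood. -/

section Charts

open Set Filter Topology

variable {n : ℕ} {M : Type*} [TopologicalSpace M] [ChartedSpace (EuclideanSpace ℝ (Fin n)) M]

theorem mfderiv_extChartAt_symm_comp [IsManifold (𝓡 n) ∞ M] {x₀ : M}
    {u : EuclideanSpace ℝ (Fin n)} (hu : u ∈ (extChartAt (𝓡 n) x₀).target) :
    (mfderiv 𝓘(ℝ, EuclideanSpace ℝ (Fin n)) (𝓡 n) (extChartAt (𝓡 n) x₀).symm u).comp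
      (mfderiv (𝓡 n) 𝓘(ℝ, EuclideanSpace ℝ (Fin n)) (extChartAt (𝓡 n) x₀)
        ((extChartAt (𝓡 n) x₀).symm u)) = ContinuousLinearMap.id ℝ _ := by
  have : IsManifold (𝓡 n) 1 M := .of_le (n := ∞) (by simp)
  have := mfderivWithin_extChartAt_symm_comp_mfderiv_extChartAt (I := 𝓡 n) hu
  rwa [modelWithCornersSelf_coe, range_id, mfderivWithin_univ] at this

theorem mfderiv_extChartAt_comp_symm [IsManifold (𝓡 n) ∞ M] {x₀ : M}
    {u : EuclideanSpace ℝ (Fin n)} (hu : u ∈ (extChartAt (𝓡 n) x₀).target) :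
    (mfderiv (𝓡 n) 𝓘(ℝ, EuclideanSpace ℝ (Fin n)) (extChartAt (𝓡 n) x₀)
        ((extChartAt (𝓡 n) x₀).symm u)).comp
      (mfderiv 𝓘(ℝ, EuclideanSpace ℝ (Fin n)) (𝓡 n) (extChartAt (𝓡 n) x₀).symm u)
      = ContinuousLinearMap.id ℝ _ := by
  have : IsManifold (𝓡 n) 1 M := .of_le (n := ∞) (by simp)
  have := mfderiv_extChartAt_comp_mfderivWithin_extChartAt_symm (I := 𝓡 n) hu
  rwa [modelWithCornersSelf_coe, range_id, mfderivWithin_univ] at this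

theorem isInvertible_mfderiv_extChartAt_symm [IsManifold (𝓡 n) ∞ M] {x₀ : M}
    {u : EuclideanSpace ℝ (Fin n)} (hu : u ∈ (extChartAt (𝓡 n) x₀).target) :
    (mfderiv 𝓘(ℝ, EuclideanSpace ℝ (Fin n)) (𝓡 n)
      (extChartAt (𝓡 n) x₀).symm u).IsInvertible :=
  ContinuousLinearMap.IsInvertible.of_inverse (mfderiv_extChartAt_symm_comp hu)
    (mfderiv_extChartAt_comp_symm hu)

theorem contMDiffAt_extChartAt_symm [IsManifold (𝓡 n) ∞ M] {x₀ : M}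
    {u : EuclideanSpace ℝ (Fin n)} (hu : u ∈ (extChartAt (𝓡 n) x₀).target) :
    ContMDiffAt 𝓘(ℝ, EuclideanSpace ℝ (Fin n)) (𝓡 n) ∞ (extChartAt (𝓡 n) x₀).symm u :=
  (contMDiffOn_extChartAt_symm x₀).contMDiffAt ((isOpen_extChartAt_target x₀).mem_nhds hu)

theorem contMDiffAt_extChartAt_source [IsManifold (𝓡 n) ∞ M] {x₀ x : M}
    (hx : x ∈ (extChartAt (𝓡 n) x₀).source) :
    ContMDiffAt (𝓡 n) 𝓘(ℝ, EuclideanSpace ℝ (Fin n)) ∞ (extChartAt (𝓡 n) x₀) x :=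
  contMDiffAt_extChartAt' (by rwa [extChartAt_source] at hx)

theorem contDiffOn_comp_extChartAt_symm [IsManifold (𝓡 n) ∞ M] {F : Type*}
    [NormedAddCommGroup F] [NormedSpace ℝ F] {g : M → F} (hg : ContMDiff (𝓡 n) 𝓘(ℝ, F) ∞ g)
    (x₀ : M) :
    ContDiffOn ℝ ∞ (fun u => g ((extChartAt (𝓡 n) x₀).symm u)) (extChartAt (𝓡 n) x₀).target :=
  (hg.comp_contMDiffOn (contMDiffOn_extChartAt_symm x₀)).contDiffOn

/-- A smooth bump function that is `1` near `x` and supported in a given neighbourhood. -/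
theorem exists_bump [IsManifold (𝓡 n) ∞ M] [T2Space M] {x : M} {U : Set M} (hU : U ∈ 𝓝 x) :
    ∃ χ : SmoothFn n M, (∀ᶠ y in 𝓝 x, χ y = 1) ∧ tsupport χ ⊆ U := by
  obtain ⟨f, -, hf⟩ := (SmoothBumpFunction.nhds_basis_tsupport (I := 𝓡 n) x).mem_iff.1 hU
  exact ⟨⟨f, f.contMDiff⟩, f.eventuallyEq_one, hf⟩

theorem exists_smoothFn_eventuallyEq [IsManifold (𝓡 n) ∞ M] [T2Space M] {x : M} {U : Set M}
    (hU : U ∈ 𝓝 x) {h : M → ℝ} (hh : ContMDiffOn (𝓡 n) 𝓘(ℝ, ℝ) ∞ h U) :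
    ∃ g : SmoothFn n M, ∀ᶠ y in 𝓝 x, g y = h y := by
  obtain ⟨χ, hχ, hs⟩ := exists_bump (n := n) (interior_mem_nhds.2 hU)
  refine ⟨⟨fun y => χ y * h y, ?_⟩, ?_⟩
  · refine contMDiff_of_tsupport fun y hy => ?_
    have hy' : y ∈ interior U := hs (closure_mono (Function.support_mul_subset_left χ h) hy)
    exact χ.contMDiff.contMDiffAt.mul (hh.contMDiffAt (mem_interior_iff_mem_nhds.1 hy'))
  · filter_upwards [hχ] with y hy
    change χ y * h y = h y
    rw [hy, one_mul]

/-- A smooth function in a chart extends to the manifold from a neighbourhood of a point. -/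
theorem exists_smoothFn_eventuallyEq_chart [IsManifold (𝓡 n) ∞ M] [T2Space M] {x₀ x : M}
    (hx : x ∈ (extChartAt (𝓡 n) x₀).source) {h : EuclideanSpace ℝ (Fin n) → ℝ}
    (hh : ContDiffOn ℝ ∞ h (extChartAt (𝓡 n) x₀).target) :
    ∃ g : SmoothFn n M, ∀ᶠ y in 𝓝 x, g y = h (extChartAt (𝓡 n) x₀ y) := by
  refine exists_smoothFn_eventuallyEq ((isOpen_extChartAt_source x₀).mem_nhds hx)
    (h := fun y => h (extChartAt (𝓡 n) x₀ y)) ?_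
  refine hh.contMDiffOn.comp (t := (extChartAt (𝓡 n) x₀).target) ?_
    fun y hy => (extChartAt (𝓡 n) x₀).map_source hy
  rw [extChartAt_source]
  exact contMDiffOn_extChartAt

/-- Smoothness of a section can be tested in the trivialization at `x₀`, which is fibrewise the
derivative of the chart. -/
theorem contMDiffOn_section_iff [IsManifold (𝓡 n) ∞ M] {x₀ : M}
    (s : (x : M) → TangentSpace (𝓡 n) x) :
    ContMDiffOn (𝓡 n) ((𝓡 n).prod 𝓘(ℝ, EuclideanSpace ℝ (Fin n))) ∞
      (fun x => (⟨x, s x⟩ : TangentBundle (𝓡 n) M)) (extChartAt (𝓡 n) x₀).source ↔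
    ContMDiffOn (𝓡 n) 𝓘(ℝ, EuclideanSpace ℝ (Fin n)) ∞
      (fun x => (mfderiv (𝓡 n) 𝓘(ℝ, EuclideanSpace ℝ (Fin n)) (extChartAt (𝓡 n) x₀) x (s x) :
        EuclideanSpace ℝ (Fin n))) (extChartAt (𝓡 n) x₀).source := by
  have : IsManifold (𝓡 n) 1 M := .of_le (n := ∞) (by simp)
  have h := (trivializationAt (EuclideanSpace ℝ (Fin n)) (TangentSpace (𝓡 n) : M → Type _)
    x₀).contMDiffOn_section_baseSet_iff (IB := 𝓡 n) (n := ∞) (s := s)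
  rw [TangentBundle.trivializationAt_baseSet, ← extChartAt_source (𝓡 n)] at h
  rw [h]
  refine contMDiffOn_congr fun x hx => ?_
  rw [extChartAt_source] at hx
  rw [← TangentBundle.continuousLinearMapAt_trivializationAt hx]
  exact (Bundle.Trivialization.continuousLinearMapAt_apply_of_mem ℝ _
    (by rwa [TangentBundle.trivializationAt_baseSet]) (s x)).symm

/-- Existence of vector fields that are given near a point in a chart. -/
theorem exists_vectorField_eventuallyEq [IsManifold (𝓡 n) ∞ M] [T2Space M] {x₀ x : M}
    (hx : x ∈ (extChartAt (𝓡 n) x₀).source)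
    {V : EuclideanSpace ℝ (Fin n) → EuclideanSpace ℝ (Fin n)}
    (hV : ContDiffOn ℝ ∞ V (extChartAt (𝓡 n) x₀).target) :
    ∃ X : SmoothVectorField n M, ∀ᶠ y in 𝓝 x,
      X y = mfderiv 𝓘(ℝ, EuclideanSpace ℝ (Fin n)) (𝓡 n) (extChartAt (𝓡 n) x₀).symm
        (extChartAt (𝓡 n) x₀ y) (V (extChartAt (𝓡 n) x₀ y)) := by
  obtain ⟨χ, hχ, hs⟩ := exists_bump (n := n) ((isOpen_extChartAt_source (I := 𝓡 n) x₀).mem_nhds hx)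
  let s : (y : M) → TangentSpace (𝓡 n) y := fun y =>
    mfderiv 𝓘(ℝ, EuclideanSpace ℝ (Fin n)) (𝓡 n) (extChartAt (𝓡 n) x₀).symm
        (extChartAt (𝓡 n) x₀ y) (V (extChartAt (𝓡 n) x₀ y))
  have hsm := (contMDiffOn_section_iff (x₀ := x₀) s).2 (by
    have : ContMDiffOn (𝓡 n) 𝓘(ℝ, EuclideanSpace ℝ (Fin n)) ∞
        (fun y => V (extChartAt (𝓡 n) x₀ y)) (extChartAt (𝓡 n) x₀).source := by
      refine hV.contMDiffOn.comp (t := (extChartAt (𝓡 n) x₀).target) ?_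
        fun y hy => (extChartAt (𝓡 n) x₀).map_source hy
      rw [extChartAt_source]
      exact contMDiffOn_extChartAt
    refine this.congr fun y hy => ?_
    have h1 := mfderiv_extChartAt_comp_symm ((extChartAt (𝓡 n) x₀).map_source hy)
    rw [(extChartAt (𝓡 n) x₀).left_inv hy] at h1
    exact DFunLike.congr_fun h1 (V (extChartAt (𝓡 n) x₀ y)))
  refine ⟨⟨fun y => χ y • s y, ContMDiffOn.smul_section_of_tsupport χ.contMDiff.contMDiffOn
    (isOpen_extChartAt_source x₀) hs hsm⟩, ?_⟩
  filter_upwards [hχ] with y hy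
  change χ y • s y = s y
  rw [hy, one_smul]

namespace SmoothVectorField

variable [IsManifold (𝓡 n) ∞ M]

theorem mfderiv_inChart (X : SmoothVectorField n M) {x₀ : M} {u : EuclideanSpace ℝ (Fin n)}
    (hu : u ∈ (extChartAt (𝓡 n) x₀).target) :
    mfderiv 𝓘(ℝ, EuclideanSpace ℝ (Fin n)) (𝓡 n) (extChartAt (𝓡 n) x₀).symm u
      (X.inChart x₀ u) = X ((extChartAt (𝓡 n) x₀).symm u) :=
  DFunLike.congr_fun (isInvertible_mfderiv_extChartAt_symm hu).self_comp_inverse _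

theorem inChart_eq (X : SmoothVectorField n M) {x₀ : M} {u : EuclideanSpace ℝ (Fin n)}
    (hu : u ∈ (extChartAt (𝓡 n) x₀).target) :
    X.inChart x₀ u = mfderiv (𝓡 n) 𝓘(ℝ, EuclideanSpace ℝ (Fin n)) (extChartAt (𝓡 n) x₀)
      ((extChartAt (𝓡 n) x₀).symm u) (X ((extChartAt (𝓡 n) x₀).symm u)) := by
  rw [← X.mfderiv_inChart hu]
  exact (DFunLike.congr_fun (mfderiv_extChartAt_comp_symm hu) _).symm

theorem toEnd_apply (X : SmoothVectorField n M) (g : SmoothFn n M) (x : M) :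
    X.toEnd g x = mfderiv (𝓡 n) 𝓘(ℝ, ℝ) g x (X x) := rfl

theorem mfderiv_eq_fderiv_chart (g : SmoothFn n M) {x₀ : M} {u : EuclideanSpace ℝ (Fin n)}
    (hu : u ∈ (extChartAt (𝓡 n) x₀).target) (v : EuclideanSpace ℝ (Fin n)) :
    mfderiv (𝓡 n) 𝓘(ℝ, ℝ) g ((extChartAt (𝓡 n) x₀).symm u)
      (mfderiv 𝓘(ℝ, EuclideanSpace ℝ (Fin n)) (𝓡 n) (extChartAt (𝓡 n) x₀).symm u v)
      = fderiv ℝ (fun u => g ((extChartAt (𝓡 n) x₀).symm u)) u v := by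
  rw [← mfderiv_eq_fderiv]
  have h := mfderiv_comp u (g := g) (f := (extChartAt (𝓡 n) x₀).symm)
    (g.contMDiff.mdifferentiable (by simp) _)
    ((contMDiffAt_extChartAt_symm hu).mdifferentiableAt (by simp))
  exact (DFunLike.congr_fun h v).symm

theorem toEnd_eq_fderiv (X : SmoothVectorField n M) (g : SmoothFn n M) {x₀ : M}
    {u : EuclideanSpace ℝ (Fin n)} (hu : u ∈ (extChartAt (𝓡 n) x₀).target) :
    X.toEnd g ((extChartAt (𝓡 n) x₀).symm u)
      = fderiv ℝ (fun u => g ((extChartAt (𝓡 n) x₀).symm u)) u (X.inChart x₀ u) := by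
  rw [toEnd_apply, ← X.mfderiv_inChart hu, mfderiv_eq_fderiv_chart g hu]

theorem contDiffOn_inChart (X : SmoothVectorField n M) (x₀ : M) :
    ContDiffOn ℝ ∞ (X.inChart x₀) (extChartAt (𝓡 n) x₀).target := by
  have h := ((contMDiffOn_section_iff (x₀ := x₀) fun x => X x).1 X.contMDiff.contMDiffOn).comp
    (contMDiffOn_extChartAt_symm x₀) fun u hu => (extChartAt (𝓡 n) x₀).map_target hu
  exact h.contDiffOn.congr fun u hu => X.inChart_eq hu

end SmoothVectorField

end Charts

/-! ### Parameter integrals and Hadamard's lemma. -/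

section Hadamard

open Set MeasureTheory

/-- The integral is the value at `0` of the convolution of the indicator of `(0, 1]` with `t ↦ b t *
G x (-t)`. The bump `b` equals `1` on `[-1, 1]`, so it changes nothing there, and it supplies the
compact support needed for smooth dependence on `x`. -/
theorem contDiff_integral_zero_one {E : Type*} [NormedAddCommGroup E] [NormedSpace ℝ E]
    {G : E → ℝ → ℝ} (hG : ContDiff ℝ ∞ fun p : E × ℝ => G p.1 p.2) :
    ContDiff ℝ ∞ fun x => ∫ t in (0 : ℝ)..1, G x t := by
  obtain ⟨b, hb⟩ : ∃ b : ContDiffBump (0 : ℝ), b.rIn = 1 := ⟨⟨1, 2, one_pos, one_lt_two⟩, rfl⟩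
  have hf : LocallyIntegrable (indicator (Ioc (0 : ℝ) 1) fun _ => (1 : ℝ)) volume :=
    ((integrable_indicator_iff measurableSet_Ioc).2
      (integrableOn_const (by simp))).locallyIntegrable
  have h := contDiffOn_convolution_right_with_param_comp (μ := volume) (𝕜 := ℝ)
    (ContinuousLinearMap.mul ℝ ℝ) (n := ⊤) (s := univ) (v := fun _ : E => (0 : ℝ))
    contDiffOn_const (g := fun x t => b t * G x (-t)) isOpen_univ
    (isCompact_closedBall (0 : ℝ) b.rOut)
    (fun p x _ hx => by
      rw [b.zero_of_le_dist, zero_mul]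
      rw [Metric.mem_closedBall, not_le] at hx
      exact hx.le) hf
    (by
      refine ContDiff.contDiffOn ?_
      have h1 : ContDiff ℝ ∞ fun p : E × ℝ => b p.2 * G p.1 (-p.2) :=
        (b.contDiff.comp contDiff_snd).mul
          (hG.comp (contDiff_fst.prodMk contDiff_snd.neg))
      exact h1)
  rw [contDiffOn_univ] at h
  refine Eq.mpr (congrArg _ (funext fun x => ?_)) h
  rw [intervalIntegral.integral_of_le zero_le_one, ← integral_indicator measurableSet_Ioc,
    convolution]
  refine integral_congr_ae (Filter.Eventually.of_forall fun t => ?_)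
  simp only [ContinuousLinearMap.mul_apply', zero_sub, neg_neg]
  by_cases ht : t ∈ Ioc (0 : ℝ) 1
  · rw [indicator_of_mem ht, indicator_of_mem ht, b.one_of_mem_closedBall, one_mul, one_mul]
    rw [hb, mem_closedBall_zero_iff, norm_neg, Real.norm_eq_abs, abs_of_pos ht.1]
    exact ht.2
  · rw [indicator_of_notMem ht, indicator_of_notMem ht, zero_mul]

/-- Hadamard's lemma. -/
theorem exists_eq_add_sum_mul {n : ℕ} {F : EuclideanSpace ℝ (Fin n) → ℝ} (hF : ContDiff ℝ ∞ F)
    (u₀ : EuclideanSpace ℝ (Fin n)) :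
    ∃ k : Fin n → EuclideanSpace ℝ (Fin n) → ℝ, (∀ i, ContDiff ℝ ∞ (k i)) ∧
      ∀ u, F u = F u₀ + ∑ i, (u i - u₀ i) * k i u := by
  have hF' : ContDiff ℝ ∞ (fderiv ℝ F) := hF.fderiv_right (by simp)
  have hline : ContDiff ℝ ∞ fun p : EuclideanSpace ℝ (Fin n) × ℝ => u₀ + p.2 • (p.1 - u₀) :=
    contDiff_const.add (contDiff_snd.smul (contDiff_fst.sub contDiff_const))
  have hG : ∀ v, ContDiff ℝ ∞ fun p : EuclideanSpace ℝ (Fin n) × ℝ =>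
      fderiv ℝ F (u₀ + p.2 • (p.1 - u₀)) v := fun v =>
    (hF'.comp hline).clm_apply contDiff_const
  have hint : ∀ u v, IntervalIntegrable (fun t : ℝ => fderiv ℝ F (u₀ + t • (u - u₀)) v)
      volume 0 1 := fun u v => by
    have : ContDiff ℝ ∞ fun t : ℝ => fderiv ℝ F (u₀ + t • (u - u₀)) v :=
      (hG v).comp (contDiff_const.prodMk contDiff_id)
    exact this.continuous.intervalIntegrable _ _
  refine ⟨fun i u => ∫ t in (0 : ℝ)..1, fderiv ℝ F (u₀ + t • (u - u₀))
    (EuclideanSpace.single i 1), fun i => contDiff_integral_zero_one (hG _), fun u => ?_⟩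
  have h1 : ∫ t in (0 : ℝ)..1, fderiv ℝ F (u₀ + t • (u - u₀)) (u - u₀) = F u - F u₀ := by
    have := intervalIntegral.integral_eq_sub_of_hasDerivAt (a := 0) (b := 1)
      (f := fun t : ℝ => F (u₀ + t • (u - u₀)))
      (f' := fun t => fderiv ℝ F (u₀ + t • (u - u₀)) (u - u₀)) (fun t _ => by
        have hd : HasDerivAt (fun t : ℝ => u₀ + t • (u - u₀)) (u - u₀) t := by
          simpa using ((hasDerivAt_id t).smul_const (u - u₀)).const_add u₀
        exact (hF.differentiable (by simp) _).hasFDerivAt.comp_hasDerivAt t hd) (hint u _)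
    rw [this]
    simp
  have h2 : u - u₀ = ∑ i, (u i - u₀ i) • EuclideanSpace.single i (1 : ℝ) := by
    have := (EuclideanSpace.basisFun (Fin n) ℝ).sum_repr (u - u₀)
    simpa using this.symm
  have h3 : ∀ t : ℝ, fderiv ℝ F (u₀ + t • (u - u₀)) (u - u₀)
      = ∑ i, (u i - u₀ i) * fderiv ℝ F (u₀ + t • (u - u₀)) (EuclideanSpace.single i 1) := by
    intro t
    conv_lhs => rw [h2, map_sum]
    simp only [map_smul, smul_eq_mul]
    rw [← h2]
  simp only [h3] at h1
  rw [intervalIntegral.integral_finsetSum fun i _ => (hint u _).const_mul _] at h1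
  simp only [intervalIntegral.integral_const_mul] at h1
  rw [h1]
  ring

end Hadamard

theorem contMDiffAt_of_coordinates {n : ℕ} {M : Type*} [TopologicalSpace M]
    [ChartedSpace (EuclideanSpace ℝ (Fin n)) M] {f : M → EuclideanSpace ℝ (Fin n)} {x : M}
    (hf : ∀ i, ContMDiffAt (𝓡 n) 𝓘(ℝ, ℝ) ∞ (fun y => f y i) x) :
    ContMDiffAt (𝓡 n) 𝓘(ℝ, EuclideanSpace ℝ (Fin n)) ∞ f x :=
  ((EuclideanSpace.equiv (Fin n) ℝ).symm.contDiff.contMDiff.contMDiffAt).comp x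
    (contMDiffAt_pi_space.2 hf)

theorem SmoothFn.sum_apply {n : ℕ} {M ι : Type*} [TopologicalSpace M]
    [ChartedSpace (EuclideanSpace ℝ (Fin n)) M] (s : Finset ι) (f : ι → SmoothFn n M) (x : M) :
    (∑ i ∈ s, f i) x = ∑ i ∈ s, f i x := by
  rw [← ContMDiffMap.coeFnAddMonoidHom_apply, map_sum, Finset.sum_apply]
  rfl

/-! ### Vector fields are the derivations of the smooth functions. -/

section Derivations

open Set Filter Topology

variable {n : ℕ} {M : Type*} [TopologicalSpace M] [ChartedSpace (EuclideanSpace ℝ (Fin n)) M]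
  [IsManifold (𝓡 n) ∞ M]

theorem exists_coordinates [T2Space M] {x₀ x : M} (hx : x ∈ (extChartAt (𝓡 n) x₀).source) :
    ∃ Y : Fin n → SmoothFn n M, ∀ i, ∀ᶠ y in 𝓝 x, Y i y = extChartAt (𝓡 n) x₀ y i := by
  choose Y hY using fun i : Fin n => exists_smoothFn_eventuallyEq_chart (n := n) hx
    (h := fun u => u i) (EuclideanSpace.proj (𝕜 := ℝ) i).contDiff.contDiffOn
  exact ⟨Y, hY⟩

theorem mfderiv_coordinate {x₀ x : M} (hx : x ∈ (extChartAt (𝓡 n) x₀).source) {Y : SmoothFn n M}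
    {i : Fin n} (hY : ∀ᶠ y in 𝓝 x, Y y = extChartAt (𝓡 n) x₀ y i) (v : TangentSpace (𝓡 n) x) :
    mfderiv (𝓡 n) 𝓘(ℝ, ℝ) Y x v =
      EuclideanSpace.proj (𝕜 := ℝ) i
        (mfderiv (𝓡 n) 𝓘(ℝ, EuclideanSpace ℝ (Fin n)) (extChartAt (𝓡 n) x₀) x v) := by
  have h1 : (Y : M → ℝ) =ᶠ[𝓝 x]
      (EuclideanSpace.proj (𝕜 := ℝ) i) ∘ (extChartAt (𝓡 n) x₀) := hY
  rw [h1.mfderiv_eq]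
  have h2 := mfderiv_comp x (g := (EuclideanSpace.proj (𝕜 := ℝ) i : EuclideanSpace ℝ (Fin n) → ℝ))
    (f := extChartAt (𝓡 n) x₀)
    (EuclideanSpace.proj (𝕜 := ℝ) i).differentiableAt.mdifferentiableAt
    ((contMDiffAt_extChartAt_source hx).mdifferentiableAt (by simp))
  rw [h2, mfderiv_eq_fderiv, ContinuousLinearMap.fderiv]
  rfl

theorem tangent_ext [T2Space M] {x : M} {v w : TangentSpace (𝓡 n) x}
    (h : ∀ g : SmoothFn n M, mfderiv (𝓡 n) 𝓘(ℝ, ℝ) g x v = mfderiv (𝓡 n) 𝓘(ℝ, ℝ) g x w) :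
    v = w := by
  have hx := mem_extChartAt_source (I := 𝓡 n) x
  obtain ⟨Y, hY⟩ := exists_coordinates hx
  have h1 : (mfderiv (𝓡 n) 𝓘(ℝ, EuclideanSpace ℝ (Fin n)) (extChartAt (𝓡 n) x) x v :
        EuclideanSpace ℝ (Fin n)) = mfderiv (𝓡 n) 𝓘(ℝ, EuclideanSpace ℝ (Fin n))
        (extChartAt (𝓡 n) x) x w := by
    refine PiLp.ext fun i => ?_
    exact (mfderiv_coordinate hx (hY i) v).symm.trans
      ((h _).trans (mfderiv_coordinate hx (hY i) w))
  have : IsManifold (𝓡 n) 1 M := .of_le (n := ∞) (by simp)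
  exact (isInvertible_mfderiv_extChartAt hx).injective h1

/-- A field of tangent vectors is smooth if all derivatives of smooth functions in its direction
are. -/
theorem contMDiff_section_of_forall [T2Space M] (s : (x : M) → TangentSpace (𝓡 n) x)
    (hs : ∀ g : SmoothFn n M, ContMDiff (𝓡 n) 𝓘(ℝ, ℝ) ∞
      fun x => (mfderiv (𝓡 n) 𝓘(ℝ, ℝ) g x (s x) : ℝ)) :
    ContMDiff (𝓡 n) ((𝓡 n).prod 𝓘(ℝ, EuclideanSpace ℝ (Fin n))) ∞
      (fun x => (⟨x, s x⟩ : TangentBundle (𝓡 n) M)) := by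
  intro x₀
  have hs₀ := isOpen_extChartAt_source (I := 𝓡 n) x₀
  refine ((contMDiffOn_section_iff (x₀ := x₀) s).2 fun x hx => ?_).contMDiffAt
    (hs₀.mem_nhds (mem_extChartAt_source x₀))
  refine ContMDiffAt.contMDiffWithinAt ?_
  refine contMDiffAt_of_coordinates fun i => ?_
  obtain ⟨Y, hY⟩ := exists_coordinates hx
  refine (hs (Y i)).contMDiffAt.congr_of_eventuallyEq ?_
  filter_upwards [(hY i).eventually_nhds, hs₀.mem_nhds hx] with y hy hy'
  exact (mfderiv_coordinate hy' hy (s y)).symm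

/-- A point derivation that annihilates local coordinates is zero. -/
theorem pointDerivation_eq_zero [T2Space M] {x : M} (D : SmoothFn n M →ₗ[ℝ] ℝ)
    (hD : ∀ f g, D (f * g) = f x * D g + g x * D f) {Y : Fin n → SmoothFn n M}
    (hY : ∀ i, ∀ᶠ y in 𝓝 x, Y i y = extChartAt (𝓡 n) x y i) (hDY : ∀ i, D (Y i) = 0)
    (g : SmoothFn n M) : D g = 0 := by
  have hone : D 1 = 0 := by
    have h1 : D (1 * 1) = (1 : ℝ) * D 1 + (1 : ℝ) * D 1 := hD 1 1
    rw [mul_one] at h1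
    linarith
  have hconst : ∀ c : ℝ, D (algebraMap ℝ _ c) = 0 := fun c => by
    rw [Algebra.algebraMap_eq_smul_one, map_smul, hone, smul_zero]
  -- Locality: a bump function `χ` supported where `f` vanishes gives `χ * f = 0`, while the Leibniz
  -- rule at `x` gives `D (χ * f) = D f`.
  have hlocal : ∀ f : SmoothFn n M, (∀ᶠ y in 𝓝 x, f y = 0) → D f = 0 := by
    intro f hf
    obtain ⟨χ, hχ, hs⟩ := exists_bump (n := n) hf
    have h1 : χ * f = 0 := by
      ext y
      change χ y * f y = 0
      by_cases hy : y ∈ tsupport χ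
      · rw [show f y = 0 from hs hy, mul_zero]
      · rw [image_eq_zero_of_notMem_tsupport hy, zero_mul]
    have h2 := hD χ f
    rw [h1, map_zero, hχ.self_of_nhds, hf.self_of_nhds, one_mul, zero_mul, add_zero] at h2
    exact h2.symm
  have hx := mem_extChartAt_source (I := 𝓡 n) x
  have htgt := (isOpen_extChartAt_target (I := 𝓡 n) x).mem_nhds (mem_extChartAt_target x)
  -- Hadamard's lemma integrates along segments, which may leave the chart target; so the local
  -- expression of `g` is first replaced by a function on all of `ℝⁿ` with the same germ.
  obtain ⟨F, hF⟩ := exists_smoothFn_eventuallyEq htgt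
    (h := fun u => g ((extChartAt (𝓡 n) x).symm u))
    (contDiffOn_comp_extChartAt_symm g.contMDiff x).contMDiffOn
  obtain ⟨k, hk, hFk⟩ := exists_eq_add_sum_mul F.contMDiff.contDiff (extChartAt (𝓡 n) x x)
  choose G hG using fun i : Fin n => exists_smoothFn_eventuallyEq_chart (n := n) hx
    (h := k i) (hk i).contDiffOn
  let c := extChartAt (𝓡 n) x x
  have hzero : D (g - algebraMap ℝ _ (F c) - ∑ i, (Y i - algebraMap ℝ _ (c i)) * G i) = 0 := by
    refine hlocal _ ?_
    have hcont := (continuousAt_extChartAt (I := 𝓡 n) x).eventually hF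
    filter_upwards [eventually_all.2 hY, eventually_all.2 hG, hcont,
      (isOpen_extChartAt_source (I := 𝓡 n) x).mem_nhds hx] with y h1 h2 h3 h4
    have h5 : (∑ i, (Y i - algebraMap ℝ (SmoothFn n M) (c i)) * G i : SmoothFn n M) y
        = ∑ i, (Y i y - c i) * G i y :=
      SmoothFn.sum_apply _ _ _
    change g y - F c - (∑ i, (Y i - algebraMap ℝ (SmoothFn n M) (c i)) * G i : SmoothFn n M) y = 0
    rw [h5]
    simp only [h1, h2]
    rw [(extChartAt (𝓡 n) x).left_inv h4, hFk] at h3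
    rw [← h3]
    ring
  rw [map_sub, map_sub, hconst, map_sum, sub_zero, sub_eq_zero] at hzero
  rw [hzero]
  refine Finset.sum_eq_zero fun i _ => ?_
  rw [hD, map_sub, hDY, hconst, sub_zero, mul_zero, add_zero]
  have : (Y i - algebraMap ℝ (SmoothFn n M) (c i)) x = Y i x - c i := rfl
  rw [this, (hY i).self_of_nhds, sub_self, zero_mul]

theorem exists_vectorField_apply_eq [T2Space M] {x : M} (v : TangentSpace (𝓡 n) x) :
    ∃ X : SmoothVectorField n M, X x = v := by
  have hx := mem_extChartAt_source (I := 𝓡 n) x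
  obtain ⟨X, hX⟩ := exists_vectorField_eventuallyEq hx
    (V := fun _ => mfderiv (𝓡 n) 𝓘(ℝ, EuclideanSpace ℝ (Fin n)) (extChartAt (𝓡 n) x) x v)
    contDiffOn_const
  refine ⟨X, hX.self_of_nhds.trans ?_⟩
  have h1 := mfderiv_extChartAt_symm_comp ((extChartAt (𝓡 n) x).map_source hx)
  rw [(extChartAt (𝓡 n) x).left_inv hx] at h1
  exact DFunLike.congr_fun h1 v

namespace SmoothVectorField

/-- A smooth vector field as a derivation of the algebra of smooth functions. -/
noncomputable def toDerivation (X : SmoothVectorField n M) :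
    Derivation ℝ (SmoothFn n M) (SmoothFn n M) :=
  Derivation.mk' X.toEnd fun a b => X.toEnd_mul a b

@[simp] theorem toDerivation_apply (X : SmoothVectorField n M) (g : SmoothFn n M) :
    X.toDerivation g = X.toEnd g := rfl

theorem derivationOp_toDerivation (f : SmoothFn n M) (X : SmoothVectorField n M) :
    derivationOp f X.toDerivation = firstOrderOp f X := rfl

theorem toDerivation_injective [T2Space M] :
    Function.Injective (toDerivation : SmoothVectorField n M → _) := by
  intro X X' h
  ext x
  exact tangent_ext fun g => DFunLike.congr_fun (DFunLike.congr_fun h g) x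

/-- At each point take the vector with components `δ (Y i) x` in local coordinates `Y i`. Its action
minus `δ` is a point derivation that kills these coordinates, hence is zero. The resulting field is
smooth because all `δ g` are. -/
theorem toDerivation_surjective [T2Space M] :
    Function.Surjective (toDerivation : SmoothVectorField n M → _) := by
  intro δ
  have key : ∀ x : M, ∃ v : TangentSpace (𝓡 n) x, ∀ g : SmoothFn n M,
      mfderiv (𝓡 n) 𝓘(ℝ, ℝ) g x v = δ g x := by
    intro x
    have hx := mem_extChartAt_source (I := 𝓡 n) x
    obtain ⟨Y, hY⟩ := exists_coordinates hx
    have : IsManifold (𝓡 n) 1 M := .of_le (n := ∞) (by simp)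
    obtain ⟨v, hv⟩ := (isInvertible_mfderiv_extChartAt hx).surjective
      (WithLp.toLp 2 fun i => δ (Y i) x : EuclideanSpace ℝ (Fin n))
    obtain ⟨X, hX⟩ := exists_vectorField_apply_eq v
    refine ⟨v, fun g => ?_⟩
    let D : SmoothFn n M →ₗ[ℝ] ℝ :=
      { toFun := fun g => X.toEnd g x - δ g x
        map_add' := fun f g => by
          rw [map_add, map_add]
          change X.toEnd f x + X.toEnd g x - (δ f x + δ g x) = _
          ring
        map_smul' := fun c g => by
          rw [map_smul, Derivation.map_smul]
          change c * X.toEnd g x - c * δ g x = c * (X.toEnd g x - δ g x)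
          ring }
    have hD := pointDerivation_eq_zero D (fun f g => by
      change X.toEnd (f * g) x - δ (f * g) x
        = f x * (X.toEnd g x - δ g x) + g x * (X.toEnd f x - δ f x)
      rw [toEnd_mul, Derivation.leibniz]
      change f x * X.toEnd g x + g x * X.toEnd f x - (f x * δ g x + g x * δ f x) = _
      ring) hY (fun i => by
        change X.toEnd (Y i) x - δ (Y i) x = 0
        rw [toEnd_apply, hX, mfderiv_coordinate hx (hY i), hv]
        exact sub_self (δ (Y i) x)) g
    have h2 : X.toEnd g x - δ g x = 0 := hD
    rw [toEnd_apply, hX] at h2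
    exact sub_eq_zero.1 h2
  choose s hs using key
  refine ⟨⟨s, contMDiff_section_of_forall s fun g => ?_⟩, ?_⟩
  · simp only [hs]
    exact (δ g).contMDiff
  · ext g x
    exact hs x g

theorem toDerivation_smul (a : SmoothFn n M) (X : SmoothVectorField n M) :
    ∃ Y : SmoothVectorField n M, (∀ x, Y x = a x • X x) ∧
      Y.toDerivation = a • X.toDerivation := by
  refine ⟨⟨fun x => a x • X x, a.contMDiff.smul_section X.contMDiff⟩, fun x => rfl, ?_⟩
  ext g x
  exact map_smul (mfderiv (𝓡 n) 𝓘(ℝ, ℝ) g x) (a x) (X x)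

theorem toDerivation_add (X Y : SmoothVectorField n M) :
    (X + Y).toDerivation = X.toDerivation + Y.toDerivation := by
  ext g x
  exact map_add (mfderiv (𝓡 n) 𝓘(ℝ, ℝ) g x) (X x) (Y x)

theorem toDerivation_const_smul (c : ℝ) (X : SmoothVectorField n M) :
    (c • X).toDerivation = c • X.toDerivation := by
  ext g x
  exact map_smul (mfderiv (𝓡 n) 𝓘(ℝ, ℝ) g x) c (X x)

end SmoothVectorField

end Derivations

/-! ### Two functions without common critical points; derivatives generate the unit ideal. -/

section Submersive

open Set Filter Topology

variable {n : ℕ} {M : Type*} [TopologicalSpace M] [ChartedSpace (EuclideanSpace ℝ (Fin n)) M]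
  [IsManifold (𝓡 n) ∞ M]

/-- The point `x` is not a common critical point of the functions `f a`. -/
def IsJointlyRegularAt {ι : Type*} (f : ι → SmoothFn n M) (x : M) : Prop :=
  ∃ (X : SmoothVectorField n M) (a : ι), X.toEnd (f a) x ≠ 0

theorem IsJointlyRegularAt.congr {ι : Type*} {f g : ι → SmoothFn n M} {x : M}
    (hf : IsJointlyRegularAt f x) (h : ∀ a, ∀ᶠ y in 𝓝 x, f a y = g a y) :
    IsJointlyRegularAt g x := by
  obtain ⟨X, a, ha⟩ := hf
  refine ⟨X, a, ?_⟩
  have : (f a : M → ℝ) =ᶠ[𝓝 x] g a := h a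
  rw [X.toEnd_apply] at ha ⊢
  rwa [this.mfderiv_eq] at ha

theorem isOpen_toEnd_ne_zero (f : SmoothFn n M) :
    IsOpen {x | ∃ X : SmoothVectorField n M, X.toEnd f x ≠ 0} := by
  rw [ofPred_exists]
  exact isOpen_iUnion fun X => isOpen_ne_fun (X.toEnd f).contMDiff.continuous continuous_const

/-- The functions are perturbed by linear combinations of the cut-off coordinates `χ * xⱼ`. Small
coefficients `l` preserve regularity on `K`. Where `χ = 1`, a common critical point means that `l`
is minus the matrix of partial derivatives of `f`; as the point varies, these matrices miss a dense
set. -/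
theorem exists_modification_isJointlyRegular [T2Space M] (hn : 1 ≤ n) (f : Fin 2 → SmoothFn n M)
    {K : Set M} (hK : IsCompact K) (hf : ∀ x ∈ K, IsJointlyRegularAt f x) {c : M}
    (χ : SmoothBumpFunction (𝓡 n) c) {C : Set M} (hC : ∀ x ∈ C, χ =ᶠ[𝓝 x] 1) :
    ∃ f' : Fin 2 → SmoothFn n M, (∀ x ∈ K ∪ C, IsJointlyRegularAt f' x) ∧
      ∀ a, ∀ x ∉ Function.support χ, f' a x = f a x := by
  let h : Fin n → SmoothFn n M := fun j => ⟨fun x => χ x • extChartAt (𝓡 n) c x j, by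
    refine χ.contMDiff_smul ?_
    exact (EuclideanSpace.proj (𝕜 := ℝ) j).contDiff.contMDiff.comp_contMDiffOn
      contMDiffOn_extChartAt⟩
  have hh : ∀ j x, h j x = χ x * extChartAt (𝓡 n) c x j := fun j x => rfl
  let g : (Fin 2 → Fin n → ℝ) → Fin 2 → SmoothFn n M := fun l a => f a + ∑ j, l a j • h j
  have hg : ∀ l a x, g l a x = f a x + ∑ j, l a j * h j x := by
    intro l a x
    change f a x + (∑ j, l a j • h j : SmoothFn n M) x = _
    rw [SmoothFn.sum_apply]
    rfl
  have hXg : ∀ (X : SmoothVectorField n M) l a x,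
      X.toEnd (g l a) x = X.toEnd (f a) x + ∑ j, l a j * X.toEnd (h j) x := by
    intro X l a x
    simp only [g, map_add, map_sum, map_smul]
    change X.toEnd (f a) x + (∑ j, l a j • X.toEnd (h j) : SmoothFn n M) x = _
    rw [SmoothFn.sum_apply]
    rfl
  -- Regularity is an open condition on the pair `(l, x)`, and `K` is compact.
  have hsmall : ∀ᶠ l in 𝓝 (0 : Fin 2 → Fin n → ℝ), ∀ x ∈ K, IsJointlyRegularAt (g l) x := by
    refine hK.eventually_forall_of_forall_eventually fun x hx => ?_
    obtain ⟨X, a, ha⟩ := hf x hx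
    have hcont : Continuous fun z : (Fin 2 → Fin n → ℝ) × M => X.toEnd (g z.1 a) z.2 := by
      simp only [hXg]
      refine ((X.toEnd (f a)).contMDiff.continuous.comp continuous_snd).add
        (continuous_finsetSum _ fun j _ => Continuous.mul (by fun_prop)
          ((X.toEnd (h j)).contMDiff.continuous.comp continuous_snd))
    have h0 : X.toEnd (g (0, x).1 a) (0, x).2 ≠ 0 := by
      rw [hXg]
      simpa using ha
    filter_upwards [hcont.continuousAt.eventually_ne h0] with z hz
    exact ⟨X, a, hz⟩
  let s := Metric.ball (extChartAt (𝓡 n) c c) χ.rOut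
  have hs : s ⊆ (extChartAt (𝓡 n) c).target := by
    have := χ.ball_subset
    rwa [modelWithCornersSelf_coe, range_id, inter_univ] at this
  let G : EuclideanSpace ℝ (Fin n) → Fin 2 → Fin n → ℝ := fun u a j =>
    -fderiv ℝ (fun u => f a ((extChartAt (𝓡 n) c).symm u)) u (EuclideanSpace.single j 1)
  have hG : ContDiffOn ℝ 1 G s := by
    refine contDiffOn_pi.2 fun a => contDiffOn_pi.2 fun j => ContDiffOn.neg ?_
    exact ((((contDiffOn_comp_extChartAt_symm (f a).contMDiff c).mono hs).fderiv_of_isOpen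
      Metric.isOpen_ball (m := ∞) (by simp)).of_le (by simp)).clm_apply contDiffOn_const
  -- A `C¹` image of an `n`-dimensional set has dimension at most `n`, less than `2 * n`. This is
  -- why two functions are used and why `n ≥ 1`.
  have hdense : Dense (G '' s)ᶜ := by
    refine hG.dense_compl_image_of_dimH_lt_finrank (convex_ball _ _) Subset.rfl ?_
    calc dimH s ≤ dimH (univ : Set (EuclideanSpace ℝ (Fin n))) := dimH_mono (subset_univ _)
      _ = n := by rw [Real.dimH_univ_eq_finrank]; simp
      _ < Module.finrank ℝ (Fin 2 → Fin n → ℝ) := by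
        rw [Module.finrank_pi_fintype]
        simp only [Module.finrank_fintype_fun_eq_card, Fintype.card_fin, Finset.sum_const,
          Finset.card_univ, smul_eq_mul]
        exact_mod_cast (by omega : n < 2 * n)
  obtain ⟨l, hl1, hl2⟩ := mem_closure_iff_nhds.1 (hdense 0) _ hsmall
  refine ⟨g l, ?_, fun a x hx => ?_⟩
  · rintro x (hx | hx)
    · exact hl1 x hx
    by_contra hbad
    refine hl2 ?_
    have hx1 : x ∈ Function.support χ := by
      rw [Function.mem_support, (hC x hx).self_of_nhds]
      exact one_ne_zero
    rw [χ.support_eq_inter_preimage, ← extChartAt_source (𝓡 n)] at hx1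
    refine ⟨extChartAt (𝓡 n) c x, hx1.2, ?_⟩
    funext a j
    obtain ⟨X, hX⟩ := exists_vectorField_eventuallyEq hx1.1
      (V := fun _ => EuclideanSpace.single j 1) contDiffOn_const
    have hXx := hX.self_of_nhds
    have h1 : X.toEnd (g l a) x = 0 := by
      by_contra h2
      exact hbad ⟨X, a, h2⟩
    have h2 : ∀ k, X.toEnd (h k) x = if k = j then 1 else 0 := by
      intro k
      have hcoord : ∀ᶠ y in 𝓝 x, h k y = extChartAt (𝓡 n) c y k := by
        filter_upwards [hC x hx] with y hy
        rw [hh, hy, Pi.one_apply, one_mul]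
      rw [X.toEnd_apply, mfderiv_coordinate hx1.1 hcoord, hXx]
      have h3 := mfderiv_extChartAt_comp_symm ((extChartAt (𝓡 n) c).map_source hx1.1)
      rw [(extChartAt (𝓡 n) c).left_inv hx1.1] at h3
      have h4 := DFunLike.congr_fun h3 (EuclideanSpace.single j (1 : ℝ))
      refine (congrArg (fun v : EuclideanSpace ℝ (Fin n) => v k) h4).trans ?_
      exact (PiLp.single_apply 2 ℝ j (1 : ℝ) k)
    have h5 : X.toEnd (f a) x = fderiv ℝ (fun u => f a ((extChartAt (𝓡 n) c).symm u))
        (extChartAt (𝓡 n) c x) (EuclideanSpace.single j 1) := by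
      rw [← SmoothVectorField.mfderiv_eq_fderiv_chart (f a)
        ((extChartAt (𝓡 n) c).map_source hx1.1), X.toEnd_apply, hXx,
        (extChartAt (𝓡 n) c).left_inv hx1.1]
    rw [hXg, h5] at h1
    simp only [h2, mul_ite, mul_one, mul_zero, Finset.sum_ite_eq', Finset.mem_univ, if_true] at h1
    change -fderiv ℝ _ _ _ = _
    linarith
  · rw [Function.notMem_support] at hx
    rw [hg]
    simp [hh, hx]

/-- There are two smooth functions without common critical points. -/
theorem exists_isJointlyRegular [T2Space M] [SigmaCompactSpace M] (hn : 1 ≤ n) :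
    ∃ f : Fin 2 → SmoothFn n M, ∀ x, IsJointlyRegularAt f x := by
  have : LocallyCompactSpace M := ChartedSpace.locallyCompactSpace (EuclideanSpace ℝ (Fin n)) M
  obtain ⟨ι, fs, -⟩ := SmoothBumpCovering.exists_isSubordinate (𝓡 n) (isClosed_univ (X := M))
    (U := fun _ => univ) fun x _ => univ_mem
  have hlf : LocallyFinite fun i => Function.support (fs i) := fs.locallyFinite
  have hcount : Countable ι :=
    countable_univ_iff.1 (hlf.countable_univ fun i => (fs i).nonempty_support)
  -- An enumeration of the patches: step `k` modifies the functions on the patch `i` with `e i = k`,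
  -- and does nothing if there is none.
  obtain ⟨e, he⟩ := exists_injective_nat ι
  let V : ι → Set M := fun i => {x | fs i =ᶠ[𝓝 x] 1}
  have hVsupp : ∀ i, V i ⊆ Function.support (fs i) := fun i x hx => by
    have h1 : fs i x = 1 := Filter.EventuallyEq.eq_of_nhds hx
    rw [Function.mem_support, h1]
    exact one_ne_zero
  obtain ⟨v, hv, -, hvV⟩ := exists_iUnion_eq_closure_subset (u := V)
    (fun i => isOpen_setOfPred_eventually_nhds)
    (fun x => (hlf.point_finite x).subset fun i hi => hVsupp i hi)
    (iUnion_eq_univ_iff.2 fun x => ⟨fs.ind x trivial, fs.eventuallyEq_one x trivial⟩)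
  have hcomp : ∀ i, IsCompact (closure (v i)) := fun i =>
    ((fs i).hasCompactSupport.isCompact).of_isClosed_subset isClosed_closure
      (((hvV i).trans (hVsupp i)).trans subset_closure)
  let P : ℕ → (Fin 2 → SmoothFn n M) → Prop := fun k f =>
    ∀ i, e i < k → ∀ x ∈ closure (v i), IsJointlyRegularAt f x
  have hstep : ∀ k f, P k f → ∃ f', P (k + 1) f' ∧
      ∀ a x, f' a x ≠ f a x → ∃ i, e i = k ∧ x ∈ Function.support (fs i) := by
    intro k f hf
    by_cases hk : ∃ i, e i = k
    · obtain ⟨i, rfl⟩ := hk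
      have hfin : {j | e j < e i}.Finite := (finite_lt_nat (e i)).preimage he.injOn
      obtain ⟨f', h1, h2⟩ := exists_modification_isJointlyRegular hn f
        (K := ⋃ j ∈ {j | e j < e i}, closure (v j)) (hfin.isCompact_biUnion fun j _ => hcomp j)
        (fun x hx => by
          obtain ⟨j, hj, hx⟩ := mem_iUnion₂.1 hx
          exact hf j hj x hx) (fs i) (C := closure (v i)) (fun x hx => hvV i hx)
      refine ⟨f', fun j hj x hx => ?_, fun a x hx => ⟨i, rfl, ?_⟩⟩
      · rcases Nat.lt_succ_iff_lt_or_eq.1 hj with hj | hj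
        · exact h1 x (Or.inl (mem_iUnion₂.2 ⟨j, hj, hx⟩))
        · rw [he hj] at hx
          exact h1 x (Or.inr hx)
      · by_contra h3
        exact hx (h2 a x h3)
    · refine ⟨f, fun j hj x hx => hf j ?_ x hx, fun a x hx => (hx rfl).elim⟩
      exact lt_of_le_of_ne (Nat.lt_succ_iff.1 hj) fun h => hk ⟨j, h⟩
  choose! next hnext1 hnext2 using hstep
  let F : ℕ → Fin 2 → SmoothFn n M := fun k => Nat.rec 0 next k
  have hF : ∀ k, P k (F k) := by
    intro k
    induction k with
    | zero => exact fun i hi => (Nat.not_lt_zero _ hi).elim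
    | succ k ih => exact hnext1 k _ ih
  -- Near each point only finitely many steps change the functions. So the sequence is locally
  -- eventually constant, and its limit inherits smoothness and regularity.
  have hlf' : LocallyFinite fun k => {x | (fun a => F (k + 1) a x) ≠ fun a => F k a x} := by
    intro x
    obtain ⟨t, ht, hfin⟩ := hlf x
    refine ⟨t, ht, (hfin.image e).subset ?_⟩
    rintro k ⟨y, hy, hyt⟩
    obtain ⟨a, ha⟩ := Function.ne_iff.1 hy
    obtain ⟨i, rfl, hi⟩ := hnext2 k _ (hF k) a y ha
    exact ⟨i, ⟨y, hi, hyt⟩, rfl⟩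
  obtain ⟨G, hG⟩ := LocallyFinite.exists_forall_eventually_atTop_eventuallyEq
    (f := fun k x a => F k a x) hlf'
  let f : Fin 2 → SmoothFn n M := fun a => ⟨fun x => G x a, fun x => by
    obtain ⟨k, hk⟩ := (hG x).exists
    refine (F k a).contMDiff.contMDiffAt.congr_of_eventuallyEq ?_
    filter_upwards [hk] with y hy
    exact (congrFun hy a).symm⟩
  refine ⟨f, fun x => ?_⟩
  obtain ⟨i, hi⟩ := iUnion_eq_univ_iff.1 hv x
  obtain ⟨k, hk1, hk2⟩ := ((hG x).and (eventually_gt_atTop (e i))).exists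
  refine (hF k i hk2 x (subset_closure hi)).congr fun a => ?_
  filter_upwards [hk1] with y hy
  exact congrFun hy a

/-- The regular sets of the two functions `f a` cover `M`. With a subordinate partition of unity `χ
a`, fields with `X a (f a) = χ a` give `1` as a sum of two derivatives. -/
theorem derivativeIdeal_eq_top [T2Space M] [SigmaCompactSpace M] (hn : 1 ≤ n) :
    derivativeIdeal ℝ (SmoothFn n M) = ⊤ := by
  obtain ⟨f, hf⟩ := exists_isJointlyRegular (M := M) hn
  let U : Fin 2 → Set M := fun a => {x | ∃ X : SmoothVectorField n M, X.toEnd (f a) x ≠ 0}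
  obtain ⟨χ, hχ⟩ := SmoothPartitionOfUnity.exists_isSubordinate (𝓡 n) (isClosed_univ (X := M)) U
    (fun a => isOpen_toEnd_ne_zero (f a)) (fun x _ => by
      obtain ⟨X, a, ha⟩ := hf x
      exact mem_iUnion.2 ⟨a, X, ha⟩)
  have key : ∀ a, ∃ X : SmoothVectorField n M, ∀ x, X.toEnd (f a) x = χ a x := by
    intro a
    -- The equation is affine in `X`, so local solutions can be glued. Where `Y (f a)` is nonzero,
    -- rescale `Y`; off the support of `χ a`, take zero.
    obtain ⟨X, hX⟩ := exists_contMDiffSection_forall_mem_convex_of_local (𝓡 n) (n := ⊤)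
      (TangentSpace (𝓡 n) : M → Type _)
      (fun x => {v | mfderiv (𝓡 n) 𝓘(ℝ, ℝ) (f a) x v = χ a x})
      (fun x v hv w hw s t _ _ hst => by
        rw [mem_ofPred_eq] at hv hw ⊢
        rw [map_add, map_smul, map_smul, hv, hw]
        change s * χ a x + t * χ a x = χ a x
        rw [← add_mul, hst, one_mul])
      (fun x => by
        by_cases hx : x ∈ U a
        · obtain ⟨Y, hY⟩ := hx
          have hopen : IsOpen {y | Y.toEnd (f a) y ≠ 0} :=
            isOpen_ne_fun (Y.toEnd (f a)).contMDiff.continuous continuous_const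
          refine ⟨_, hopen.mem_nhds hY, fun y => (χ a y / Y.toEnd (f a) y) • Y y, ?_,
            fun y hy => ?_⟩
          · refine ContMDiffOn.smul_section (fun y hy => ?_) Y.contMDiff.contMDiffOn
            exact ((χ a).contMDiff.contMDiffAt.div₀ (Y.toEnd (f a)).contMDiff.contMDiffAt
              hy).contMDiffWithinAt
          · rw [mem_ofPred_eq, map_smul, ← Y.toEnd_apply]
            exact div_mul_cancel₀ (χ a y) hy
        · refine ⟨(tsupport (χ a))ᶜ, (isClosed_tsupport _).isOpen_compl.mem_nhds
            fun h => hx (hχ a h), fun _ => 0, ?_, fun y hy => ?_⟩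
          · exact (Bundle.contMDiff_zeroSection ℝ _).contMDiffOn
          · rw [mem_ofPred_eq, map_zero, image_eq_zero_of_notMem_tsupport hy]
            rfl)
    exact ⟨X, hX⟩
  choose X hX using key
  rw [Ideal.eq_top_iff_one]
  have h1 : (1 : SmoothFn n M) = ∑ a, (X a).toDerivation (f a) := by
    ext x
    have h2 := χ.sum_eq_one (mem_univ x)
    rw [finsum_eq_sum_of_fintype] at h2
    rw [SmoothFn.sum_apply]
    refine h2.symm.trans (Finset.sum_congr rfl fun a _ => (hX a x).symm)
  rw [h1]
  exact Ideal.sum_mem _ fun a _ => Ideal.subset_span ⟨_, _, rfl⟩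

end Submersive

/-! ### Characters are evaluations, and algebra automorphisms come from diffeomorphisms. -/

section Characters

open Set Filter Topology

variable {n : ℕ} {M : Type*} [TopologicalSpace M] [ChartedSpace (EuclideanSpace ℝ (Fin n)) M]

/-- The automorphism `f ↦ f ∘ φ⁻¹` of the algebra of smooth functions. -/
noncomputable def compSymmAlgEquiv (φ : M ≃ₘ^∞⟮𝓡 n, 𝓡 n⟯ M) :
    SmoothFn n M ≃ₐ[ℝ] SmoothFn n M where
  toFun f := f.comp φ.symm.toContMDiffMap
  invFun f := f.comp φ.toContMDiffMap
  left_inv f := by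
    ext x
    exact congrArg f (φ.symm_apply_apply x)
  right_inv f := by
    ext x
    exact congrArg f (φ.apply_symm_apply x)
  map_mul' _ _ := rfl
  map_add' _ _ := rfl
  commutes' _ := rfl

theorem compSymmAlgEquiv_apply (φ : M ≃ₘ^∞⟮𝓡 n, 𝓡 n⟯ M) (f : SmoothFn n M) (x : M) :
    compSymmAlgEquiv φ f x = f (φ.symm x) := rfl

variable [IsManifold (𝓡 n) ∞ M]

/-- There is a smooth function whose sublevel sets are compact. -/
theorem exists_exhaustion [T2Space M] [SigmaCompactSpace M] :
    ∃ f : SmoothFn n M, ∀ R : ℝ, IsCompact {x | f x ≤ R} := by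
  have : LocallyCompactSpace M := ChartedSpace.locallyCompactSpace (EuclideanSpace ℝ (Fin n)) M
  let K := CompactExhaustion.choice M
  -- The condition `f ≥ i` off `K i` is convex in the value, and the constant `j` satisfies it near
  -- a point of which `K j` is a neighbourhood.
  obtain ⟨f, hf⟩ := exists_contMDiffMap_forall_mem_convex_of_local_const (𝓡 n) (n := ⊤)
    (t := fun y : M => {r : ℝ | ∀ i : ℕ, y ∉ K i → (i : ℝ) ≤ r})
    (fun y => by
      intro r hr s hs a b ha hb hab i hi
      have h1 := hr i hi
      have h2 := hs i hi
      simp only [smul_eq_mul]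
      calc (i : ℝ) = a * i + b * i := by rw [← add_mul, hab, one_mul]
        _ ≤ a * r + b * s := by gcongr)
    (fun x => by
      obtain ⟨j, hj⟩ := K.exists_mem_nhds x
      refine ⟨j, ?_⟩
      filter_upwards [hj] with y hy i hi
      have : i ≤ j := by
        by_contra h
        exact hi (K.subset (not_le.1 h).le hy)
      exact_mod_cast this)
  refine ⟨f, fun R => ?_⟩
  obtain ⟨i, hi⟩ := exists_nat_gt R
  refine (K.isCompact i).of_isClosed_subset
    (isClosed_le f.contMDiff.continuous continuous_const) fun x hx => ?_
  by_contra h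
  exact absurd (lt_of_lt_of_le hi (hf x i h)) (not_lt.2 hx)

/-- The characters of the algebra of smooth functions are the evaluations at points. -/
theorem exists_forall_eq_eval [T2Space M] [SigmaCompactSpace M] (χ : SmoothFn n M →ₐ[ℝ] ℝ) :
    ∃ x, ∀ f, χ f = f x := by
  by_contra! hcon
  obtain ⟨f, hf⟩ := exists_exhaustion (n := n) (M := M)
  choose g hg using hcon
  let G : M → SmoothFn n M := fun x => g x - algebraMap ℝ _ (χ (g x))
  let F : SmoothFn n M := f - algebraMap ℝ _ (χ f)
  have hG : ∀ x y, G x y = g x y - χ (g x) := fun x y => rfl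
  have hF : ∀ y, F y = f y - χ f := fun y => rfl
  have hχG : ∀ x, χ (G x) = 0 := fun x => by simp [G]
  have hχF : χ F = 0 := by simp [F]
  obtain ⟨t, -, ht⟩ := (hf (χ f)).elim_nhds_subcover (fun x => {y | G x y ≠ 0}) fun x _ =>
    (isOpen_ne_fun (G x).contMDiff.continuous continuous_const).mem_nhds (by
      change G x x ≠ 0
      rw [hG, sub_ne_zero]
      exact (hg x).symm)
  -- An element of the kernel of `χ` without zeros, hence invertible: `F` is positive off the
  -- compact set `{f ≤ χ f}`, finitely many `G x` take care of that set, and squares prevent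
  -- cancellation.
  let H : SmoothFn n M := F * F + ∑ x ∈ t, G x * G x
  have hH : ∀ y, H y = F y * F y + ∑ x ∈ t, G x y * G x y := fun y => by
    change F y * F y + (∑ x ∈ t, G x * G x : SmoothFn n M) y = _
    rw [SmoothFn.sum_apply]
    rfl
  have hHpos : ∀ y, 0 < H y := by
    intro y
    rw [hH]
    have h2 : 0 ≤ ∑ x ∈ t, G x y * G x y := Finset.sum_nonneg fun x _ => mul_self_nonneg _
    by_cases hy : f y ≤ χ f
    · obtain ⟨x, hx, hxy⟩ := mem_iUnion₂.1 (ht hy)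
      have h3 : 0 < ∑ x ∈ t, G x y * G x y :=
        Finset.sum_pos' (fun x _ => mul_self_nonneg _) ⟨x, hx, mul_self_pos.2 hxy⟩
      have h4 := mul_self_nonneg (F y)
      linarith
    · have h3 : 0 < F y * F y := mul_self_pos.2 (by
        rw [hF]
        linarith)
      linarith
  let H' : SmoothFn n M := ⟨fun y => (H y)⁻¹, fun y =>
    H.contMDiff.contMDiffAt.inv₀ (hHpos y).ne'⟩
  have hHH' : H * H' = 1 := by
    ext y
    exact mul_inv_cancel₀ (hHpos y).ne'
  have h1 : χ H = 0 := by
    simp only [H, map_add, map_mul, map_sum, hχF, hχG, mul_zero, Finset.sum_const_zero, add_zero]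
  have h2 := congrArg χ hHH'
  rw [map_mul, h1, zero_mul, map_one] at h2
  exact zero_ne_one h2

theorem eq_of_forall_smoothFn_eq [T2Space M] {x y : M} (h : ∀ f : SmoothFn n M, f x = f y) :
    x = y := by
  by_contra hxy
  obtain ⟨χ, hχ, hs⟩ := exists_bump (n := n) (isOpen_compl_singleton.mem_nhds hxy : {y}ᶜ ∈ 𝓝 x)
  have h1 := h χ
  rw [hχ.self_of_nhds, image_eq_zero_of_notMem_tsupport fun hy => hs hy rfl] at h1
  exact one_ne_zero h1

/-- A map that pulls smooth functions back to smooth functions is smooth. -/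
theorem contMDiff_of_forall_comp [T2Space M] {p : M → M}
    (hp : ∀ f : SmoothFn n M, ContMDiff (𝓡 n) 𝓘(ℝ, ℝ) ∞ fun x => f (p x)) :
    ContMDiff (𝓡 n) (𝓡 n) ∞ p := by
  intro x
  -- For a bump function `χ` supported in `U`, the point `p y` lies in `U` as long as `χ (p y) ≠ 0`.
  have hcont : ContinuousAt p x := by
    intro U hU
    obtain ⟨χ, hχ, hs⟩ := exists_bump (n := n) hU
    have h1 : ∀ᶠ y in 𝓝 x, χ (p y) ≠ 0 :=
      (hp χ).continuous.continuousAt.eventually_ne (by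
        rw [hχ.self_of_nhds]
        exact one_ne_zero)
    rw [mem_map]
    filter_upwards [h1] with y hy
    exact hs (subset_tsupport _ hy)
  rw [contMDiffAt_iff_target]
  refine ⟨hcont, contMDiffAt_of_coordinates fun i => ?_⟩
  obtain ⟨Y, hY⟩ := exists_coordinates (mem_extChartAt_source (I := 𝓡 n) (p x))
  refine (hp (Y i)).contMDiffAt.congr_of_eventuallyEq ?_
  filter_upwards [hcont.eventually (hY i)] with y hy
  exact hy.symm

/-- Every automorphism of the algebra of smooth functions is induced by a diffeomorphism. -/
theorem exists_diffeomorph_of_algEquiv [T2Space M] [SigmaCompactSpace M]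
    (σ : SmoothFn n M ≃ₐ[ℝ] SmoothFn n M) :
    ∃ φ : M ≃ₘ^∞⟮𝓡 n, 𝓡 n⟯ M, ∀ f x, σ f x = f (φ.symm x) := by
  have key : ∀ τ : SmoothFn n M ≃ₐ[ℝ] SmoothFn n M, ∃ p : M → M, ∀ f x, τ f x = f (p x) := by
    intro τ
    have h : ∀ x : M, ∃ y, ∀ f, τ f x = f y := fun x => by
      let χ : SmoothFn n M →ₐ[ℝ] ℝ := AlgHom.comp
        { toFun := fun f : SmoothFn n M => f x
          map_one' := rfl
          map_mul' := fun _ _ => rfl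
          map_zero' := rfl
          map_add' := fun _ _ => rfl
          commutes' := fun _ => rfl } τ.toAlgHom
      exact exists_forall_eq_eval χ
    choose p hp using h
    exact ⟨p, fun f x => hp x f⟩
  obtain ⟨p, hp⟩ := key σ
  obtain ⟨q, hq⟩ := key σ.symm
  have hsm : ∀ (τ : SmoothFn n M ≃ₐ[ℝ] SmoothFn n M) (p : M → M), (∀ f x, τ f x = f (p x)) →
      ContMDiff (𝓡 n) (𝓡 n) ∞ p := fun τ p hp => contMDiff_of_forall_comp fun f => by
    simp only [← hp]
    exact (τ f).contMDiff
  -- Since `σ` is the composition with `p`, the map `p` is the inverse `φ⁻¹` and `q` is `φ`.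
  refine ⟨⟨⟨q, p, fun x => ?_, fun x => ?_⟩, hsm _ q hq, hsm _ p hp⟩, hp⟩
  · refine eq_of_forall_smoothFn_eq (n := n) fun f => ?_
    rw [← hp, ← hq, σ.symm_apply_apply]
  · refine eq_of_forall_smoothFn_eq (n := n) fun f => ?_
    rw [← hq, ← hp, σ.apply_symm_apply]

theorem pushforwardOp_eq (φ : M ≃ₘ^∞⟮𝓡 n, 𝓡 n⟯ M) (X : SmoothVectorField n M)
    (g : SmoothFn n M) :
    pushforwardOp φ X (compSymmAlgEquiv φ g) = compSymmAlgEquiv φ (X.toEnd g) := by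
  have h : (compSymmAlgEquiv φ g).comp φ.toContMDiffMap = g := by
    ext x
    exact congrArg g (φ.symm_apply_apply x)
  unfold pushforwardOp
  rw [h]
  rfl

/-- A smooth function on a connected manifold that is annihilated by all vector fields is
constant. -/
theorem eq_const_of_forall_toEnd_eq_zero [T2Space M] [ConnectedSpace M] {f : SmoothFn n M}
    (hf : ∀ X : SmoothVectorField n M, X.toEnd f = 0) :
    ∃ c : ℝ, f = algebraMap ℝ (SmoothFn n M) c := by
  have hf' : ∀ x v, mfderiv (𝓡 n) 𝓘(ℝ, ℝ) f x v = 0 := by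
    intro x v
    obtain ⟨X, hX⟩ := exists_vectorField_apply_eq v
    rw [← hX]
    exact DFunLike.congr_fun (hf X) x
  have hloc : IsLocallyConstant f := by
    rw [IsLocallyConstant.iff_eventually_eq]
    intro x
    have hx := mem_extChartAt_source (I := 𝓡 n) x
    obtain ⟨r, hr, hball⟩ := Metric.isOpen_iff.1 (isOpen_extChartAt_target (I := 𝓡 n) x) _
      (mem_extChartAt_target (I := 𝓡 n) x)
    filter_upwards [(continuousAt_extChartAt (I := 𝓡 n) x).eventually (Metric.ball_mem_nhds _ hr),
      (isOpen_extChartAt_source (I := 𝓡 n) x).mem_nhds hx] with y hy hys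
    have hsm := contDiffOn_comp_extChartAt_symm f.contMDiff x
    have h1 := (convex_ball (extChartAt (𝓡 n) x x) r).norm_image_sub_le_of_norm_fderiv_le
      (𝕜 := ℝ) (f := fun u => f ((extChartAt (𝓡 n) x).symm u)) (C := 0)
      (fun u hu => (hsm.contDiffAt ((isOpen_extChartAt_target x).mem_nhds
        (hball hu))).differentiableAt (by simp))
      (fun u hu => by
        rw [norm_le_zero_iff]
        ext v
        rw [← SmoothVectorField.mfderiv_eq_fderiv_chart f (hball hu), hf']
        rfl) (Metric.mem_ball_self hr) hy
    rw [zero_mul, norm_le_zero_iff, sub_eq_zero, (extChartAt (𝓡 n) x).left_inv hys,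
      (extChartAt (𝓡 n) x).left_inv hx] at h1
    exact h1
  obtain ⟨x₀⟩ := (inferInstance : Nonempty M)
  refine ⟨f x₀, ?_⟩
  ext x
  exact hloc.apply_eq_of_preconnectedSpace x x₀

end Characters

/-! ### The divergence on `ℝⁿ`: Jacobi's formula, change of coordinates, brackets. -/

section LocalDivergence

open Set Filter Topology

variable {n : ℕ}

/-- The trace as a continuous linear functional. -/
noncomputable def traceCLM (n : ℕ) :
    (EuclideanSpace ℝ (Fin n) →L[ℝ] EuclideanSpace ℝ (Fin n)) →L[ℝ] ℝ :=
  ∑ i, (EuclideanSpace.proj (𝕜 := ℝ) i).comp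
    (ContinuousLinearMap.apply ℝ (EuclideanSpace ℝ (Fin n)) (EuclideanSpace.single i (1 : ℝ)))

theorem traceCLM_apply (A : EuclideanSpace ℝ (Fin n) →L[ℝ] EuclideanSpace ℝ (Fin n)) :
    traceCLM n A = ∑ i, A (EuclideanSpace.single i 1) i := by
  simp [traceCLM]

theorem traceCLM_eq_trace_toMatrix
    (A : EuclideanSpace ℝ (Fin n) →L[ℝ] EuclideanSpace ℝ (Fin n)) :
    traceCLM n A = (LinearMap.toMatrix (EuclideanSpace.basisFun (Fin n) ℝ).toBasis
      (EuclideanSpace.basisFun (Fin n) ℝ).toBasis A.toLinearMap).trace := by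
  rw [traceCLM_apply, Matrix.trace]
  refine Finset.sum_congr rfl fun i _ => ?_
  simp [LinearMap.toMatrix_apply]

theorem traceCLM_comp_comm (A B : EuclideanSpace ℝ (Fin n) →L[ℝ] EuclideanSpace ℝ (Fin n)) :
    traceCLM n (A.comp B) = traceCLM n (B.comp A) := by
  rw [traceCLM_eq_trace_toMatrix, traceCLM_eq_trace_toMatrix,
    ContinuousLinearMap.toLinearMap_comp, ContinuousLinearMap.toLinearMap_comp,
    LinearMap.toMatrix_comp _ (EuclideanSpace.basisFun (Fin n) ℝ).toBasis,
    LinearMap.toMatrix_comp _ (EuclideanSpace.basisFun (Fin n) ℝ).toBasis, Matrix.trace_mul_comm]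

theorem det_eq_det_toMatrix (A : EuclideanSpace ℝ (Fin n) →L[ℝ] EuclideanSpace ℝ (Fin n)) :
    A.det = (LinearMap.toMatrix (EuclideanSpace.basisFun (Fin n) ℝ).toBasis
      (EuclideanSpace.basisFun (Fin n) ℝ).toBasis A.toLinearMap).det :=
  (LinearMap.det_toMatrix _ _).symm

theorem differentiable_det : Differentiable ℝ
    fun A : EuclideanSpace ℝ (Fin n) →L[ℝ] EuclideanSpace ℝ (Fin n) => A.det := by
  simp only [det_eq_det_toMatrix, Matrix.det_apply, LinearMap.toMatrix_apply]
  simp only [OrthonormalBasis.coe_toBasis, EuclideanSpace.basisFun_apply,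
    OrthonormalBasis.coe_toBasis_repr_apply, EuclideanSpace.basisFun_repr,
    ContinuousLinearMap.coe_coe]
  refine Differentiable.fun_sum fun σ _ => Differentiable.const_smul ?_ _
  refine (contDiff_prod (n := 1) fun i _ => ?_).differentiable (by simp)
  exact ((EuclideanSpace.proj (𝕜 := ℝ) (σ i)).comp (ContinuousLinearMap.apply ℝ
    (EuclideanSpace ℝ (Fin n)) (EuclideanSpace.single i (1 : ℝ)))).contDiff

/-- Jacobi's formula at the identity. -/
theorem hasFDerivAt_det_one : HasFDerivAt
    (fun A : EuclideanSpace ℝ (Fin n) →L[ℝ] EuclideanSpace ℝ (Fin n) => A.det) (traceCLM n)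
    (ContinuousLinearMap.id ℝ _) := by
  have h1 := (differentiable_det (n := n) (ContinuousLinearMap.id ℝ _)).hasFDerivAt
  convert h1 using 1
  ext B
  -- The derivative exists, so its value at `B` can be found along the line `1 + t B`, where `det (1
  -- + t N) = 1 + t tr N + O(t²)`.
  have hline : HasDerivAt (fun t : ℝ => ContinuousLinearMap.id ℝ _ + t • B) B 0 := by
    simpa using ((hasDerivAt_id (0 : ℝ)).smul_const B).const_add (ContinuousLinearMap.id ℝ _)
  have h1' : HasFDerivAt
      (fun A : EuclideanSpace ℝ (Fin n) →L[ℝ] EuclideanSpace ℝ (Fin n) => A.det)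
      (fderiv ℝ (fun A => A.det) (ContinuousLinearMap.id ℝ _))
      (ContinuousLinearMap.id ℝ _ + (0 : ℝ) • B) := by
    have h0 : ContinuousLinearMap.id ℝ _ + (0 : ℝ) • B = ContinuousLinearMap.id ℝ _ :=
      (congrArg _ (zero_smul ℝ B)).trans (add_zero _)
    rwa [h0]
  have h2 := h1'.comp_hasDerivAt (0 : ℝ) hline
  let b := (EuclideanSpace.basisFun (Fin n) ℝ).toBasis
  let N := LinearMap.toMatrix b b B.toLinearMap
  have h3 : ∀ t : ℝ, (ContinuousLinearMap.id ℝ (EuclideanSpace ℝ (Fin n)) + t • B).det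
      = (1 + t • N).det := by
    intro t
    rw [det_eq_det_toMatrix]
    congr 1
    change LinearMap.toMatrix b b (LinearMap.id + t • B.toLinearMap) = _
    rw [map_add, map_smul, LinearMap.toMatrix_id]
  have h4 : HasDerivAt (fun t : ℝ => (1 + t • N).det) N.trace 0 := by
    rw [funext fun t : ℝ => Matrix.det_one_add_smul t N]
    have hp := fun q : Polynomial ℝ => q.hasDerivAt (0 : ℝ)
    have := (((hasDerivAt_id (0 : ℝ)).const_mul N.trace).const_add 1).add
      ((hp (Matrix.det (1 + (Polynomial.X : Polynomial ℝ) •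
        N.map Polynomial.C)).divX.divX).mul ((hasDerivAt_id (0 : ℝ)).pow 2))
    refine HasDerivAt.congr_deriv this ?_
    simp
  rw [traceCLM_eq_trace_toMatrix]
  refine h4.unique ?_
  refine HasDerivAt.congr_of_eventuallyEq h2 (Eventually.of_forall fun t => ?_)
  exact (h3 t).symm

/-- Jacobi's formula. -/
theorem hasFDerivAt_log_det {E' : Type*} [NormedAddCommGroup E'] [NormedSpace ℝ E']
    {J : E' → EuclideanSpace ℝ (Fin n) →L[ℝ] EuclideanSpace ℝ (Fin n)}
    {J' : E' →L[ℝ] EuclideanSpace ℝ (Fin n) →L[ℝ] EuclideanSpace ℝ (Fin n)} {u : E'}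
    (hJ : HasFDerivAt J J' u)
    {B : EuclideanSpace ℝ (Fin n) →L[ℝ] EuclideanSpace ℝ (Fin n)}
    (hB : B.comp (J u) = ContinuousLinearMap.id ℝ _) :
    HasFDerivAt (fun u => Real.log (J u).det)
      ((traceCLM n).comp (((ContinuousLinearMap.compL ℝ _ _ _) B).comp J')) u := by
  have hdet : B.det * (J u).det = 1 := by
    have h := congrArg ContinuousLinearMap.det hB
    rw [ContinuousLinearMap.det, ContinuousLinearMap.toLinearMap_comp, LinearMap.det_comp] at h
    refine h.trans ?_
    exact LinearMap.det_id
  have hB0 : B.det ≠ 0 := left_ne_zero_of_mul_eq_one hdet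
  -- Composing with the constant `B` moves the base point to the identity and changes `log det` only
  -- by a constant.
  have h1 : HasFDerivAt (fun u => (B.comp (J u)).det)
      ((traceCLM n).comp (((ContinuousLinearMap.compL ℝ _ _ _) B).comp J')) u := by
    refine HasFDerivAt.comp u (g := fun A : EuclideanSpace ℝ (Fin n) →L[ℝ]
      EuclideanSpace ℝ (Fin n) => A.det) (f := fun u => B.comp (J u)) ?_ ?_
    · rw [hB]
      exact hasFDerivAt_det_one
    · exact ((ContinuousLinearMap.compL ℝ _ _ _) B).hasFDerivAt.comp u hJ
  have h2 : ∀ u, (B.comp (J u)).det = B.det * (J u).det := fun u => by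
    rw [ContinuousLinearMap.det, ContinuousLinearMap.toLinearMap_comp, LinearMap.det_comp]
  have h3 := h1.log (by rw [hB]; simp [ContinuousLinearMap.det])
  have h4 : (B.comp (J u)).det = 1 := by rw [h2, hdet]
  rw [h4, inv_one, one_smul] at h3
  have hJ0 : (J u).det ≠ 0 := right_ne_zero_of_mul_eq_one hdet
  have hcont : ContinuousAt (fun u => (J u).det) u :=
    (differentiable_det (J u)).continuousAt.comp hJ.continuousAt
  have h5 := h3.sub_const (Real.log B.det)
  refine h5.congr_of_eventuallyEq ?_
  filter_upwards [hcont.eventually_ne hJ0] with w hw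
  rw [h2, Real.log_mul hB0 hw]
  ring

/-- The divergence `dL(V) + tr(DV)` of a vector field on `ℝⁿ` with respect to the density with
logarithm `L`. -/
noncomputable def localDivergence (L : EuclideanSpace ℝ (Fin n) → ℝ)
    (V : EuclideanSpace ℝ (Fin n) → EuclideanSpace ℝ (Fin n)) (u : EuclideanSpace ℝ (Fin n)) : ℝ :=
  fderiv ℝ L u (V u) + traceCLM n (fderiv ℝ V u)

/-- This is `r⁻¹ ∂ᵢ(r Vⁱ) = Vⁱ ∂ᵢ(log r) + ∂ᵢVⁱ`. As `Real.log` is `log |·|`, the sign of `r` does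
not matter. -/
theorem inv_mul_sum_fderiv_eq_localDivergence {r : EuclideanSpace ℝ (Fin n) → ℝ}
    {V : EuclideanSpace ℝ (Fin n) → EuclideanSpace ℝ (Fin n)} {u : EuclideanSpace ℝ (Fin n)}
    (hr : DifferentiableAt ℝ r u) (hV : DifferentiableAt ℝ V u) (hr0 : r u ≠ 0) :
    (r u)⁻¹ * ∑ i, fderiv ℝ (fun u => r u * V u i) u (EuclideanSpace.single i 1)
      = localDivergence (fun u => Real.log (r u)) V u := by
  have hVi : ∀ i, HasFDerivAt (fun u => V u i)
      ((EuclideanSpace.proj (𝕜 := ℝ) i).comp (fderiv ℝ V u)) u := fun i =>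
    (EuclideanSpace.proj (𝕜 := ℝ) i).hasFDerivAt.comp u hV.hasFDerivAt
  have h1 : ∀ i, fderiv ℝ (fun u => r u * V u i) u (EuclideanSpace.single i 1)
      = r u * fderiv ℝ V u (EuclideanSpace.single i 1) i
        + V u i * fderiv ℝ r u (EuclideanSpace.single i 1) := fun i => by
    rw [(hr.hasFDerivAt.fun_mul (hVi i)).fderiv]
    simp
  have h2 : V u = ∑ i, V u i • EuclideanSpace.single i (1 : ℝ) := by
    simpa using ((EuclideanSpace.basisFun (Fin n) ℝ).sum_repr (V u)).symm
  rw [localDivergence, fderiv.log hr hr0, traceCLM_apply]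
  simp only [h1, Finset.sum_add_distrib, mul_add, ← Finset.mul_sum]
  rw [← mul_assoc, inv_mul_cancel₀ hr0, one_mul, add_comm]
  congr 1
  rw [smul_apply, smul_eq_mul]
  congr 1
  conv_rhs => rw [h2, map_sum]
  simp

/-- The divergence does not depend on the coordinates. -/
theorem localDivergence_eq_of_transition
    {r₀ r : EuclideanSpace ℝ (Fin n) → ℝ}
    {V₀ V τ : EuclideanSpace ℝ (Fin n) → EuclideanSpace ℝ (Fin n)}
    {u : EuclideanSpace ℝ (Fin n)}
    (hτ : ContDiffAt ℝ 2 τ u) (hV₀ : DifferentiableAt ℝ V₀ u) (hV : DifferentiableAt ℝ V (τ u))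
    (hr : DifferentiableAt ℝ r (τ u)) (hr0 : r (τ u) ≠ 0)
    (hr₀ : ∀ᶠ w in 𝓝 u, r₀ w = |(fderiv ℝ τ w).det| * r (τ w))
    (hVV₀ : ∀ᶠ w in 𝓝 u, V (τ w) = fderiv ℝ τ w (V₀ w))
    {B : EuclideanSpace ℝ (Fin n) →L[ℝ] EuclideanSpace ℝ (Fin n)}
    (hB : B.comp (fderiv ℝ τ u) = ContinuousLinearMap.id ℝ _)
    (hB' : (fderiv ℝ τ u).comp B = ContinuousLinearMap.id ℝ _) :
    localDivergence (fun w => Real.log (r₀ w)) V₀ u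
      = localDivergence (fun w => Real.log (r w)) V (τ u) := by
  have hτ1 : HasFDerivAt τ (fderiv ℝ τ u) u := (hτ.differentiableAt (by simp)).hasFDerivAt
  have hJ : HasFDerivAt (fderiv ℝ τ) (fderiv ℝ (fderiv ℝ τ) u) u :=
    ((hτ.fderiv_right (m := 1) (by norm_num)).differentiableAt (by simp)).hasFDerivAt
  set J := fderiv ℝ τ u with hJdef
  set J' := fderiv ℝ (fderiv ℝ τ) u with hJ'def
  have hsymm : ∀ v w, J' v w = J' w v := (hτ.isSymmSndFDerivAt (by simp)).eq
  have hdet : J.det ≠ 0 := by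
    have h := congrArg ContinuousLinearMap.det hB
    rw [ContinuousLinearMap.det, ContinuousLinearMap.toLinearMap_comp, LinearMap.det_comp] at h
    refine right_ne_zero_of_mul_eq_one (h.trans ?_)
    exact LinearMap.det_id
  have hcont : ContinuousAt (fun w => (fderiv ℝ τ w).det) u :=
    ContinuousAt.comp (g := fun A : EuclideanSpace ℝ (Fin n) →L[ℝ] _ => A.det)
      (differentiable_det _).continuousAt hJ.continuousAt
  have hrτ : HasFDerivAt (fun w => r (τ w)) ((fderiv ℝ r (τ u)).comp J) u :=
    hr.hasFDerivAt.comp u hτ1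
  have hL : HasFDerivAt (fun w => Real.log (r₀ w))
      ((traceCLM n).comp (((ContinuousLinearMap.compL ℝ _ _ _) B).comp J')
        + (r (τ u))⁻¹ • (fderiv ℝ r (τ u)).comp J) u := by
    refine ((hasFDerivAt_log_det hJ hB).add (hrτ.log hr0)).congr_of_eventuallyEq ?_
    filter_upwards [hr₀, hcont.eventually_ne hdet, hrτ.continuousAt.eventually_ne hr0]
      with w h1 h2 h3
    rw [h1, Real.log_mul (abs_ne_zero.2 h2) h3, Real.log_abs]
    rfl
  have h1 : HasFDerivAt (fun w => V (τ w)) ((fderiv ℝ V (τ u)).comp J) u :=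
    hV.hasFDerivAt.comp u hτ1
  have h2 : HasFDerivAt (fun w => V (τ w))
      (J.comp (fderiv ℝ V₀ u) + J'.flip (V₀ u)) u :=
    (hJ.clm_apply hV₀.hasFDerivAt).congr_of_eventuallyEq hVV₀
  have h3 : fderiv ℝ V (τ u) = (J.comp (fderiv ℝ V₀ u) + J'.flip (V₀ u)).comp B := by
    rw [← h1.unique h2, ContinuousLinearMap.comp_assoc, hB', ContinuousLinearMap.comp_id]
  -- By the symmetry of the second derivative of `τ`, the correction in the trace of `DV` equals the
  -- derivative of `log |det τ'|` along `V₀`.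
  have h4 : J'.flip (V₀ u) = J' (V₀ u) := by
    ext1 v
    exact hsymm v (V₀ u)
  have h5 : traceCLM n (fderiv ℝ V (τ u))
      = traceCLM n (fderiv ℝ V₀ u) + traceCLM n (B.comp (J' (V₀ u))) := by
    rw [h3, h4, traceCLM_comp_comm, ContinuousLinearMap.comp_add, map_add,
      ← ContinuousLinearMap.comp_assoc, hB, ContinuousLinearMap.id_comp]
  have h6 : V (τ u) = J (V₀ u) := hVV₀.self_of_nhds
  rw [localDivergence, localDivergence, hL.fderiv, h5, fderiv.log hr hr0, h6]
  simp only [add_apply, smul_apply,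
    ContinuousLinearMap.comp_apply, ContinuousLinearMap.compL_apply]
  ring

theorem localDivergence_smul {L a : EuclideanSpace ℝ (Fin n) → ℝ}
    {V : EuclideanSpace ℝ (Fin n) → EuclideanSpace ℝ (Fin n)} {u : EuclideanSpace ℝ (Fin n)}
    (ha : DifferentiableAt ℝ a u) (hV : DifferentiableAt ℝ V u) :
    localDivergence L (fun u => a u • V u) u
      = a u * localDivergence L V u + fderiv ℝ a u (V u) := by
  have h2 : V u = ∑ i, V u i • EuclideanSpace.single i (1 : ℝ) := by
    simpa using ((EuclideanSpace.basisFun (Fin n) ℝ).sum_repr (V u)).symm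
  have h3 : traceCLM n ((fderiv ℝ a u).smulRight (V u)) = fderiv ℝ a u (V u) := by
    rw [traceCLM_apply]
    conv_rhs => rw [h2, map_sum]
    simp [mul_comm]
  rw [localDivergence, localDivergence, fderiv_fun_smul ha hV, map_add, map_smul, map_smul, h3]
  simp only [smul_eq_mul]
  ring

/-- The divergence of a commutator. -/
theorem localDivergence_bracket {L : EuclideanSpace ℝ (Fin n) → ℝ}
    {V W Z : EuclideanSpace ℝ (Fin n) → EuclideanSpace ℝ (Fin n)} {u : EuclideanSpace ℝ (Fin n)}
    (hL : ContDiffAt ℝ 2 L u) (hV : ContDiffAt ℝ 2 V u) (hW : ContDiffAt ℝ 2 W u)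
    (hZ : ∀ᶠ w in 𝓝 u, Z w = fderiv ℝ W w (V w) - fderiv ℝ V w (W w)) :
    localDivergence L Z u = fderiv ℝ (localDivergence L W) u (V u)
      - fderiv ℝ (localDivergence L V) u (W u) := by
  have hd : ∀ {F : Type} [NormedAddCommGroup F] [NormedSpace ℝ F]
      {f : EuclideanSpace ℝ (Fin n) → F}, ContDiffAt ℝ 2 f u →
      HasFDerivAt f (fderiv ℝ f u) u ∧ HasFDerivAt (fderiv ℝ f) (fderiv ℝ (fderiv ℝ f) u) u ∧
      ∀ v w, fderiv ℝ (fderiv ℝ f) u v w = fderiv ℝ (fderiv ℝ f) u w v := by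
    intro F _ _ f hf
    exact ⟨(hf.differentiableAt (by simp)).hasFDerivAt,
      ((hf.fderiv_right (m := 1) (by norm_num)).differentiableAt (by simp)).hasFDerivAt,
      (hf.isSymmSndFDerivAt (by simp)).eq⟩
  obtain ⟨-, hL2, hLs⟩ := hd hL
  obtain ⟨hV1, hV2, hVs⟩ := hd hV
  obtain ⟨hW1, hW2, hWs⟩ := hd hW
  have hdiv : ∀ {V : EuclideanSpace ℝ (Fin n) → EuclideanSpace ℝ (Fin n)},
      HasFDerivAt V (fderiv ℝ V u) u →
      HasFDerivAt (fderiv ℝ V) (fderiv ℝ (fderiv ℝ V) u) u → HasFDerivAt (localDivergence L V)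
        (((fderiv ℝ L u).comp (fderiv ℝ V u) + (fderiv ℝ (fderiv ℝ L) u).flip (V u))
          + (traceCLM n).comp (fderiv ℝ (fderiv ℝ V) u)) u := fun h1 h2 =>
    (hL2.clm_apply h1).add ((traceCLM n).hasFDerivAt.comp u h2)
  have hZ1 : HasFDerivAt Z
      (((fderiv ℝ W u).comp (fderiv ℝ V u) + (fderiv ℝ (fderiv ℝ W) u).flip (V u))
        - ((fderiv ℝ V u).comp (fderiv ℝ W u) + (fderiv ℝ (fderiv ℝ V) u).flip (W u))) u :=
    ((hW2.clm_apply hV1).sub (hV2.clm_apply hW1)).congr_of_eventuallyEq hZ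
  have hf1 : (fderiv ℝ (fderiv ℝ W) u).flip (V u) = fderiv ℝ (fderiv ℝ W) u (V u) := by
    ext1 v
    exact hWs v (V u)
  have hf2 : (fderiv ℝ (fderiv ℝ V) u).flip (W u) = fderiv ℝ (fderiv ℝ V) u (W u) := by
    ext1 v
    exact hVs v (W u)
  rw [(hdiv hV1 hV2).fderiv, (hdiv hW1 hW2).fderiv, localDivergence, hZ1.fderiv, hf1, hf2,
    hZ.self_of_nhds]
  simp only [map_sub, map_add, add_apply, ContinuousLinearMap.comp_apply,
    ContinuousLinearMap.flip_apply]
  -- What is left cancels by `tr (DW DV) = tr (DV DW)` and by the symmetry of the second derivative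
  -- of `L`.
  rw [traceCLM_comp_comm (fderiv ℝ W u), hLs (V u) (W u)]
  ring

end LocalDivergence

/-! ### Densities, vector fields and the divergence under changes of charts. -/

section Transitions

open Set Filter Topology

variable {n : ℕ}

/-- The endomorphism `P ∘ B ∘ Q` has the determinant of `B` and sends `P eᵢ` to `P (B eᵢ)`. -/
theorem weightOne_comp {F : (Fin n → EuclideanSpace ℝ (Fin n)) → ℝ}
    (hF : ∀ (A : EuclideanSpace ℝ (Fin n) →ₗ[ℝ] EuclideanSpace ℝ (Fin n)) v,
      F (fun i => A (v i)) = |LinearMap.det A| * F v)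
    {P Q : EuclideanSpace ℝ (Fin n) →L[ℝ] EuclideanSpace ℝ (Fin n)}
    (hPQ : P.comp Q = ContinuousLinearMap.id ℝ _) (hQP : Q.comp P = ContinuousLinearMap.id ℝ _)
    (B : EuclideanSpace ℝ (Fin n) →L[ℝ] EuclideanSpace ℝ (Fin n)) :
    F (fun i => P (B (EuclideanSpace.single i 1)))
      = |B.det| * F (fun i => P (EuclideanSpace.single i 1)) := by
  have h1 := hF ((P.comp (B.comp Q)).toLinearMap) fun i => P (EuclideanSpace.single i 1)
  have h2 : ∀ v, Q (P v) = v := DFunLike.congr_fun hQP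
  have h3 : P.det * Q.det = 1 := by
    have h := congrArg ContinuousLinearMap.det hPQ
    rw [ContinuousLinearMap.det, ContinuousLinearMap.toLinearMap_comp, LinearMap.det_comp] at h
    exact h.trans LinearMap.det_id
  have h4 : LinearMap.det (P.comp (B.comp Q)).toLinearMap = B.det := by
    rw [ContinuousLinearMap.toLinearMap_comp, ContinuousLinearMap.toLinearMap_comp,
      LinearMap.det_comp, LinearMap.det_comp]
    change P.det * (B.det * Q.det) = B.det
    linear_combination B.det * h3
  rw [h4] at h1
  simpa [h2] using h1

/-- Every family `v` is the image of the frame `P eᵢ` under a linear map, so a zero on the frame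
would make `F` vanish identically. -/
theorem weightOne_ne_zero {F : (Fin n → EuclideanSpace ℝ (Fin n)) → ℝ}
    (hF : ∀ (A : EuclideanSpace ℝ (Fin n) →ₗ[ℝ] EuclideanSpace ℝ (Fin n)) v,
      F (fun i => A (v i)) = |LinearMap.det A| * F v)
    {P Q : EuclideanSpace ℝ (Fin n) →L[ℝ] EuclideanSpace ℝ (Fin n)}
    (hQP : Q.comp P = ContinuousLinearMap.id ℝ _) (h0 : ∃ v, F v ≠ 0) :
    F (fun i => P (EuclideanSpace.single i 1)) ≠ 0 := by
  obtain ⟨v, hv⟩ := h0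
  have h2 : ∀ v, Q (P v) = v := DFunLike.congr_fun hQP
  let A := ((EuclideanSpace.basisFun (Fin n) ℝ).toBasis.constr ℝ v).comp Q.toLinearMap
  have h3 : ∀ i, A (P (EuclideanSpace.single i 1)) = v i := fun i => by
    simp [A, h2]
  have h1 := hF A fun i => P (EuclideanSpace.single i 1)
  simp only [h3] at h1
  intro h
  rw [h, mul_zero] at h1
  exact hv h1

variable {M : Type*} [TopologicalSpace M] [ChartedSpace (EuclideanSpace ℝ (Fin n)) M]

/-- Frees the base point for rewriting: the vectors are regarded in `EuclideanSpace`, a type that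
does not mention it. -/
theorem SmoothDensity.coeff_eq (ρ : SmoothDensity n M) {x₀ y : M} {u : EuclideanSpace ℝ (Fin n)}
    (hy : (extChartAt (𝓡 n) x₀).symm u = y) :
    ρ.coeff x₀ u = ρ.toFun y (fun i => (mfderiv 𝓘(ℝ, EuclideanSpace ℝ (Fin n)) (𝓡 n)
      (extChartAt (𝓡 n) x₀).symm u (EuclideanSpace.single i 1) : EuclideanSpace ℝ (Fin n))) := by
  subst hy
  rfl

variable [IsManifold (𝓡 n) ∞ M]

theorem fderiv_transition {x₀ x₁ : M} {w : EuclideanSpace ℝ (Fin n)}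
    (hw : w ∈ (extChartAt (𝓡 n) x₀).target)
    (hw₁ : (extChartAt (𝓡 n) x₀).symm w ∈ (extChartAt (𝓡 n) x₁).source) :
    fderiv ℝ (fun w => extChartAt (𝓡 n) x₁ ((extChartAt (𝓡 n) x₀).symm w)) w =
      (mfderiv (𝓡 n) 𝓘(ℝ, EuclideanSpace ℝ (Fin n)) (extChartAt (𝓡 n) x₁)
        ((extChartAt (𝓡 n) x₀).symm w)).comp
      (mfderiv 𝓘(ℝ, EuclideanSpace ℝ (Fin n)) (𝓡 n) (extChartAt (𝓡 n) x₀).symm w) := by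
  rw [← mfderiv_eq_fderiv]
  exact mfderiv_comp w (g := extChartAt (𝓡 n) x₁) (f := (extChartAt (𝓡 n) x₀).symm)
    ((contMDiffAt_extChartAt_source hw₁).mdifferentiableAt (by simp))
    ((contMDiffAt_extChartAt_symm hw).mdifferentiableAt (by simp))

theorem contDiffAt_transition {x₀ x₁ : M} {w : EuclideanSpace ℝ (Fin n)}
    (hw : w ∈ (extChartAt (𝓡 n) x₀).target)
    (hw₁ : (extChartAt (𝓡 n) x₀).symm w ∈ (extChartAt (𝓡 n) x₁).source) :
    ContDiffAt ℝ ∞ (fun w => extChartAt (𝓡 n) x₁ ((extChartAt (𝓡 n) x₀).symm w)) w :=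
  ((contMDiffAt_extChartAt_source hw₁).comp w (contMDiffAt_extChartAt_symm hw)).contDiffAt

theorem eventually_extChartAt_symm_mem {x₀ : M} {w : EuclideanSpace ℝ (Fin n)}
    (hw : w ∈ (extChartAt (𝓡 n) x₀).target) {p : M → Prop}
    (hp : ∀ᶠ y in 𝓝 ((extChartAt (𝓡 n) x₀).symm w), p y) :
    ∀ᶠ w' in 𝓝 w, w' ∈ (extChartAt (𝓡 n) x₀).target ∧ p ((extChartAt (𝓡 n) x₀).symm w') :=
  ((isOpen_extChartAt_target x₀).eventually_mem hw).and
    ((contMDiffAt_extChartAt_symm hw).continuousAt.eventually hp)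

theorem contMDiff_of_forall_chart {f : M → ℝ}
    (hf : ∀ x₀ : M, ContDiffOn ℝ ∞ (fun u => f ((extChartAt (𝓡 n) x₀).symm u))
      (extChartAt (𝓡 n) x₀).target) : ContMDiff (𝓡 n) 𝓘(ℝ, ℝ) ∞ f := by
  intro x₀
  have h1 : ContMDiffOn (𝓡 n) 𝓘(ℝ, ℝ) ∞
      (fun y => f ((extChartAt (𝓡 n) x₀).symm (extChartAt (𝓡 n) x₀ y)))
      (extChartAt (𝓡 n) x₀).source := by
    refine (hf x₀).contMDiffOn.comp (t := (extChartAt (𝓡 n) x₀).target) ?_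
      fun y hy => (extChartAt (𝓡 n) x₀).map_source hy
    rw [extChartAt_source]
    exact contMDiffOn_extChartAt
  refine (h1.congr fun y hy => ?_).contMDiffAt (extChartAt_source_mem_nhds x₀)
  rw [(extChartAt (𝓡 n) x₀).left_inv hy]

namespace SmoothDensity

theorem coeff_ne_zero {ρ : SmoothDensity n M} (hρ : ρ.IsNowhereVanishing) {x₀ : M}
    {u : EuclideanSpace ℝ (Fin n)} (hu : u ∈ (extChartAt (𝓡 n) x₀).target) :
    ρ.coeff x₀ u ≠ 0 :=
  weightOne_ne_zero (F := ρ.toFun ((extChartAt (𝓡 n) x₀).symm u))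
    (ρ.map_linear ((extChartAt (𝓡 n) x₀).symm u)) (mfderiv_extChartAt_comp_symm hu) (hρ _)

theorem coeff_transition (ρ : SmoothDensity n M) {x₀ x₁ : M} {w : EuclideanSpace ℝ (Fin n)}
    (hw : w ∈ (extChartAt (𝓡 n) x₀).target)
    (hw₁ : (extChartAt (𝓡 n) x₀).symm w ∈ (extChartAt (𝓡 n) x₁).source) :
    ρ.coeff x₀ w =
      |(fderiv ℝ (fun w => extChartAt (𝓡 n) x₁ ((extChartAt (𝓡 n) x₀).symm w)) w).det|
        * ρ.coeff x₁ (extChartAt (𝓡 n) x₁ ((extChartAt (𝓡 n) x₀).symm w)) := by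
  have hl := (extChartAt (𝓡 n) x₁).left_inv hw₁
  have h1 := mfderiv_extChartAt_symm_comp ((extChartAt (𝓡 n) x₁).map_source hw₁)
  have h2 := mfderiv_extChartAt_comp_symm ((extChartAt (𝓡 n) x₁).map_source hw₁)
  rw [hl] at h1 h2
  rw [ρ.coeff_eq hl, ρ.coeff_eq rfl, fderiv_transition hw hw₁]
  refine Eq.trans ?_ (weightOne_comp (F := ρ.toFun ((extChartAt (𝓡 n) x₀).symm w))
    (ρ.map_linear ((extChartAt (𝓡 n) x₀).symm w)) h1 h2 _)
  congr 1
  ext1 i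
  exact (DFunLike.congr_fun h1 _).symm

theorem contDiffOn_log_coeff {ρ : SmoothDensity n M} (hρ : ρ.IsNowhereVanishing) (x₀ : M) :
    ContDiffOn ℝ ∞ (fun u => Real.log (ρ.coeff x₀ u)) (extChartAt (𝓡 n) x₀).target :=
  ContDiffOn.log (ρ.smooth x₀) fun _ hu => coeff_ne_zero hρ hu

end SmoothDensity

namespace SmoothVectorField

theorem inChart_transition (X : SmoothVectorField n M) {x₀ x₁ : M} {w : EuclideanSpace ℝ (Fin n)}
    (hw : w ∈ (extChartAt (𝓡 n) x₀).target)
    (hw₁ : (extChartAt (𝓡 n) x₀).symm w ∈ (extChartAt (𝓡 n) x₁).source) :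
    X.inChart x₁ (extChartAt (𝓡 n) x₁ ((extChartAt (𝓡 n) x₀).symm w)) =
      fderiv ℝ (fun w => extChartAt (𝓡 n) x₁ ((extChartAt (𝓡 n) x₀).symm w)) w
        (X.inChart x₀ w) := by
  rw [X.inChart_eq ((extChartAt (𝓡 n) x₁).map_source hw₁), (extChartAt (𝓡 n) x₁).left_inv hw₁,
    ← X.mfderiv_inChart hw, fderiv_transition hw hw₁]
  rfl

theorem differentiableAt_inChart (X : SmoothVectorField n M) {x₀ : M}
    {u : EuclideanSpace ℝ (Fin n)} (hu : u ∈ (extChartAt (𝓡 n) x₀).target) :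
    DifferentiableAt ℝ (X.inChart x₀) u :=
  ((X.contDiffOn_inChart x₀).contDiffAt
    ((isOpen_extChartAt_target x₀).mem_nhds hu)).differentiableAt (by simp)

/-- Both sides are tested on functions `c i` that agree with the coordinates near the point: there
`W (c i)` is the `i`-th component of `W`. -/
theorem inChart_bracket [T2Space M] {X Y Z : SmoothVectorField n M}
    (hZ : Z.toDerivation = ⁅X.toDerivation, Y.toDerivation⁆) {x₀ : M}
    {u : EuclideanSpace ℝ (Fin n)} (hu : u ∈ (extChartAt (𝓡 n) x₀).target) :
    Z.inChart x₀ u = fderiv ℝ (Y.inChart x₀) u (X.inChart x₀ u)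
      - fderiv ℝ (X.inChart x₀) u (Y.inChart x₀ u) := by
  obtain ⟨c, hc⟩ := exists_coordinates (n := n) ((extChartAt (𝓡 n) x₀).map_target hu)
  have h1 : ∀ (W : SmoothVectorField n M) i, ∀ᶠ w in 𝓝 u,
      W.toEnd (c i) ((extChartAt (𝓡 n) x₀).symm w) = W.inChart x₀ w i := by
    intro W i
    have h2 : ∀ᶠ w in 𝓝 u, c i ((extChartAt (𝓡 n) x₀).symm w) = w i := by
      filter_upwards [eventually_extChartAt_symm_mem hu (hc i)] with w hw
      rw [hw.2, (extChartAt (𝓡 n) x₀).right_inv hw.1]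
    filter_upwards [h2.eventually_nhds, (isOpen_extChartAt_target x₀).eventually_mem hu]
      with w hw hw'
    rw [W.toEnd_eq_fderiv _ hw', Filter.EventuallyEq.fderiv_eq hw]
    exact DFunLike.congr_fun (EuclideanSpace.proj (𝕜 := ℝ) i).fderiv _
  have h3 : ∀ (V W : SmoothVectorField n M) i,
      V.toEnd (W.toEnd (c i)) ((extChartAt (𝓡 n) x₀).symm u)
        = fderiv ℝ (W.inChart x₀) u (V.inChart x₀ u) i := by
    intro V W i
    rw [V.toEnd_eq_fderiv _ hu, Filter.EventuallyEq.fderiv_eq (h1 W i)]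
    exact DFunLike.congr_fun ((EuclideanSpace.proj (𝕜 := ℝ) i).hasFDerivAt.comp u
      (W.differentiableAt_inChart hu).hasFDerivAt).fderiv _
  ext i
  rw [← (h1 Z i).self_of_nhds, PiLp.sub_apply, ← h3 X Y i, ← h3 Y X i, ← toDerivation_apply, hZ,
    Derivation.commutator_apply]
  rfl

end SmoothVectorField

/-- The chart in the definition of `divergence` varies with the point. Invariance under transition
maps allows one fixed chart on its whole domain, where the divergence can then be differentiated. -/
theorem divergence_eq_localDivergence {ρ : SmoothDensity n M} (hρ : ρ.IsNowhereVanishing)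
    (X : SmoothVectorField n M) {x₀ : M} {u : EuclideanSpace ℝ (Fin n)}
    (hu : u ∈ (extChartAt (𝓡 n) x₀).target) :
    divergence ρ X ((extChartAt (𝓡 n) x₀).symm u)
      = localDivergence (fun w => Real.log (ρ.coeff x₀ w)) (X.inChart x₀) u := by
  obtain ⟨x₁, hx₁⟩ : ∃ x₁, x₁ = (extChartAt (𝓡 n) x₀).symm u := ⟨_, rfl⟩
  have hs₁ := mem_extChartAt_source (I := 𝓡 n) x₁
  have hs : (extChartAt (𝓡 n) x₀).symm u ∈ (extChartAt (𝓡 n) x₁).source := by rwa [← hx₁]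
  have ht := (extChartAt (𝓡 n) x₁).map_source hs₁
  have hr : DifferentiableAt ℝ (ρ.coeff x₁) (extChartAt (𝓡 n) x₁ x₁) :=
    ((ρ.smooth x₁).contDiffAt ((isOpen_extChartAt_target x₁).mem_nhds ht)).differentiableAt
      (by simp)
  have hev := eventually_extChartAt_symm_mem hu ((isOpen_extChartAt_source x₁).eventually_mem hs)
  rw [← hx₁, divergence, inv_mul_sum_fderiv_eq_localDivergence hr
    (X.differentiableAt_inChart ht) (ρ.coeff_ne_zero hρ ht)]
  have h1 := mfderiv_extChartAt_symm_comp ht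
  have h2 := mfderiv_extChartAt_comp_symm ht
  have h3 := mfderiv_extChartAt_symm_comp hu
  have h4 := mfderiv_extChartAt_comp_symm hu
  have h5 := fderiv_transition hu hs
  rw [(extChartAt (𝓡 n) x₁).left_inv hs₁] at h1 h2
  rw [← hx₁] at h3 h4 h5
  have h6 := localDivergence_eq_of_transition
    (B := (mfderiv (𝓡 n) 𝓘(ℝ, EuclideanSpace ℝ (Fin n)) (extChartAt (𝓡 n) x₀) x₁).comp
      (mfderiv 𝓘(ℝ, EuclideanSpace ℝ (Fin n)) (𝓡 n) (extChartAt (𝓡 n) x₁).symm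
        (extChartAt (𝓡 n) x₁ x₁)))
    (τ := fun w => extChartAt (𝓡 n) x₁ ((extChartAt (𝓡 n) x₀).symm w)) (r := ρ.coeff x₁)
    (r₀ := ρ.coeff x₀) (V₀ := X.inChart x₀) (V := X.inChart x₁) (u := u)
    ((contDiffAt_transition hu hs).of_le
      ENat.LEInfty.out) (X.differentiableAt_inChart hu)
    (by rw [← hx₁]; exact X.differentiableAt_inChart ht)
    (by rwa [← hx₁]) (by rw [← hx₁]; exact ρ.coeff_ne_zero hρ ht)
    (hev.mono fun w hw => ρ.coeff_transition hw.1 hw.2)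
    (hev.mono fun w hw => X.inChart_transition hw.1 hw.2)
    (by
      rw [h5]
      ext1 v
      exact (congrArg _ (DFunLike.congr_fun h1 _)).trans (DFunLike.congr_fun h4 v))
    (by
      rw [h5]
      ext1 v
      exact (congrArg _ (DFunLike.congr_fun h3 _)).trans (DFunLike.congr_fun h2 v))
  rw [h6, ← hx₁]

end Transitions

/-! ### The divergence as a cocycle on derivations. -/

section DivergenceMap

open Set Filter Topology

variable {n : ℕ}

theorem contDiffOn_localDivergence {L : EuclideanSpace ℝ (Fin n) → ℝ}
    {V : EuclideanSpace ℝ (Fin n) → EuclideanSpace ℝ (Fin n)} {s : Set (EuclideanSpace ℝ (Fin n))}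
    (hs : IsOpen s) (hL : ContDiffOn ℝ ∞ L s) (hV : ContDiffOn ℝ ∞ V s) :
    ContDiffOn ℝ ∞ (localDivergence L V) s :=
  ((hL.fderiv_of_isOpen hs (m := ∞) (by simp)).clm_apply hV).add
    ((traceCLM n).contDiff.comp_contDiffOn (hV.fderiv_of_isOpen hs (m := ∞) (by simp)))

variable {M : Type*} [TopologicalSpace M] [ChartedSpace (EuclideanSpace ℝ (Fin n)) M]

theorem exists_extChartAt_symm_eq (x : M) : ∃ x₀ : M, ∃ u ∈ (extChartAt (𝓡 n) x₀).target,
    (extChartAt (𝓡 n) x₀).symm u = x :=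
  ⟨x, extChartAt (𝓡 n) x x, mem_extChartAt_target x, extChartAt_to_inv x⟩

variable [IsManifold (𝓡 n) ∞ M]

namespace SmoothVectorField

/-- Vector fields and derivations of the algebra of smooth functions. -/
noncomputable def derivationEquiv (n : ℕ) (M : Type*) [TopologicalSpace M]
    [ChartedSpace (EuclideanSpace ℝ (Fin n)) M] [IsManifold (𝓡 n) ∞ M] [T2Space M] :
    SmoothVectorField n M ≃ₗ[ℝ] Derivation ℝ (SmoothFn n M) (SmoothFn n M) :=
  LinearEquiv.ofBijective
    { toFun := toDerivation
      map_add' := toDerivation_add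
      map_smul' := toDerivation_const_smul }
    ⟨toDerivation_injective, toDerivation_surjective⟩

theorem derivationEquiv_symm_toDerivation [T2Space M] (X : SmoothVectorField n M) :
    (derivationEquiv n M).symm X.toDerivation = X :=
  (derivationEquiv n M).symm_apply_apply X

theorem inChart_of_forall_eq_smul {X Y : SmoothVectorField n M} {a : M → ℝ}
    (h : ∀ x, Y x = a x • X x) {x₀ : M} {u : EuclideanSpace ℝ (Fin n)}
    (hu : u ∈ (extChartAt (𝓡 n) x₀).target) :
    Y.inChart x₀ u = a ((extChartAt (𝓡 n) x₀).symm u) • X.inChart x₀ u := by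
  rw [Y.inChart_eq hu, X.inChart_eq hu, h]
  exact map_smul (mfderiv (𝓡 n) 𝓘(ℝ, EuclideanSpace ℝ (Fin n)) (extChartAt (𝓡 n) x₀)
      ((extChartAt (𝓡 n) x₀).symm u)) _ _

theorem inChart_add (X Y : SmoothVectorField n M) {x₀ : M} {u : EuclideanSpace ℝ (Fin n)}
    (hu : u ∈ (extChartAt (𝓡 n) x₀).target) :
    (X + Y).inChart x₀ u = X.inChart x₀ u + Y.inChart x₀ u := by
  rw [(X + Y).inChart_eq hu, Y.inChart_eq hu, X.inChart_eq hu]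
  exact map_add (mfderiv (𝓡 n) 𝓘(ℝ, EuclideanSpace ℝ (Fin n)) (extChartAt (𝓡 n) x₀)
      ((extChartAt (𝓡 n) x₀).symm u)) _ _

end SmoothVectorField

open SmoothVectorField

theorem divergence_add {ρ : SmoothDensity n M} (hρ : ρ.IsNowhereVanishing)
    (X Y : SmoothVectorField n M) (x : M) :
    divergence ρ (X + Y) x = divergence ρ X x + divergence ρ Y x := by
  obtain ⟨x₀, u, hu, rfl⟩ := exists_extChartAt_symm_eq (n := n) x
  have h1 : (X + Y).inChart x₀ =ᶠ[𝓝 u] fun w => X.inChart x₀ w + Y.inChart x₀ w :=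
    ((isOpen_extChartAt_target x₀).eventually_mem hu).mono fun w hw => X.inChart_add Y hw
  rw [divergence_eq_localDivergence hρ _ hu, divergence_eq_localDivergence hρ _ hu,
    divergence_eq_localDivergence hρ _ hu, localDivergence, localDivergence, localDivergence,
    h1.fderiv_eq, h1.self_of_nhds, fderiv_fun_add (X.differentiableAt_inChart hu)
      (Y.differentiableAt_inChart hu), map_add, map_add]
  ring

theorem divergence_of_forall_eq_smul {ρ : SmoothDensity n M} (hρ : ρ.IsNowhereVanishing)
    {X Y : SmoothVectorField n M} {a : SmoothFn n M} (h : ∀ x, Y x = a x • X x) (x : M) :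
    divergence ρ Y x = a x * divergence ρ X x + X.toEnd a x := by
  obtain ⟨x₀, u, hu, rfl⟩ := exists_extChartAt_symm_eq (n := n) x
  have h1 : Y.inChart x₀ =ᶠ[𝓝 u]
      fun w => a ((extChartAt (𝓡 n) x₀).symm w) • X.inChart x₀ w :=
    ((isOpen_extChartAt_target x₀).eventually_mem hu).mono fun w hw =>
      inChart_of_forall_eq_smul h hw
  have ha : DifferentiableAt ℝ (fun w => a ((extChartAt (𝓡 n) x₀).symm w)) u :=
    ((contDiffOn_comp_extChartAt_symm a.contMDiff x₀).contDiffAt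
      ((isOpen_extChartAt_target x₀).mem_nhds hu)).differentiableAt (by simp)
  rw [divergence_eq_localDivergence hρ _ hu, divergence_eq_localDivergence hρ _ hu,
    X.toEnd_eq_fderiv a hu, ← localDivergence_smul ha (X.differentiableAt_inChart hu),
    localDivergence, localDivergence, h1.fderiv_eq, h1.self_of_nhds]

/-- The divergence of a vector field as a smooth function. -/
noncomputable def divergenceFn {ρ : SmoothDensity n M} (hρ : ρ.IsNowhereVanishing)
    (X : SmoothVectorField n M) : SmoothFn n M :=
  ⟨divergence ρ X, contMDiff_of_forall_chart fun x₀ =>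
    (contDiffOn_localDivergence (isOpen_extChartAt_target x₀) (ρ.contDiffOn_log_coeff hρ x₀)
      (X.contDiffOn_inChart x₀)).congr fun _ hu => divergence_eq_localDivergence hρ X hu⟩

theorem divergenceFn_apply {ρ : SmoothDensity n M} (hρ : ρ.IsNowhereVanishing)
    (X : SmoothVectorField n M) (x : M) : divergenceFn hρ X x = divergence ρ X x := rfl

theorem divergenceFn_bracket [T2Space M] {ρ : SmoothDensity n M} (hρ : ρ.IsNowhereVanishing)
    {X Y Z : SmoothVectorField n M} (hZ : Z.toDerivation = ⁅X.toDerivation, Y.toDerivation⁆) :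
    divergenceFn hρ Z = X.toEnd (divergenceFn hρ Y) - Y.toEnd (divergenceFn hρ X) := by
  ext x
  change divergence ρ Z x = X.toEnd (divergenceFn hρ Y) x - Y.toEnd (divergenceFn hρ X) x
  obtain ⟨x₀, u, hu, rfl⟩ := exists_extChartAt_symm_eq (n := n) x
  have hmem := (isOpen_extChartAt_target x₀).mem_nhds hu
  have h2 : (2 : WithTop ℕ∞) ≤ ∞ := ENat.LEInfty.out
  have h1 : ∀ W : SmoothVectorField n M,
      (fun w => divergenceFn hρ W ((extChartAt (𝓡 n) x₀).symm w)) =ᶠ[𝓝 u]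
        localDivergence (fun w => Real.log (ρ.coeff x₀ w)) (W.inChart x₀) := fun W =>
    ((isOpen_extChartAt_target x₀).eventually_mem hu).mono fun w hw =>
      divergence_eq_localDivergence hρ W hw
  rw [X.toEnd_eq_fderiv _ hu, Y.toEnd_eq_fderiv _ hu, (h1 X).fderiv_eq, (h1 Y).fderiv_eq,
    divergence_eq_localDivergence hρ Z hu]
  exact localDivergence_bracket
    (((ρ.contDiffOn_log_coeff hρ x₀).contDiffAt hmem).of_le h2)
    (((X.contDiffOn_inChart x₀).contDiffAt hmem).of_le h2)
    (((Y.contDiffOn_inChart x₀).contDiffAt hmem).of_le h2)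
    (((isOpen_extChartAt_target x₀).eventually_mem hu).mono fun w hw => inChart_bracket hZ hw)

/-- The divergence as a linear map on derivations. -/
noncomputable def divergenceMap [T2Space M] {ρ : SmoothDensity n M} (hρ : ρ.IsNowhereVanishing) :
    Derivation ℝ (SmoothFn n M) (SmoothFn n M) →ₗ[ℝ] SmoothFn n M where
  toFun δ := divergenceFn hρ ((derivationEquiv n M).symm δ)
  map_add' δ δ' := by
    ext x
    rw [map_add]
    exact divergence_add hρ _ _ x
  map_smul' c δ := by
    ext x
    rw [map_smul, divergenceFn_apply, divergence_of_forall_eq_smul hρ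
      (X := (derivationEquiv n M).symm δ) (a := algebraMap ℝ (SmoothFn n M) c) fun x => rfl,
      ← toDerivation_apply, Derivation.map_algebraMap]
    exact add_zero _

theorem divergenceMap_toDerivation [T2Space M] {ρ : SmoothDensity n M}
    (hρ : ρ.IsNowhereVanishing) (X : SmoothVectorField n M) :
    divergenceMap hρ X.toDerivation = divergenceFn hρ X :=
  congrArg (divergenceFn hρ) (derivationEquiv_symm_toDerivation X)

theorem divergenceMap_smul [T2Space M] {ρ : SmoothDensity n M} (hρ : ρ.IsNowhereVanishing)
    (a : SmoothFn n M) (δ : Derivation ℝ (SmoothFn n M) (SmoothFn n M)) :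
    divergenceMap hρ (a • δ) = a * divergenceMap hρ δ + δ a := by
  obtain ⟨X, rfl⟩ := toDerivation_surjective δ
  obtain ⟨Y, h1, h2⟩ := X.toDerivation_smul a
  rw [← h2, divergenceMap_toDerivation, divergenceMap_toDerivation]
  ext x
  exact divergence_of_forall_eq_smul hρ h1 x

theorem divergenceMap_lie [T2Space M] {ρ : SmoothDensity n M} (hρ : ρ.IsNowhereVanishing)
    (δ δ' : Derivation ℝ (SmoothFn n M) (SmoothFn n M)) :
    divergenceMap hρ ⁅δ, δ'⁆ = δ (divergenceMap hρ δ') - δ' (divergenceMap hρ δ) := by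
  obtain ⟨X, rfl⟩ := toDerivation_surjective δ
  obtain ⟨Y, rfl⟩ := toDerivation_surjective δ'
  obtain ⟨Z, hZ⟩ := toDerivation_surjective ⁅X.toDerivation, Y.toDerivation⁆
  rw [← hZ, divergenceMap_toDerivation, divergenceMap_toDerivation, divergenceMap_toDerivation]
  exact divergenceFn_bracket hρ hZ

end DivergenceMap

/-! ### One-forms as linear maps on derivations, and closedness. -/

section OneForms

open Set Filter Topology SmoothVectorField

variable {n : ℕ} {M : Type*} [TopologicalSpace M] [ChartedSpace (EuclideanSpace ℝ (Fin n)) M]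
  [IsManifold (𝓡 n) ∞ M]

theorem exists_inChart_eventuallyEq [T2Space M] {x₀ : M} {u : EuclideanSpace ℝ (Fin n)}
    (hu : u ∈ (extChartAt (𝓡 n) x₀).target)
    {V : EuclideanSpace ℝ (Fin n) → EuclideanSpace ℝ (Fin n)}
    (hV : ContDiffOn ℝ ∞ V (extChartAt (𝓡 n) x₀).target) :
    ∃ X : SmoothVectorField n M, ∀ᶠ w in 𝓝 u, X.inChart x₀ w = V w := by
  obtain ⟨X, hX⟩ := exists_vectorField_eventuallyEq ((extChartAt (𝓡 n) x₀).map_target hu) hV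
  refine ⟨X, (eventually_extChartAt_symm_mem hu hX).mono fun w hw => ?_⟩
  rw [X.inChart_eq hw.1, hw.2, (extChartAt (𝓡 n) x₀).right_inv hw.1]
  exact DFunLike.congr_fun (mfderiv_extChartAt_comp_symm hw.1) _

namespace SmoothOneForm

/-- The value of a 1-form on a vector field. -/
noncomputable def eval (η : SmoothOneForm n M) (X : SmoothVectorField n M) : SmoothFn n M :=
  ⟨fun x => η x (X x), fun x => by
    have h := (η.contMDiff x).clm_bundle_apply (X.contMDiff x)
    exact (Bundle.contMDiffAt_totalSpace.1 h).2⟩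

theorem eval_apply (η : SmoothOneForm n M) (X : SmoothVectorField n M) (x : M) :
    η.eval X x = η x (X x) := rfl

theorem eval_extChartAt_symm (η : SmoothOneForm n M) (X : SmoothVectorField n M) {x₀ : M}
    {u : EuclideanSpace ℝ (Fin n)} (hu : u ∈ (extChartAt (𝓡 n) x₀).target) :
    η.eval X ((extChartAt (𝓡 n) x₀).symm u) = η.inChart x₀ u (X.inChart x₀ u) := by
  rw [eval_apply, ← X.mfderiv_inChart hu]
  rfl

theorem contDiffAt_inChart [T2Space M] (η : SmoothOneForm n M) {x₀ : M}
    {u : EuclideanSpace ℝ (Fin n)} (hu : u ∈ (extChartAt (𝓡 n) x₀).target) :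
    ContDiffAt ℝ ∞ (η.inChart x₀) u := by
  have key : ContDiffOn ℝ ∞ (η.inChart x₀) (extChartAt (𝓡 n) x₀).target := by
    rw [contDiffOn_clm_apply]
    intro v w hw
    obtain ⟨X, hX⟩ := exists_inChart_eventuallyEq hw (V := fun _ => v) contDiffOn_const
    have h1 := (contDiffOn_comp_extChartAt_symm (η.eval X).contMDiff x₀).contDiffAt
      ((isOpen_extChartAt_target x₀).mem_nhds hw)
    refine (h1.congr_of_eventuallyEq ?_).contDiffWithinAt
    filter_upwards [hX, (isOpen_extChartAt_target x₀).eventually_mem hw] with z hz hz'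
    rw [η.eval_extChartAt_symm X hz', hz]
  exact key.contDiffAt ((isOpen_extChartAt_target x₀).mem_nhds hu)

/-- Cartan's formula for the differential of a 1-form. -/
theorem toEnd_eval_sub [T2Space M] (η : SmoothOneForm n M) {X Y Z : SmoothVectorField n M}
    (hZ : Z.toDerivation = ⁅X.toDerivation, Y.toDerivation⁆) {x₀ : M}
    {u : EuclideanSpace ℝ (Fin n)} (hu : u ∈ (extChartAt (𝓡 n) x₀).target) :
    X.toEnd (η.eval Y) ((extChartAt (𝓡 n) x₀).symm u)
        - Y.toEnd (η.eval X) ((extChartAt (𝓡 n) x₀).symm u)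
      = η.eval Z ((extChartAt (𝓡 n) x₀).symm u)
        + (fderiv ℝ (η.inChart x₀) u (X.inChart x₀ u) (Y.inChart x₀ u)
          - fderiv ℝ (η.inChart x₀) u (Y.inChart x₀ u) (X.inChart x₀ u)) := by
  have h1 : ∀ V W : SmoothVectorField n M, V.toEnd (η.eval W) ((extChartAt (𝓡 n) x₀).symm u)
      = η.inChart x₀ u (fderiv ℝ (W.inChart x₀) u (V.inChart x₀ u))
        + fderiv ℝ (η.inChart x₀) u (V.inChart x₀ u) (W.inChart x₀ u) := by
    intro V W
    have h2 : (fun w => η.eval W ((extChartAt (𝓡 n) x₀).symm w)) =ᶠ[𝓝 u]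
        fun w => η.inChart x₀ w (W.inChart x₀ w) :=
      ((isOpen_extChartAt_target x₀).eventually_mem hu).mono fun w hw =>
        η.eval_extChartAt_symm W hw
    rw [V.toEnd_eq_fderiv _ hu, h2.fderiv_eq, (((η.contDiffAt_inChart hu).differentiableAt
      (by simp)).hasFDerivAt.clm_apply (W.differentiableAt_inChart hu).hasFDerivAt).fderiv]
    rfl
  rw [h1, h1, η.eval_extChartAt_symm Z hu, inChart_bracket hZ hu, map_sub]
  ring

/-- A 1-form as a linear map on derivations. -/
noncomputable def toLinearMap [T2Space M] (η : SmoothOneForm n M) :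
    Derivation ℝ (SmoothFn n M) (SmoothFn n M) →ₗ[SmoothFn n M] SmoothFn n M where
  toFun δ := η.eval ((derivationEquiv n M).symm δ)
  map_add' δ δ' := by
    ext x
    rw [map_add]
    exact map_add (η x) _ _
  map_smul' a δ := by
    obtain ⟨X, rfl⟩ := toDerivation_surjective δ
    obtain ⟨Y, h1, h2⟩ := X.toDerivation_smul a
    ext x
    rw [← h2, derivationEquiv_symm_toDerivation, derivationEquiv_symm_toDerivation, eval_apply,
      h1]
    exact map_smul (η x) _ _

theorem toLinearMap_toDerivation [T2Space M] (η : SmoothOneForm n M)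
    (X : SmoothVectorField n M) : η.toLinearMap X.toDerivation = η.eval X :=
  congrArg η.eval (derivationEquiv_symm_toDerivation X)

/-- By Cartan's formula the defect of the cocycle identity is the antisymmetrized derivative of the
coefficients. Conversely, fields that are constant in the chart near a point realize all pairs of
vectors. -/
theorem isClosed_iff [T2Space M] (η : SmoothOneForm n M) :
    η.IsClosed ↔ ∀ δ δ' : Derivation ℝ (SmoothFn n M) (SmoothFn n M),
      η.toLinearMap ⁅δ, δ'⁆ = δ (η.toLinearMap δ') - δ' (η.toLinearMap δ) := by
  constructor
  · intro h δ δ'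
    obtain ⟨X, rfl⟩ := toDerivation_surjective δ
    obtain ⟨Y, rfl⟩ := toDerivation_surjective δ'
    obtain ⟨Z, hZ⟩ := toDerivation_surjective ⁅X.toDerivation, Y.toDerivation⁆
    rw [← hZ, toLinearMap_toDerivation, toLinearMap_toDerivation, toLinearMap_toDerivation]
    ext x
    obtain ⟨x₀, u, hu, rfl⟩ := exists_extChartAt_symm_eq (n := n) x
    have h1 := η.toEnd_eval_sub hZ hu
    rw [h x₀ u hu, sub_self, add_zero] at h1
    exact h1.symm
  · intro h x₀ u hu v w
    obtain ⟨X, hX⟩ := exists_inChart_eventuallyEq hu (V := fun _ => v) contDiffOn_const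
    obtain ⟨Y, hY⟩ := exists_inChart_eventuallyEq hu (V := fun _ => w) contDiffOn_const
    obtain ⟨Z, hZ⟩ := toDerivation_surjective ⁅X.toDerivation, Y.toDerivation⁆
    have h1 := η.toEnd_eval_sub hZ hu
    have h2 := h X.toDerivation Y.toDerivation
    rw [← hZ, toLinearMap_toDerivation, toLinearMap_toDerivation, toLinearMap_toDerivation] at h2
    rw [h2, hX.self_of_nhds, hY.self_of_nhds] at h1
    exact sub_eq_zero.1 (left_eq_add.1 h1)

end SmoothOneForm

end OneForms

/-! ### Maps linear over the functions are one-forms. -/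

section TensorialMaps

open Set Filter Topology SmoothVectorField

variable {n : ℕ} {M : Type*} [TopologicalSpace M] [ChartedSpace (EuclideanSpace ℝ (Fin n)) M]
  [IsManifold (𝓡 n) ∞ M] [T2Space M]

/-- A map that is linear over the smooth functions depends on the value of a vector field only. -/
theorem tensorial_apply_eq_zero
    (w : Derivation ℝ (SmoothFn n M) (SmoothFn n M) →ₗ[SmoothFn n M] SmoothFn n M)
    {X : SmoothVectorField n M} {x : M} (hX : X x = 0) : w X.toDerivation x = 0 := by
  obtain ⟨x₀, u, hu, rfl⟩ := exists_extChartAt_symm_eq (n := n) x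
  choose a ha using fun i : Fin n => exists_smoothFn_eventuallyEq_chart (n := n)
    ((extChartAt (𝓡 n) x₀).map_target hu) (h := fun w => X.inChart x₀ w i)
    ((EuclideanSpace.proj (𝕜 := ℝ) i).contDiff.comp_contDiffOn (X.contDiffOn_inChart x₀))
  choose Y hY using fun i : Fin n => exists_inChart_eventuallyEq (M := M) hu
    (V := fun _ => EuclideanSpace.single i (1 : ℝ)) contDiffOn_const
  -- The difference of `X` and its expansion in coordinate fields vanishes near the point, so a bump
  -- function kills it. On the expansion, `w` produces the factors `a i`, which are zero at the
  -- point.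
  set δ := X.toDerivation - ∑ i, a i • (Y i).toDerivation with hδ
  have hx := (extChartAt (𝓡 n) x₀).map_target hu
  have h0 : ∀ᶠ y in 𝓝 ((extChartAt (𝓡 n) x₀).symm u), ∀ g, δ g y = 0 := by
    have hc : ContinuousAt (extChartAt (𝓡 n) x₀) ((extChartAt (𝓡 n) x₀).symm u) :=
      (contMDiffAt_extChartAt_source hx).continuousAt
    rw [ContinuousAt, (extChartAt (𝓡 n) x₀).right_inv hu] at hc
    filter_upwards [eventually_all.2 ha, hc.eventually (eventually_all.2 hY),
      (isOpen_extChartAt_source x₀).eventually_mem hx] with y h1 h2 h3 g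
    obtain ⟨v, hv, rfl⟩ : ∃ v ∈ (extChartAt (𝓡 n) x₀).target, (extChartAt (𝓡 n) x₀).symm v = y :=
      ⟨_, (extChartAt (𝓡 n) x₀).map_source h3, (extChartAt (𝓡 n) x₀).left_inv h3⟩
    rw [(extChartAt (𝓡 n) x₀).right_inv hv] at h1 h2
    have h4 : X.inChart x₀ v = ∑ i, X.inChart x₀ v i • EuclideanSpace.single i (1 : ℝ) := by
      simpa using ((EuclideanSpace.basisFun (Fin n) ℝ).sum_repr (X.inChart x₀ v)).symm
    have h5 : δ g = X.toEnd g - ∑ i, a i * (Y i).toEnd g := by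
      rw [hδ, Derivation.sub_apply, ← Derivation.coeFnAddMonoidHom_apply (∑ i, _), map_sum,
        Finset.sum_apply]
      rfl
    rw [h5]
    change X.toEnd g ((extChartAt (𝓡 n) x₀).symm v)
      - (∑ i, a i * (Y i).toEnd g) ((extChartAt (𝓡 n) x₀).symm v) = 0
    rw [SmoothFn.sum_apply, X.toEnd_eq_fderiv g hv, h4, map_sum, sub_eq_zero]
    refine Finset.sum_congr rfl fun i _ => ?_
    change _ = a i ((extChartAt (𝓡 n) x₀).symm v) * (Y i).toEnd g ((extChartAt (𝓡 n) x₀).symm v)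
    rw [(Y i).toEnd_eq_fderiv g hv, h1 i, h2 i, map_smul, smul_eq_mul]
  obtain ⟨χ, hχ, hs⟩ := exists_bump (n := n) h0
  have h1 : χ • δ = 0 := by
    ext g y
    change χ y * δ g y = 0
    by_cases hy : y ∈ tsupport χ
    · rw [hs hy, mul_zero]
    · rw [image_eq_zero_of_notMem_tsupport hy, zero_mul]
  have h2 : w δ ((extChartAt (𝓡 n) x₀).symm u) = 0 := by
    have h3 : χ ((extChartAt (𝓡 n) x₀).symm u) * w δ ((extChartAt (𝓡 n) x₀).symm u) = 0 := by
      change (χ • w δ) ((extChartAt (𝓡 n) x₀).symm u) = 0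
      rw [← map_smul, h1, map_zero]
      rfl
    rwa [hχ.self_of_nhds, one_mul] at h3
  have h3 : X.toDerivation = δ + ∑ i, a i • (Y i).toDerivation := by rw [hδ, sub_add_cancel]
  have h4 : X.inChart x₀ u = 0 := by
    rw [X.inChart_eq hu, hX]
    exact map_zero (mfderiv (𝓡 n) 𝓘(ℝ, EuclideanSpace ℝ (Fin n)) (extChartAt (𝓡 n) x₀) _)
  rw [h3, map_add, map_sum]
  change w δ _ + (∑ i, w (a i • (Y i).toDerivation)) _ = 0
  rw [h2, zero_add, SmoothFn.sum_apply]
  refine Finset.sum_eq_zero fun i _ => ?_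
  rw [map_smul]
  change a i _ * _ = 0
  rw [(ha i).self_of_nhds, (extChartAt (𝓡 n) x₀).right_inv hu, h4]
  exact zero_mul _

/-- The form at `x` is `v ↦ w (E x v) x` for any field `E x v` that extends `v`; the choice is
irrelevant by tensoriality. -/
theorem exists_eq_toLinearMap
    (w : Derivation ℝ (SmoothFn n M) (SmoothFn n M) →ₗ[SmoothFn n M] SmoothFn n M) :
    ∃ η : SmoothOneForm n M, η.toLinearMap = w := by
  have hw : ∀ {X Y : SmoothVectorField n M} {x : M}, X x = Y x →
      w X.toDerivation x = w Y.toDerivation x := by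
    intro X Y x h
    have h1 : (X - Y) x = 0 := sub_eq_zero.2 h
    have h2 : (X - Y).toDerivation = X.toDerivation - Y.toDerivation :=
      map_sub (derivationEquiv n M) X Y
    have h3 := tensorial_apply_eq_zero w h1
    rw [h2, map_sub] at h3
    exact sub_eq_zero.1 h3
  choose E hE using fun (x : M) (v : TangentSpace (𝓡 n) x) => exists_vectorField_apply_eq v
  let η₀ : M → EuclideanSpace ℝ (Fin n) →ₗ[ℝ] ℝ := fun x =>
    { toFun := fun v => w (E x v).toDerivation x
      map_add' := fun v v' => by
        refine (hw (Y := E x v + E x v')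
          ((hE x _).trans (congrArg₂ (· + ·) (hE x v) (hE x v')).symm)).trans ?_
        rw [toDerivation_add, map_add]
        rfl
      map_smul' := fun c v => by
        refine (hw (Y := c • E x v)
          ((hE x _).trans (congrArg (c • ·) (hE x v)).symm)).trans ?_
        rw [toDerivation_const_smul]
        change w (algebraMap ℝ (SmoothFn n M) c • (E x v).toDerivation) x = _
        rw [map_smul]
        rfl }
  let η₂ : M → EuclideanSpace ℝ (Fin n) →L[ℝ] ℝ := fun x => LinearMap.toContinuousLinearMap (η₀ x)
  let η₁ : (x : M) → TangentSpace (𝓡 n) x →L[ℝ] Bundle.Trivial M ℝ x := η₂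
  have hη₁ : ∀ (X : SmoothVectorField n M) x, η₁ x (X x) = w X.toDerivation x := fun X x =>
    hw (hE x (X x))
  have hsm : ContMDiff (𝓡 n) ((𝓡 n).prod 𝓘(ℝ, EuclideanSpace ℝ (Fin n) →L[ℝ] ℝ)) ∞
      (fun x => Bundle.TotalSpace.mk' (EuclideanSpace ℝ (Fin n) →L[ℝ] ℝ)
        (E := fun x : M => TangentSpace (𝓡 n) x →L[ℝ] Bundle.Trivial M ℝ x) x (η₁ x)) := by
    intro x₀
    rw [contMDiffAt_hom_bundle]
    refine ⟨contMDiffAt_id, ?_⟩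
    choose Y hY using fun i : Fin n => exists_vectorField_eventuallyEq
      (mem_extChartAt_source (I := 𝓡 n) x₀) (V := fun _ => EuclideanSpace.single i (1 : ℝ))
      contDiffOn_const
    -- In the trivialization the form is `∑ w (Y i) dxⁱ` near `x₀`, for fields `Y i` that agree
    -- there with the coordinate fields.
    have h1 : ContMDiffAt (𝓡 n) 𝓘(ℝ, EuclideanSpace ℝ (Fin n) →L[ℝ] ℝ) ∞
        (fun x => ∑ i, w (Y i).toDerivation x • EuclideanSpace.proj (𝕜 := ℝ) i) x₀ :=
      contMDiffAt_finsetSum fun i _ => (w (Y i).toDerivation).contMDiff.contMDiffAt.smul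
        contMDiffAt_const
    refine h1.congr_of_eventuallyEq ?_
    filter_upwards [eventually_all.2 hY, extChartAt_source_mem_nhds (I := 𝓡 n) x₀] with x h2 h3
    rw [extChartAt_source] at h3
    have h4 : ∀ (T : EuclideanSpace ℝ (Fin n) →L[ℝ] ℝ) v,
        T v = ∑ i, T (EuclideanSpace.single i 1) * v i := fun T v => by
      have hv : v = ∑ i, v i • EuclideanSpace.single i (1 : ℝ) := by
        simpa using ((EuclideanSpace.basisFun (Fin n) ℝ).sum_repr v).symm
      conv_lhs => rw [hv, map_sum]
      simp [mul_comm]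
    have h5 : ∀ i, η₁ x (mfderiv 𝓘(ℝ, EuclideanSpace ℝ (Fin n)) (𝓡 n) (extChartAt (𝓡 n) x₀).symm
        (extChartAt (𝓡 n) x₀ x) (EuclideanSpace.single i (1 : ℝ))) = w (Y i).toDerivation x :=
      fun i => by rw [← h2 i, hη₁]
    have h6 := TangentBundle.symmL_trivializationAt (𝕜 := ℝ) (I := 𝓡 n) h3
    rw [modelWithCornersSelf_coe, range_id, mfderivWithin_univ] at h6
    ext1 v
    have h7 : (trivializationAt ℝ (Bundle.Trivial M ℝ) x₀).continuousLinearMapAt ℝ x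
        = ContinuousLinearMap.id ℝ ℝ := Bundle.Trivial.continuousLinearMapAt_trivialization ℝ M ℝ x
    rw [ContinuousLinearMap.inCoordinates, h6, h7]
    refine (h4 ((η₂ x).comp (mfderiv 𝓘(ℝ, EuclideanSpace ℝ (Fin n)) (𝓡 n)
      (extChartAt (𝓡 n) x₀).symm (extChartAt (𝓡 n) x₀ x))) v).trans ?_
    rw [sum_apply]
    exact Finset.sum_congr rfl fun i _ => congrArg (· * v i) (h5 i)
  refine ⟨⟨η₁, hsm⟩, LinearMap.ext fun δ => ?_⟩
  obtain ⟨X, rfl⟩ := toDerivation_surjective δ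
  rw [SmoothOneForm.toLinearMap_toDerivation]
  ext x
  exact hη₁ X x

end TensorialMaps

/-! ### The standard form in algebraic terms. -/

section StandardForm

open SmoothVectorField

variable {n : ℕ} {M : Type*} [TopologicalSpace M] [ChartedSpace (EuclideanSpace ℝ (Fin n)) M]

instance SmoothFn.isReduced : IsReduced (SmoothFn n M) :=
  isReduced_of_injective (ContMDiffMap.coeFnRingHom : SmoothFn n M →+* M → ℝ)
    DFunLike.coe_injective

theorem SmoothFn.nontrivial [Nonempty M] : Nontrivial (SmoothFn n M) :=
  ⟨0, 1, fun h => zero_ne_one (α := ℝ) (DFunLike.congr_fun h (Classical.arbitrary M))⟩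

/-- The evaluation of smooth functions at a point. -/
noncomputable def SmoothFn.evalAlgHom (x : M) : SmoothFn n M →ₐ[ℝ] ℝ where
  toFun f := f x
  map_one' := rfl
  map_mul' _ _ := rfl
  map_zero' := rfl
  map_add' _ _ := rfl
  commutes' _ := rfl

variable [IsManifold (𝓡 n) ∞ M] [T2Space M]

/-- The map `X ↦ l div X + η(X)` on derivations. -/
noncomputable def standardCocycle {ρ : SmoothDensity n M} (hρ : ρ.IsNowhereVanishing) (l : ℝ)
    (η : SmoothOneForm n M) :
    Derivation ℝ (SmoothFn n M) (SmoothFn n M) →ₗ[ℝ] SmoothFn n M :=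
  l • divergenceMap hρ + η.toLinearMap.restrictScalars ℝ

theorem standardCocycle_apply {ρ : SmoothDensity n M} (hρ : ρ.IsNowhereVanishing) (l : ℝ)
    (η : SmoothOneForm n M) (δ : Derivation ℝ (SmoothFn n M) (SmoothFn n M)) :
    standardCocycle hρ l η δ = l • divergenceMap hρ δ + η.toLinearMap δ := rfl

theorem standardCocycle_toDerivation_apply {ρ : SmoothDensity n M} (hρ : ρ.IsNowhereVanishing)
    (l : ℝ) (η : SmoothOneForm n M) (X : SmoothVectorField n M) (x : M) :
    standardCocycle hρ l η X.toDerivation x = l * divergence ρ X x + η x (X x) := by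
  rw [standardCocycle_apply, divergenceMap_toDerivation, η.toLinearMap_toDerivation]
  rfl

/-- The divergence satisfies the identity by itself, so the condition falls on `η` alone. -/
theorem standardCocycle_lie_iff {ρ : SmoothDensity n M} (hρ : ρ.IsNowhereVanishing) (l : ℝ)
    (η : SmoothOneForm n M) :
    (∀ δ δ', standardCocycle hρ l η ⁅δ, δ'⁆
      = δ (standardCocycle hρ l η δ') - δ' (standardCocycle hρ l η δ)) ↔ η.IsClosed := by
  rw [η.isClosed_iff]
  refine forall₂_congr fun δ δ' => ?_
  simp only [standardCocycle_apply, divergenceMap_lie, map_add, Derivation.map_smul, smul_sub]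
  constructor <;> intro h <;> linear_combination h

/-- Testing on `g ∘ φ⁻¹` turns the push-forward into a conjugation, which is the shape of the
formula in the algebraic theorems. -/
theorem hasStandardForm_iff {ρ : SmoothDensity n M} (hρ : ρ.IsNowhereVanishing)
    {Φ : diffOpOne ℝ (SmoothFn n M) →ₗ[ℝ] diffOpOne ℝ (SmoothFn n M)}
    {φ : M ≃ₘ^∞⟮𝓡 n, 𝓡 n⟯ M} {κ l : ℝ} {η : SmoothOneForm n M} :
    HasStandardForm ρ Φ φ κ l η ↔
      ∀ f (δ : Derivation ℝ (SmoothFn n M) (SmoothFn n M)) g,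
        (Φ (derivationOp f δ)).1 (compSymmAlgEquiv φ g)
          = compSymmAlgEquiv φ ((κ • f + standardCocycle hρ l η δ) * g + δ g) := by
  have key : ∀ (f : SmoothFn n M) (X : SmoothVectorField n M) (g : SmoothFn n M) x,
      compSymmAlgEquiv φ ((κ • f + standardCocycle hρ l η X.toDerivation) * g
          + X.toDerivation g) x
        = (κ * f (φ.symm x) + l * divergence ρ X (φ.symm x) + η (φ.symm x) (X (φ.symm x)))
          * compSymmAlgEquiv φ g x + pushforwardOp φ X (compSymmAlgEquiv φ g) x := by
    intro f X g x
    rw [pushforwardOp_eq, compSymmAlgEquiv_apply, compSymmAlgEquiv_apply, compSymmAlgEquiv_apply,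
      add_assoc (κ * f (φ.symm x)), ← standardCocycle_toDerivation_apply]
    rfl
  constructor
  · intro h f δ g
    obtain ⟨X, rfl⟩ := toDerivation_surjective δ
    ext x
    rw [key, derivationOp_toDerivation]
    exact h f X _ x
  · intro h f X g x
    obtain ⟨g, rfl⟩ := (compSymmAlgEquiv φ).surjective g
    rw [← key, ← derivationOp_toDerivation, h]

/-- The defect `c (a X) - a c X = l X a` determines `l`, because not all derivatives vanish; the
forms are then compared at points. -/
theorem standardCocycle_injective [SigmaCompactSpace M] [Nonempty M] (hn : 1 ≤ n)
    {ρ : SmoothDensity n M} (hρ : ρ.IsNowhereVanishing) {l l' : ℝ} {η η' : SmoothOneForm n M}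
    (h : ∀ δ, standardCocycle hρ l η δ = standardCocycle hρ l' η' δ) : l = l' ∧ η = η' := by
  have hl : l = l' := by
    by_contra hne
    have h1 : ∀ (δ : Derivation ℝ (SmoothFn n M) (SmoothFn n M)) a, δ a = 0 := by
      intro δ a
      have h2 := h (a • δ)
      have h3 := h δ
      simp only [standardCocycle_apply, divergenceMap_smul, map_smul, smul_add,
        smul_eq_mul] at h2 h3
      have h4 : (l - l') • δ a = 0 := by
        rw [sub_smul]
        simp only [Algebra.smul_def] at h2 h3 ⊢
        linear_combination h2 - a * h3
      exact (smul_eq_zero.1 h4).resolve_left (sub_ne_zero.2 hne)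
    have h2 : (1 : SmoothFn n M) ∈ derivativeIdeal ℝ (SmoothFn n M) := by
      rw [derivativeIdeal_eq_top hn]
      trivial
    have h3 : derivativeIdeal ℝ (SmoothFn n M) = ⊥ := by
      rw [derivativeIdeal, Ideal.span_eq_bot]
      rintro _ ⟨X, a, rfl⟩
      exact h1 X a
    have := SmoothFn.nontrivial (n := n) (M := M)
    rw [h3] at h2
    exact one_ne_zero h2
  subst hl
  refine ⟨rfl, ?_⟩
  ext x v
  obtain ⟨X, rfl⟩ := exists_vectorField_apply_eq v
  have h1 := DFunLike.congr_fun (h X.toDerivation) x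
  rw [standardCocycle_toDerivation_apply, standardCocycle_toDerivation_apply] at h1
  exact add_left_cancel h1

end StandardForm

/-! ### The theorem on automorphisms. -/

theorem mainTheorem5 {n : ℕ} (hn : 1 ≤ n) {M : Type*} [TopologicalSpace M] [T2Space M]
    [SecondCountableTopology M] [ConnectedSpace M]
    [ChartedSpace (EuclideanSpace ℝ (Fin n)) M] [IsManifold (𝓡 n) ∞ M]
    (ρ : SmoothDensity n M) (hρ : ρ.IsNowhereVanishing) :
    -- `D¹(M) = C^∞(M) ⊕ 𝔛(M)`
    (∀ D : diffOpOne ℝ (SmoothFn n M),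
      ∃! p : SmoothFn n M × SmoothVectorField n M, firstOrderOp p.1 p.2 = D) ∧
    -- a linear map is an automorphism if and only if it has the standard form
    (∀ Φ : diffOpOne ℝ (SmoothFn n M) →ₗ[ℝ] diffOpOne ℝ (SmoothFn n M),
      IsLieAutomorphism Φ ↔
        ∃ (φ : M ≃ₘ^∞⟮𝓡 n, 𝓡 n⟯ M) (κ l : ℝ) (η : SmoothOneForm n M),
          κ ≠ 0 ∧ η.IsClosed ∧ HasStandardForm ρ Φ φ κ l η) ∧
    -- all data occur
    (∀ (φ : M ≃ₘ^∞⟮𝓡 n, 𝓡 n⟯ M) (κ l : ℝ) (η : SmoothOneForm n M),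
      κ ≠ 0 → η.IsClosed →
        ∃ Φ : diffOpOne ℝ (SmoothFn n M) →ₗ[ℝ] diffOpOne ℝ (SmoothFn n M),
          IsLieAutomorphism Φ ∧ HasStandardForm ρ Φ φ κ l η) ∧
    -- the data are determined by the map
    (∀ (Φ : diffOpOne ℝ (SmoothFn n M) →ₗ[ℝ] diffOpOne ℝ (SmoothFn n M))
      (φ φ' : M ≃ₘ^∞⟮𝓡 n, 𝓡 n⟯ M) (κ κ' l l' : ℝ) (η η' : SmoothOneForm n M),
      κ ≠ 0 → κ' ≠ 0 → η.IsClosed → η'.IsClosed →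
        HasStandardForm ρ Φ φ κ l η → HasStandardForm ρ Φ φ' κ' l' η' →
          φ = φ' ∧ κ = κ' ∧ l = l' ∧ η = η') := by
  have : LocallyCompactSpace M := ChartedSpace.locallyCompactSpace (EuclideanSpace ℝ (Fin n)) M
  have : Nontrivial (SmoothFn n M) := SmoothFn.nontrivial
  have hI := derivativeIdeal_eq_top (M := M) hn
  have hconst : ∀ f : SmoothFn n M, (∀ δ : Derivation ℝ (SmoothFn n M) (SmoothFn n M), δ f = 0) →
      ∃ c : ℝ, f = algebraMap ℝ (SmoothFn n M) c := fun f hf =>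
    eq_const_of_forall_toEnd_eq_zero fun X => hf X.toDerivation
  have hpts : ∀ f : SmoothFn n M, (∀ χ : SmoothFn n M →ₐ[ℝ] ℝ, χ f = 0) → f = 0 := fun f hf => by
    ext x
    exact hf (SmoothFn.evalAlgHom x)
  have hexists : ∀ (φ : M ≃ₘ^∞⟮𝓡 n, 𝓡 n⟯ M) (κ l : ℝ) (η : SmoothOneForm n M),
      κ ≠ 0 → η.IsClosed →
        ∃ Φ : diffOpOne ℝ (SmoothFn n M) →ₗ[ℝ] diffOpOne ℝ (SmoothFn n M),
          IsLieAutomorphism Φ ∧ HasStandardForm ρ Φ φ κ l η := by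
    intro φ κ l η hκ hη
    obtain ⟨Φ, h1, h2⟩ := exists_isLieAutomorphism (compSymmAlgEquiv φ) κ hκ
      (standardCocycle hρ l η) ((standardCocycle_lie_iff hρ l η).2 hη)
    exact ⟨Φ, h1, (hasStandardForm_iff hρ).2 h2⟩
  refine ⟨fun D => ?_, fun Φ => ⟨fun hΦ => ?_, ?_⟩, hexists, ?_⟩
  · obtain ⟨f, δ, rfl⟩ := exists_derivationOp_eq D
    obtain ⟨X, rfl⟩ := SmoothVectorField.toDerivation_surjective δ
    refine ⟨(f, X), rfl, fun p hp => ?_⟩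
    obtain ⟨h1, h2⟩ := derivationOp_injective (f := p.1) (X := p.2.toDerivation) hp
    exact Prod.ext h1 (SmoothVectorField.toDerivation_injective h2)
  · obtain ⟨σ, κ, c, hκ, hc, h⟩ := hΦ.exists_algEquiv hI hconst
    obtain ⟨φ, hφ⟩ := exists_diffeomorph_of_algEquiv σ
    obtain rfl : σ = compSymmAlgEquiv φ := AlgEquiv.ext fun f => by
      ext x
      exact hφ f x
    obtain ⟨l, w, hw⟩ := cocycle_eq_divergence_add hI hconst hpts (divergenceMap hρ)
      (divergenceMap_smul hρ) c hc
    obtain ⟨η, rfl⟩ := exists_eq_toLinearMap w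
    obtain rfl : c = standardCocycle hρ l η := LinearMap.ext hw
    exact ⟨φ, κ, l, η, hκ, (standardCocycle_lie_iff hρ l η).1 hc, (hasStandardForm_iff hρ).2 h⟩
  · rintro ⟨φ, κ, l, η, hκ, hη, h⟩
    obtain ⟨Φ', h1, h2⟩ := hexists φ κ l η hκ hη
    -- The formula prescribes `Φ` on all `f + X`, hence everywhere.
    obtain rfl : Φ = Φ' := LinearMap.ext fun D => by
      obtain ⟨f, δ, rfl⟩ := exists_derivationOp_eq D
      obtain ⟨X, rfl⟩ := SmoothVectorField.toDerivation_surjective δ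
      refine Subtype.ext (LinearMap.ext fun g => ?_)
      ext x
      exact (h f X g x).trans (h2 f X g x).symm
    exact h1
  · intro Φ φ φ' κ κ' l l' η η' hκ _ _ _ h h'
    rw [hasStandardForm_iff hρ] at h h'
    -- The value at the constant function `1` isolates the zeroth-order part. In it, `f = 1` with `X
    -- = 0` gives `κ`, general `f` with `X = 0` gives `φ`, and `f = 0` gives the cocycle.
    have h1 : ∀ f δ, compSymmAlgEquiv φ (κ • f + standardCocycle hρ l η δ)
        = compSymmAlgEquiv φ' (κ' • f + standardCocycle hρ l' η' δ) := by
      intro f δ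
      have h2 := h f δ 1
      have h3 := h' f δ 1
      rw [map_one, Derivation.map_one_eq_zero, mul_one, add_zero] at h2 h3
      exact h2.symm.trans h3
    have hκ' : κ = κ' := by
      have h2 := h1 1 0
      rw [map_zero, map_zero, add_zero, add_zero, map_smul, map_smul, map_one, map_one] at h2
      have h3 := DFunLike.congr_fun h2 (Classical.arbitrary M)
      simpa using h3
    subst hκ'
    have hφ : φ = φ' := by
      have h2 : ∀ x, φ.symm x = φ'.symm x := fun x =>
        eq_of_forall_smoothFn_eq (n := n) fun f => by
          have h3 := h1 f 0
          rw [map_zero, map_zero, add_zero, map_smul, map_smul] at h3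
          exact DFunLike.congr_fun (smul_right_injective _ hκ h3) x
      refine Diffeomorph.ext fun y => ?_
      have h3 := h2 (φ y)
      rw [φ.symm_apply_apply] at h3
      conv_rhs => rw [h3, φ'.apply_symm_apply]
    subst hφ
    have h2 : ∀ δ, standardCocycle hρ l η δ = standardCocycle hρ l' η' δ := fun δ => by
      have h3 := h1 0 δ
      rw [smul_zero, zero_add, zero_add] at h3
      exact (compSymmAlgEquiv φ).injective h3
    obtain ⟨h3, h4⟩ := standardCocycle_injective hn hρ h2
    exact ⟨rfl, rfl, h3, h4⟩
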